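/- **Setting.** Fix $\delta\in(0,1/2)$ and $\mathcal U=[\delta,1-\delta]$; let $\Theta\subset\mathbb R^{d_\theta}$ and $\Gamma\subset\mathbb R^{d_\rho}$ be compact, $d_\rho\ge d_\theta$. The process $(\nu_t,w_t)_{t\ge1}$ is strictly stationary and ergodic with values in a measurable space ($\nu_t$ is the structural noise, e.g. i.i.d. white noise; $w_t$ drives the regressors and may contain lags of $\nu$). For $\theta\in\mathbb R^{d_\theta}$ put $y_t(\theta)=r(\varphi(\nu_t;\theta);\theta)\in\mathbb R$ and $z_{v,t}(\theta)=\zeta(v,w_t;\theta)\in\mathbb R^{d_z}$. The observations are $Y_{t,T}=r(\varphi(\nu_t;\theta_0(t/T));\theta_0(t/T))$ and regressors $Z_{t,T}$, $1\le t\le T$; $\theta_0$ is the unknown function, $\theta_0(\mathcal U)\subset\Theta$. For $j=1,\dots,H$ ($H\ge1$), $(\tilde\nu^{[j]}_t,\tilde w^{[j]}_t)_{t\ge 1}$ has the same law as $(\nu_t,w_t)_{t\ge 1}$, and $\tilde y^{[j]}_t(\theta),\tilde z^{[j]}_{v,t}(\theta)$ are the corresponding simulated series. With criterion $g[y;f(z,\rho)]$,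 score $q=\partial g[y;f(z,\rho)]/\partial\rho$, kernel $K$ and bandwidth $h=h_T$, put $$M_T[\rho;v]=\frac1{Th}\sum_{t=1}^T g[Y_{t,T};f(Z_{t,T},\rho)]K\Big(\frac{v-t/T}{h}\Big),\qquad \Psi_T(\rho;v)=\frac1{Th}\sum_{t=1}^T q[Y_{t,T};f(Z_{t,T},\rho)]K\Big(\frac{v-t/T}{h}\Big),$$ $\mathbb M_0[\rho;v]=\lim_T E M_T[\rho;v]$, $\Psi_0=\partial\mathbb M_0/\partial\rho$. For $v\in\mathcal U$, $\rho_0(v):=\rho_0(v;\theta_0(v))$ minimizes $\mathbb M_0[\cdot;v]$ over $\Gamma$ and, for $\theta\in\Theta$, $\rho_0(v;\theta)$ is the unique minimizer over $\Gamma$ of $\lim_T T^{-1}\sum_{t\le T}E g[\tilde y^{[j]}_t(\theta);f(\tilde z^{[j]}_{v,t}(\theta),\rho)]$ (with finite expectations). Put $\mathcal E_v=\{\rho\in\Gamma:\|\rho-\rho_0(v)\|\le\varepsilon\}$ for some $\varepsilon>0$. **Estimators.** $\hat\rho(u)$ minimizes $M_T[\cdot;u]$ over $\Gamma$; $\hat\rho^{[j]}(u;\theta)$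 minimizes $T^{-1}\sum_{t\le T} g[\tilde y^{[j]}_t(\theta);f(\tilde z^{[j]}_{u,t}(\theta),\rho)]$ over $\rho\in\Gamma$ for every $\theta\in\Theta$; $\hat\rho(u;\theta)=H^{-1}\sum_{j}\hat\rho^{[j]}(u;\theta)$; and, for a symmetric positive definite matrix $\Omega$, $\hat\theta(u)$ is a measurable maximizer of $-(\hat\rho(u)-\hat\rho(u;\theta))'\Omega(\hat\rho(u)-\hat\rho(u;\theta))$ over $\theta\in\Theta$ (each of these optimality properties holding with probability tending to one). **Assumptions.** 1. $\theta_0$ is twice differentiable on $\mathcal U$ with bounded second derivative. For each $x$, $\theta\mapsto r(\varphi(x;\theta);\theta)$ is $C^2$, with second derivative bounded, uniformly over the convex hull of $\Theta$, by a constant or more generally by some $B(x)$ with $E|B(\nu_t)|<\infty$. 2. The array $(Y_{t,T},Z_{t,T})$ is locally stationary: with $x_{v,t}=(y_t(\theta_0(v)),z_{v,t}(\theta_0(v)))$, which is strictly stationary for each $v\in[0,1]$, a.s. $\max_{t\le T}\|(Y_{t,T},Z_{t,T})-x_{t/T,t}\|\le C_T/T$ for all $T$, where $\sup_TE|C_T|^\eta<\infty$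 for some $\eta>0$. It is $\phi$-mixing: $\phi(k)=\sup|P(B|A)-P(B)|\to0$, the supremum being over $T$, $t$, events $A$ with $P(A)>0$ generated by $(Y_{i,T},Z_{i,T})_{i\le t}$ and $B$ generated by $(Y_{i,T},Z_{i,T})_{i\ge t+k}$; and for some $1\le m_T\le T$, $\sup_T T\phi(m_T)/m_T<\infty$. For $\theta\in\Theta$, $y_t(\theta)$ has finite second moment, constant mean and shift-invariant covariances. For $v\in\mathcal U$, $\zeta(v,x;\theta)$ is $C^2$ in $\theta$ with first two derivatives dominated over the convex hull of $\Theta$ by some $B_v(x)$ with $E|B_v(w_t)|<\infty$ (void for exogenous regressors). 3. For all $v\in\mathcal U$: $(y,z,\rho)\mapsto g[y;f(z,\rho)]$ is $C^2$ with bounded first and second derivatives, and for all $t\le T$, $\sup_{\rho\in\mathcal E_v}E|g[Y_{t,T};f(Z_{t,T},\rho)]|<\infty$; $f$ is measurable in $z$, satisfies $|f(z,\rho_1)-f(z,\rho_2)|\le b(z)\|\rho_1-\rho_2\|$ on $\Gamma$ for some function $b$, is twice differentiable in $\rho$ at each point of $\mathcal E_v$, $\sup_{\rho\in\mathcal E_v}E|f(Z_{t,T},\rho)|<\infty$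 and $\sup_{\rho\in\mathcal E_v}f(z,\rho)\le\bar f(z)$ with $E|\bar f(Z_{t,T})|<\infty$. The limit $\mathbb M_0[\rho;v]$ exists for all $\rho\in\mathbb R^{d_\rho}$ and is differentiable in $\rho$ on $\Gamma$; $\rho_0(v)$ is the unique zero of $\Psi_0(\cdot;v)$ in $\Gamma$, and for each $a>0$ there is $\eta>0$ with $\mathbb M_0[\rho;v]-\mathbb M_0[\rho_0(v);v]\ge\eta$ for all $\rho\in\Gamma$ with $\|\rho-\rho_0(v)\|>a$. For each $e>0$ there are $a_1,a_2>0$ such that $E g[y_{u_1,t};f(z_{u_1,t},\rho_1)]$ and $E g[y_{u_2,t};f(z_{u_2,t},\rho_2)]$ are finite and differ by at most $e$ whenever $u_1\in\mathcal U$, $\rho_1\in\mathcal E_{u_1}$, $u_2\in[0,1]$, $|u_2-u_1|\le a_1$, $\rho_2\in\Gamma$, $\|\rho_2-\rho_1\|\le a_2$, where $(y_{v,t},z_{v,t})=x_{v,t}$. The map $\theta\mapsto\rho_0(v;\theta)$ is continuous and injective on $\Theta$. 4. $K\ge0$ is even, bounded, Lipschitz and $s$ times continuously differentiable for some $s\ge2$;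 $\int K=1$, $\kappa_2=\int K^2<\infty$; either $K$ has bounded support or $|K'|\le C$ and $|K'(x)|\le C|x|^{-p}$ for $|x|>L$, for some $p>1$ and $L>0$; $\int x^iK=0$ for $1\le i<s$, $\int x^sK\ne0$, $\int|x|^s|K|<\infty$, $|x|K(x)\to0$ as $|x|\to\infty$. Further $h>0$, $h\to0$, $Th\to\infty$, $Th/(m_T\log T)\to\infty$. 5. For the fixed $u\in\mathcal U$: there are positive semidefinite matrices $V(v)$, $v\in\mathcal U$, with $0<\inf_{\mathcal U}\|V\|\le\sup_{\mathcal U}\|V\|<\infty$ ($V(u)$ is the long-run variance of the local score), such that $\sqrt{Th}\,\Psi_T(\rho_0(u);u)\to_d N(0,\kappa_2V(u))$ and, for each $j$, $T^{-1/2}\sum_{t\le T}q[\tilde y^{[j]}_t(\theta_0(u));f(\tilde z^{[j]}_{u,t}(\theta_0(u)),\rho_0(u))]\to_dN(0,V(u))$. For some $\varepsilon'>0$, $\sup_{v\in\mathcal U}\sup_{\rho\in\Gamma,\|\rho-\rho_0(v)\|\le\varepsilon'}\|\partial\Psi_T(\rho;v)/\partial\rho'-\partial\Psi_0(\rho;v)/\partial\rho'\|=o_p(1)$.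 $\Psi_0$ is differentiable in $\rho$, and $\Psi_0$ and $\partial\Psi_0/\partial\rho'$ are Lipschitz in $(v,\rho)\in\mathcal U\times\Gamma$; $\partial\Psi_0(\rho_0(v);v)/\partial\rho'$ is invertible for all $v\in\mathcal U$. The function $v\mapsto\rho_0(v;\theta_0(v))$ has bounded first and second derivatives on $\mathcal U$; $\theta\mapsto\rho_0(u;\theta)$ is differentiable at $\theta_0(u)$ and $\partial\rho_0(u;\theta_0(u))/\partial\theta'$ has full column rank. 6. $\theta_0(u)$ is an interior point of $\Theta$ and $\rho_0(u)$ an interior point of $\Gamma$. (Measurability of $\nu_t,w_t,\tilde\nu^{[j]}_t,\tilde w^{[j]}_t,Z_{t,T},B,B_v,C_T$ and, in the noise variable, of $r(\varphi(\cdot;\theta);\theta)$ and $\zeta(v,\cdot;\theta)$ is understood.) **Conclusion.** If moreover $Th^3\to0$, then $Q(u)$ is invertible and, as $T\to\infty$, $$\sqrt{Th}\,\big[\hat\theta(u)-\theta_0(u)\big]\to_d N\big(0,\ \kappa_2\,[Q^{-1}W\,V\,W'Q^{-1}](u)\big),$$ $$Q(u)=\frac{\partial\rho_0(u;\theta)'}{\partial\theta}\,\Omega\,\frac{\partial\rho_0(u;\theta)}{\partial\theta'}\Big|_{\theta=\theta_0(u)},\qquad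 W(u)=\frac{\partial\rho_0(u;\theta)'}{\partial\theta}\,\Omega\,\Big(\frac{\partial\Psi_0(\rho;u)}{\partial\rho'}\Big)^{-1}\Big|_{\theta=\theta_0(u),\,\rho=\rho_0(u)} .$$ The limit law is the same for every number $H\ge1$ of simulated paths (there is no factor $1+1/H$). -/

import Mathlib

open MeasureTheory ProbabilityTheory Filter Topology
open scoped Matrix ENNReal

noncomputable section

/-- The Euclidean space `ℝᵈ`. -/
abbrev Vec (d : ℕ) : Type := EuclideanSpace ℝ (Fin d)

/-- The Jacobian matrix `∂F/∂x'` of `F : ℝⁿ → ℝᵐ` at `x`: the entry `(i, j)` is `∂Fᵢ/∂xⱼ`. -/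
def jacobian {n m : ℕ} (F : Vec n → Vec m) (x : Vec n) : Matrix (Fin m) (Fin n) ℝ :=
  Matrix.of fun i j => (fderiv ℝ F x (EuclideanSpace.single j 1)) i

/-- The path `(X₁, X₂, …)` of a process indexed by `t ≥ 1`. -/
def pathOf {Ω S : Type*} (X : ℕ → Ω → S) (ω : Ω) : ℕ → S := fun n => X (n + 1) ω

/-- The left shift on one-sided sequences. -/
def leftShift {S : Type*} (x : ℕ → S) : ℕ → S := fun n => x (n + 1)

/-- Strict stationarity of `(X_t)_{t ≥ 1}`: the law of the path is shift invariant. -/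
def StrictlyStationary {Ω S : Type*} [MeasurableSpace Ω] [MeasurableSpace S]
    (P : Measure Ω) (X : ℕ → Ω → S) : Prop :=
  MeasurePreserving leftShift (P.map (pathOf X)) (P.map (pathOf X))

/-- `(X_t)_{t ≥ 1}` is strictly stationary and ergodic: the shift is measure preserving and ergodic
for the law of the path. -/
def StationaryErgodic {Ω S : Type*} [MeasurableSpace Ω] [MeasurableSpace S]
    (P : Measure Ω) (X : ℕ → Ω → S) : Prop :=
  Ergodic leftShift (P.map (pathOf X))

/-- The triangular array `X T t` (`1 ≤ t ≤ T`) is locally stationary with stationary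
approximations `x v t`, `v ∈ [0,1]`: almost surely
`max_{1 ≤ t ≤ T} ‖X T t - x (t/T) t‖ ≤ C_T / T` for every `T`,
where `sup_T E |C_T|^η < ∞` for some `η > 0`. -/
def LocallyStationary {Ω E : Type*} [MeasurableSpace Ω] [NormedAddCommGroup E] [MeasurableSpace E]
    (P : Measure Ω) (X : ℕ → ℕ → Ω → E) (x : ℝ → ℕ → Ω → E) : Prop :=
  (∀ v ∈ Set.Icc (0 : ℝ) 1, StrictlyStationary P (x v)) ∧
  ∃ (C : ℕ → Ω → ℝ) (η : ℝ) (B : ℝ), 0 < η ∧ (∀ T, Measurable (C T)) ∧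
    (∀ T, ∫⁻ ω, ENNReal.ofReal (|C T ω| ^ η) ∂P ≤ ENNReal.ofReal B) ∧
    ∀ T : ℕ, 1 ≤ T → ∀ᵐ ω ∂P, ∀ t ∈ Finset.Icc 1 T,
      ‖X T t ω - x ((t : ℝ) / T) t ω‖ ≤ C T ω / T

/-- The `σ`-field generated by the entries `X T i`, `1 ≤ i ≤ T`, `i ≤ t`, of a row. -/
@[reducible]
def pastField {Ω S : Type*} [MeasurableSpace S] (X : ℕ → ℕ → Ω → S) (T t : ℕ) :
    MeasurableSpace Ω :=
  ⨆ i ∈ {i : ℕ | 1 ≤ i ∧ i ≤ T ∧ i ≤ t}, MeasurableSpace.comap (X T i) inferInstance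

/-- The `σ`-field generated by the entries `X T i`, `1 ≤ i ≤ T`, `s ≤ i`, of a row. -/
@[reducible]
def futureField {Ω S : Type*} [MeasurableSpace S] (X : ℕ → ℕ → Ω → S) (T s : ℕ) :
    MeasurableSpace Ω :=
  ⨆ i ∈ {i : ℕ | 1 ≤ i ∧ i ≤ T ∧ s ≤ i}, MeasurableSpace.comap (X T i) inferInstance

/-- The `φ`-mixing coefficient of a triangular array at lag `k`: the supremum of
`|P(B | A) - P(B)|` over all rows `T`, all times `t`, all events `A` of the past up to `t` with
`P(A) > 0` and all events `B` of the future from `t + k` on. -/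
def phiMixingCoeff {Ω S : Type*} [MeasurableSpace Ω] [MeasurableSpace S]
    (P : Measure Ω) (X : ℕ → ℕ → Ω → S) (k : ℕ) : ℝ :=
  sSup {x : ℝ | ∃ (T t : ℕ) (A B : Set Ω), MeasurableSet[pastField X T t] A ∧
    MeasurableSet[futureField X T (t + k)] B ∧ 0 < P.real A ∧
    x = |P.real (A ∩ B) / P.real A - P.real B|}

/-- The ingredients of local indirect inference (data only; all conditions on them are stated
below). `dθ`, `dρ`, `dz` are the dimensions of the structural parameter, of the auxiliary parameter
and of the regressors, `H` is the number of simulated paths.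

The structural noise `ν_t` takes values in an arbitrary measurable space `𝕏` (the real line for a
scalar noise), and `w_t`, with values in `𝕎`, collects whatever drives the regressors (exogenous
noise, or lagged values of `ν` when the regressors contain lagged observations). -/
structure LIIModel (Ω 𝕏 𝕎 : Type*) (dθ dρ dz H : ℕ) where
  /-- the structural function `r(ε; θ)` -/
  r : ℝ → Vec dθ → ℝ
  /-- the structural function `φ(ν; θ)` -/
  φ : 𝕏 → Vec dθ → ℝ
  /-- the unknown function of interest -/
  θ₀ : ℝ → Vec dθ
  /-- the structural noise -/
  ν : ℕ → Ω → 𝕏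
  /-- the driver of the regressors -/
  w : ℕ → Ω → 𝕎
  /-- the stationary regressor at rescaled time `v` and parameter `θ` is `ζ v w_t θ` -/
  ζ : ℝ → 𝕎 → Vec dθ → Vec dz
  /-- the observed regressors, `Z T t = Z_{t,T}` -/
  Z : ℕ → ℕ → Ω → Vec dz
  /-- simulated structural noise, one path for each `j` -/
  νsim : Fin H → ℕ → Ω → 𝕏
  /-- simulated driver of the regressors, one path for each `j` -/
  wsim : Fin H → ℕ → Ω → 𝕎
  /-- structural parameter space -/
  Θ : Set (Vec dθ)
  /-- auxiliary parameter space -/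
  Γ : Set (Vec dρ)
  /-- the auxiliary criterion `g[y; s]`, used at `s = f(z, ρ)` -/
  g : ℝ → ℝ → ℝ
  /-- the auxiliary regression function `f(z, ρ)` -/
  f : Vec dz → Vec dρ → ℝ
  /-- the kernel -/
  K : ℝ → ℝ
  /-- the bandwidth `h = h_T` -/
  h : ℕ → ℝ
  /-- the sequence `m_T` that links mixing rate and bandwidth -/
  m : ℕ → ℕ
  /-- the trimming constant of the set of rescaled times -/
  δ : ℝ

namespace LIIModel

variable {Ω 𝕏 𝕎 : Type*} {dθ dρ dz H : ℕ} (M : LIIModel Ω 𝕏 𝕎 dθ dρ dz H)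

/-- The set `𝒰 = [δ, 1 - δ]` of rescaled times. -/
def U : Set ℝ := Set.Icc M.δ (1 - M.δ)

/-- The structural map `θ ↦ r(φ(x; θ); θ)` at the noise value `x`. -/
def yMap (x : 𝕏) (θ : Vec dθ) : ℝ := M.r (M.φ x θ) θ

/-- The observations `Y_{t,T} = r(φ(ν_t; θ₀(t/T)); θ₀(t/T))`. -/
def Y (T t : ℕ) (ω : Ω) : ℝ := M.yMap (M.ν t ω) (M.θ₀ ((t : ℝ) / T))

/-- The stationary structural observations `y_{u,t}(θ)` (they depend on `u` only through `θ`). -/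
def yStat (θ : Vec dθ) (t : ℕ) (ω : Ω) : ℝ := M.yMap (M.ν t ω) θ

/-- The stationary regressors `z_{v,t}(θ)`. -/
def zStat (v : ℝ) (θ : Vec dθ) (t : ℕ) (ω : Ω) : Vec dz := M.ζ v (M.w t ω) θ

/-- The `j`-th simulated path of observations, `ỹ_{u,t}(θ)`. -/
def ySim (j : Fin H) (θ : Vec dθ) (t : ℕ) (ω : Ω) : ℝ := M.yMap (M.νsim j t ω) θ

/-- The `j`-th simulated path of regressors, `z̃_{v,t}(θ)`. -/
def zSim (j : Fin H) (v : ℝ) (θ : Vec dθ) (t : ℕ) (ω : Ω) : Vec dz := M.ζ v (M.wsim j t ω) θ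

/-- The observed array `(Y_{t,T}, Z_{t,T})`. -/
def obs (T t : ℕ) (ω : Ω) : ℝ × Vec dz := (M.Y T t ω, M.Z T t ω)

/-- The stationary approximation `(y_{v,t}, z_{v,t})` of the observed array at rescaled time `v`. -/
def obsStat (v : ℝ) (t : ℕ) (ω : Ω) : ℝ × Vec dz :=
  (M.yStat (M.θ₀ v) t ω, M.zStat v (M.θ₀ v) t ω)

/-- The criterion `(y, z, ρ) ↦ g[y; f(z, ρ)]`. -/
def crit (y : ℝ) (z : Vec dz) (ρ : Vec dρ) : ℝ := M.g y (M.f z ρ)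

/-- The score `q[y; f(z, ρ)] = (∂/∂ρ) g[y; f(z, ρ)]`. -/
def score (y : ℝ) (z : Vec dz) (ρ : Vec dρ) : Vec dρ := gradient (fun ρ' => M.crit y z ρ') ρ

/-- The kernel weight `K((v - t/T)/h) / (Th)`. -/
def weight (T : ℕ) (v : ℝ) (t : ℕ) : ℝ :=
  M.K ((v - (t : ℝ) / T) / M.h T) / ((T : ℝ) * M.h T)

/-- The local sample criterion `M_T[ρ; v]`. -/
def localCrit (T : ℕ) (v : ℝ) (ω : Ω) (ρ : Vec dρ) : ℝ :=
  ∑ t ∈ Finset.Icc 1 T, M.weight T v t * M.crit (M.Y T t ω) (M.Z T t ω) ρ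

/-- The local sample score `Ψ_T(ρ; v)`. -/
def localScore (T : ℕ) (v : ℝ) (ω : Ω) (ρ : Vec dρ) : Vec dρ :=
  ∑ t ∈ Finset.Icc 1 T, M.weight T v t • M.score (M.Y T t ω) (M.Z T t ω) ρ

/-- The sample criterion of the `j`-th simulated path at `(v, θ)`. -/
def simCrit (j : Fin H) (T : ℕ) (v : ℝ) (θ : Vec dθ) (ω : Ω) (ρ : Vec dρ) : ℝ :=
  (1 / (T : ℝ)) * ∑ t ∈ Finset.Icc 1 T, M.crit (M.ySim j θ t ω) (M.zSim j v θ t ω) ρ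

/-- The neighbourhood `{ρ ∈ Γ : ‖ρ - c‖ ≤ ε}`. -/
def nbhd (ε : ℝ) (c : Vec dρ) : Set (Vec dρ) := {ρ | ρ ∈ M.Γ ∧ ‖ρ - c‖ ≤ ε}

section Limits

variable [MeasurableSpace Ω] (P : Measure Ω)

/-- The limit criterion `𝕄₀[ρ; v] = lim_T E M_T[ρ; v]`. -/
def limCrit (v : ℝ) (ρ : Vec dρ) : ℝ :=
  limUnder atTop fun T : ℕ => ∫ ω, M.localCrit T v ω ρ ∂P

/-- The limit score `Ψ₀(ρ; v) = (∂/∂ρ) 𝕄₀[ρ; v]`. -/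
def limScore (v : ℝ) (ρ : Vec dρ) : Vec dρ := gradient (M.limCrit P v) ρ

/-- The limit criterion of the simulated data,
`lim_T T⁻¹ ∑_{t ≤ T} E g[ỹ_{v,t}(θ); f(z̃_{v,t}(θ), ρ)]`. -/
def simLimCrit (j : Fin H) (v : ℝ) (θ : Vec dθ) (ρ : Vec dρ) : ℝ :=
  limUnder atTop fun T : ℕ =>
    (1 / (T : ℝ)) * ∑ t ∈ Finset.Icc 1 T, ∫ ω, M.crit (M.ySim j θ t ω) (M.zSim j v θ t ω) ρ ∂P

end Limits

/-- Smoothness of the structural model. -/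
structure StructuralRegularity [MeasurableSpace Ω] [MeasurableSpace 𝕏] (P : Measure Ω) :
    Prop where
  δ_pos : 0 < M.δ
  δ_lt : M.δ < 1 / 2
  θ₀_mem : ∀ v ∈ M.U, M.θ₀ v ∈ M.Θ
  θ₀_diff : DifferentiableOn ℝ M.θ₀ M.U
  θ₀_diff_two : DifferentiableOn ℝ (derivWithin M.θ₀ M.U) M.U
  θ₀_bound : ∃ C : ℝ, ∀ v ∈ M.U, ‖derivWithin (derivWithin M.θ₀ M.U) M.U v‖ ≤ C
  ν_meas : ∀ t, Measurable (M.ν t)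
  yMap_meas : ∀ θ, Measurable fun x => M.yMap x θ
  yMap_smooth : ∀ x, ContDiff ℝ 2 (M.yMap x)
  /-- the second derivatives of `θ ↦ r(φ(x; θ); θ)` are bounded uniformly in `θ`, by a constant or,
  more generally, by an integrable function of the noise -/
  yMap_bound : ∃ B : 𝕏 → ℝ, Measurable B ∧ (∀ t, 1 ≤ t → Integrable (fun ω => B (M.ν t ω)) P) ∧
    ∀ x, ∀ θ ∈ convexHull ℝ M.Θ, ‖iteratedFDeriv ℝ 2 (M.yMap x) θ‖ ≤ B x

/-- Local stationarity and `φ`-mixing of the observed array, and the stationary process that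
approximates it and from which the data are simulated. -/
structure DependenceConditions [MeasurableSpace Ω] [MeasurableSpace 𝕏] [MeasurableSpace 𝕎]
    (P : Measure Ω) : Prop where
  Z_meas : ∀ T t, Measurable (M.Z T t)
  locallyStationary : LocallyStationary P M.obs M.obsStat
  mixing : Tendsto (phiMixingCoeff P M.obs) atTop (𝓝 0)
  m_range : ∀ T : ℕ, 1 ≤ T → 1 ≤ M.m T ∧ M.m T ≤ T
  mixing_rate : ∃ C : ℝ, ∀ T : ℕ, 1 ≤ T →
    (T : ℝ) * phiMixingCoeff P M.obs (M.m T) / (M.m T : ℝ) ≤ C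
  /-- square integrability of `y_{u,t}(θ)` -/
  y_memLp : ∀ θ ∈ M.Θ, ∀ t, 1 ≤ t → MemLp (M.yStat θ t) 2 P
  /-- constant mean of `y_{u,t}(θ)` -/
  y_mean : ∀ θ ∈ M.Θ, ∃ C : ℝ, ∀ t, 1 ≤ t → ∫ ω, M.yStat θ t ω ∂P = C
  /-- shift invariant covariances of `y_{u,t}(θ)` -/
  y_cov : ∀ θ ∈ M.Θ, ∀ t s k, 1 ≤ t → 1 ≤ s →
    cov[M.yStat θ t, M.yStat θ s; P] = cov[M.yStat θ (t + k), M.yStat θ (s + k); P]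
  w_meas : ∀ t, Measurable (M.w t)
  /-- the driving noise is strictly stationary and ergodic (an i.i.d. sequence is a special case) -/
  ergodic : StationaryErgodic P fun t ω => (M.ν t ω, M.w t ω)
  νsim_meas : ∀ j t, Measurable (M.νsim j t)
  wsim_meas : ∀ j t, Measurable (M.wsim j t)
  /-- the simulated noise has the law of the true noise -/
  sim_law : ∀ j, P.map (pathOf fun t ω => (M.νsim j t ω, M.wsim j t ω)) =
    P.map (pathOf fun t ω => (M.ν t ω, M.w t ω))
  ζ_meas : ∀ v θ, Measurable fun x => M.ζ v x θ
  ζ_smooth : ∀ v ∈ M.U, ∀ x, ContDiff ℝ 2 (M.ζ v x)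
  /-- the first two `θ`-derivatives of the regressors are dominated; this is void for exogenous
  regressors, which do not depend on `θ` -/
  ζ_bound : ∀ v ∈ M.U, ∃ B : 𝕎 → ℝ, Measurable B ∧
    (∀ t, 1 ≤ t → Integrable (fun ω => B (M.w t ω)) P) ∧
    ∀ x, ∀ θ ∈ convexHull ℝ M.Θ,
      ‖fderiv ℝ (M.ζ v x) θ‖ ≤ B x ∧ ‖iteratedFDeriv ℝ 2 (M.ζ v x) θ‖ ≤ B x

/-- The map `ρ₀(v; θ)` of pseudo-true values: `ρ₀(v; θ₀(v))` minimizes the limit criterion of the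
observed data over `Γ`, and `ρ₀(v; θ)` is the unique minimizer over `Γ` of the limit criterion of
data simulated at `θ`. -/
structure IsPseudoTrue [MeasurableSpace Ω] (P : Measure Ω) (ρ₀ : ℝ → Vec dθ → Vec dρ) :
    Prop where
  mem : ∀ v ∈ M.U, ∀ θ ∈ M.Θ, ρ₀ v θ ∈ M.Γ
  obs_min : ∀ v ∈ M.U, ∀ ρ ∈ M.Γ, M.limCrit P v (ρ₀ v (M.θ₀ v)) ≤ M.limCrit P v ρ
  sim_min : ∀ j, ∀ v ∈ M.U, ∀ θ ∈ M.Θ, ∀ ρ ∈ M.Γ, ρ ≠ ρ₀ v θ →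
    M.simLimCrit P j v θ (ρ₀ v θ) < M.simLimCrit P j v θ ρ

/-- Conditions on the auxiliary model; `ε` is the radius of the neighbourhoods of the pseudo-true
values. -/
structure AuxiliaryRegularity [MeasurableSpace Ω] (P : Measure Ω)
    (ρ₀ : ℝ → Vec dθ → Vec dρ) (ε : ℝ) : Prop where
  ε_pos : 0 < ε
  /-- `g[y; f(z, ρ)]` is twice continuously and boundedly differentiable in `(y, z, ρ)` -/
  crit_smooth : ContDiff ℝ 2 fun p : ℝ × Vec dz × Vec dρ => M.crit p.1 p.2.1 p.2.2
  crit_bound : ∃ C : ℝ, ∀ p : ℝ × Vec dz × Vec dρ,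
    ‖fderiv ℝ (fun p : ℝ × Vec dz × Vec dρ => M.crit p.1 p.2.1 p.2.2) p‖ ≤ C ∧
    ‖iteratedFDeriv ℝ 2 (fun p : ℝ × Vec dz × Vec dρ => M.crit p.1 p.2.1 p.2.2) p‖ ≤ C
  crit_integrable : ∀ v ∈ M.U, ∀ T : ℕ, ∀ t ∈ Finset.Icc 1 T, ∃ C : ℝ,
    ∀ ρ ∈ M.nbhd ε (ρ₀ v (M.θ₀ v)),
      Integrable (fun ω => M.crit (M.Y T t ω) (M.Z T t ω) ρ) P ∧
      ∫ ω, |M.crit (M.Y T t ω) (M.Z T t ω) ρ| ∂P ≤ C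
  simCrit_integrable : ∀ j, ∀ v ∈ M.U, ∀ θ ∈ M.Θ, ∀ ρ ∈ M.Γ, ∀ t, 1 ≤ t →
    Integrable (fun ω => M.crit (M.ySim j θ t ω) (M.zSim j v θ t ω) ρ) P
  f_meas : ∀ ρ, Measurable fun z => M.f z ρ
  f_lipschitz : ∃ b : Vec dz → ℝ, ∀ z, ∀ ρ₁ ∈ M.Γ, ∀ ρ₂ ∈ M.Γ,
    |M.f z ρ₁ - M.f z ρ₂| ≤ b z * ‖ρ₁ - ρ₂‖
  f_diff : ∀ v ∈ M.U, ∀ ρ ∈ M.nbhd ε (ρ₀ v (M.θ₀ v)), ∀ z,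
    (∀ᶠ ρ' in 𝓝 ρ, DifferentiableAt ℝ (M.f z) ρ') ∧ DifferentiableAt ℝ (fderiv ℝ (M.f z)) ρ
  f_integrable : ∀ v ∈ M.U, ∀ T : ℕ, ∀ t ∈ Finset.Icc 1 T, ∃ C : ℝ,
    ∀ ρ ∈ M.nbhd ε (ρ₀ v (M.θ₀ v)),
      Integrable (fun ω => M.f (M.Z T t ω) ρ) P ∧ ∫ ω, |M.f (M.Z T t ω) ρ| ∂P ≤ C
  f_envelope : ∀ v ∈ M.U, ∃ fbar : Vec dz → ℝ,
    (∀ z, ∀ ρ ∈ M.nbhd ε (ρ₀ v (M.θ₀ v)), M.f z ρ ≤ fbar z) ∧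
    ∀ T : ℕ, ∀ t ∈ Finset.Icc 1 T, Integrable (fun ω => fbar (M.Z T t ω)) P
  /-- the limit that defines `𝕄₀[ρ; v]` exists -/
  limCrit_exists : ∀ v ∈ M.U, ∀ ρ, ∃ l : ℝ,
    Tendsto (fun T : ℕ => ∫ ω, M.localCrit T v ω ρ ∂P) atTop (𝓝 l)
  limCrit_diff : ∀ v ∈ M.U, ∀ ρ ∈ M.Γ, DifferentiableAt ℝ (M.limCrit P v) ρ
  limScore_zero : ∀ v ∈ M.U, ∀ ρ ∈ M.Γ, (M.limScore P v ρ = 0 ↔ ρ = ρ₀ v (M.θ₀ v))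
  well_separated : ∀ v ∈ M.U, ∀ a : ℝ, 0 < a → ∃ η : ℝ, 0 < η ∧ ∀ ρ ∈ M.Γ,
    a < ‖ρ - ρ₀ v (M.θ₀ v)‖ → η ≤ M.limCrit P v ρ - M.limCrit P v (ρ₀ v (M.θ₀ v))
  /-- equicontinuity in rescaled time and auxiliary parameter, the expectations being finite -/
  equicontinuous : ∀ e : ℝ, 0 < e → ∃ a₁ a₂ : ℝ, 0 < a₁ ∧ 0 < a₂ ∧ ∀ u₁ ∈ M.U,
    ∀ ρ₁ ∈ M.nbhd ε (ρ₀ u₁ (M.θ₀ u₁)), ∀ u₂ ∈ Set.Icc (0 : ℝ) 1, |u₂ - u₁| ≤ a₁ →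
    ∀ ρ₂ ∈ M.Γ, ‖ρ₂ - ρ₁‖ ≤ a₂ → ∀ t, 1 ≤ t →
      Integrable (fun ω => M.crit (M.obsStat u₁ t ω).1 (M.obsStat u₁ t ω).2 ρ₁) P ∧
      Integrable (fun ω => M.crit (M.obsStat u₂ t ω).1 (M.obsStat u₂ t ω).2 ρ₂) P ∧
      |∫ ω, M.crit (M.obsStat u₁ t ω).1 (M.obsStat u₁ t ω).2 ρ₁ ∂P -
        ∫ ω, M.crit (M.obsStat u₂ t ω).1 (M.obsStat u₂ t ω).2 ρ₂ ∂P| ≤ e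
  ρ₀_continuous : ∀ v ∈ M.U, ContinuousOn (ρ₀ v) M.Θ
  ρ₀_injective : ∀ v ∈ M.U, Set.InjOn (ρ₀ v) M.Θ
  Γ_compact : IsCompact M.Γ
  Θ_compact : IsCompact M.Θ
  dim_le : dθ ≤ dρ

/-- Conditions on kernel and bandwidth; `s` is the order of the kernel. -/
structure KernelBandwidth (s : ℕ) : Prop where
  two_le : 2 ≤ s
  K_nonneg : ∀ x, 0 ≤ M.K x
  K_symm : ∀ x, M.K (-x) = M.K x
  K_bdd : ∃ C : ℝ, ∀ x, M.K x ≤ C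
  K_smooth : ContDiff ℝ s M.K
  K_integrable : Integrable M.K
  K_integral : ∫ x, M.K x = 1
  K_sq_integrable : Integrable fun x => M.K x ^ 2
  K_tail : (∃ L : ℝ, 0 < L ∧ ∀ x, L < |x| → M.K x = 0) ∨
    ∃ C L p : ℝ, 0 < L ∧ 1 < p ∧ (∀ x, |deriv M.K x| ≤ C) ∧
      ∀ x, L < |x| → |deriv M.K x| ≤ C * |x| ^ (-p)
  K_moments : ∀ i : ℕ, 1 ≤ i → i < s → ∫ x, x ^ i * M.K x = 0
  K_moment_ne : ∫ x, x ^ s * M.K x ≠ 0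
  K_moment_integrable : Integrable fun x => |x| ^ s * |M.K x|
  K_decay : Tendsto (fun x => |x| * M.K x) (cocompact ℝ) (𝓝 0)
  K_lipschitz : ∃ C : ℝ, ∀ x x', |M.K x - M.K x'| ≤ C * |x - x'|
  h_pos : ∀ T : ℕ, 1 ≤ T → 0 < M.h T
  h_zero : Tendsto M.h atTop (𝓝 0)
  Th_top : Tendsto (fun T : ℕ => (T : ℝ) * M.h T) atTop atTop
  Th_rate : Tendsto (fun T : ℕ => (T : ℝ) * M.h T / ((M.m T : ℝ) * Real.log T)) atTop atTop

/-- Conditions for asymptotic normality at the rescaled time `u`, where `V v` is the long-run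
variance matrix of the local score at `v`. -/
structure LocalNormality [MeasurableSpace Ω] (P : Measure Ω) [IsProbabilityMeasure P]
    (ρ₀ : ℝ → Vec dθ → Vec dρ) (V : ℝ → Matrix (Fin dρ) (Fin dρ) ℝ) (u : ℝ) : Prop where
  V_posSemidef : ∀ v ∈ M.U, (V v).PosSemidef
  V_bounds : ∃ c C : ℝ, 0 < c ∧ ∀ v ∈ M.U,
    c ≤ ‖Matrix.toEuclideanCLM (𝕜 := ℝ) (V v)‖ ∧ ‖Matrix.toEuclideanCLM (𝕜 := ℝ) (V v)‖ ≤ C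
  /-- `√(Th) Ψ_T(ρ₀(u); u) →_d N(0, κ₂ V(u))` with `κ₂ = ∫ K²` -/
  score_clt : TendstoInDistribution
    (fun (T : ℕ) ω => √((T : ℝ) * M.h T) • M.localScore T u ω (ρ₀ u (M.θ₀ u)))
    atTop (fun x : Vec dρ => x) (fun _ => P)
    (multivariateGaussian 0 ((∫ x, M.K x ^ 2) • V u))
  /-- `T^{-1/2} ∑_{t ≤ T} q(ỹ⁰_{u,t}, ρ₀(u)) →_d N(0, V(u))` for data simulated at `θ₀(u)` -/
  sim_score_clt : ∀ j, TendstoInDistribution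
    (fun (T : ℕ) ω => (1 / √(T : ℝ)) • ∑ t ∈ Finset.Icc 1 T,
      M.score (M.ySim j (M.θ₀ u) t ω) (M.zSim j u (M.θ₀ u) t ω) (ρ₀ u (M.θ₀ u)))
    atTop (fun x : Vec dρ => x) (fun _ => P) (multivariateGaussian 0 (V u))
  /-- uniform convergence in probability of `∂Ψ_T/∂ρ'` near the pseudo-true values -/
  score_deriv : ∃ ε : ℝ, 0 < ε ∧ ∀ c : ℝ, 0 < c → Tendsto
    (fun T : ℕ => P {ω | ∃ v ∈ M.U, ∃ ρ ∈ M.nbhd ε (ρ₀ v (M.θ₀ v)),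
      c ≤ ‖fderiv ℝ (M.localScore T v ω) ρ - fderiv ℝ (M.limScore P v) ρ‖}) atTop (𝓝 0)
  limScore_diff : ∀ v ∈ M.U, ∀ ρ ∈ M.Γ, DifferentiableAt ℝ (M.limScore P v) ρ
  limScore_lipschitz : ∃ C : ℝ, ∀ v ∈ M.U, ∀ v' ∈ M.U, ∀ ρ ∈ M.Γ, ∀ ρ' ∈ M.Γ,
    ‖M.limScore P v ρ - M.limScore P v' ρ'‖ ≤ C * (|v - v'| + ‖ρ - ρ'‖) ∧
    ‖fderiv ℝ (M.limScore P v) ρ - fderiv ℝ (M.limScore P v') ρ'‖ ≤ C * (|v - v'| + ‖ρ - ρ'‖)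
  limScore_invertible : ∀ v ∈ M.U, IsUnit (jacobian (M.limScore P v) (ρ₀ v (M.θ₀ v))).det
  ρ₀_diff : DifferentiableOn ℝ (fun v => ρ₀ v (M.θ₀ v)) M.U
  ρ₀_diff_two : DifferentiableOn ℝ (derivWithin (fun v => ρ₀ v (M.θ₀ v)) M.U) M.U
  ρ₀_bounds : ∃ C : ℝ, ∀ v ∈ M.U, ‖derivWithin (fun v => ρ₀ v (M.θ₀ v)) M.U v‖ ≤ C ∧
    ‖derivWithin (derivWithin (fun v => ρ₀ v (M.θ₀ v)) M.U) M.U v‖ ≤ C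
  ρ₀_diff_θ : DifferentiableAt ℝ (ρ₀ u) (M.θ₀ u)
  /-- `∂ρ₀(u; θ₀(u))/∂θ'` has full column rank -/
  full_rank : (jacobian (ρ₀ u) (M.θ₀ u)).rank = dθ

/-- The simulated auxiliary estimator `ρ̂(u; θ)`: the average over the simulated paths (for `H = 1`
it is the estimator of the single path). -/
def avgSim (ρsim : Fin H → ℕ → Vec dθ → Ω → Vec dρ) (T : ℕ) (θ : Vec dθ) (ω : Ω) : Vec dρ :=
  (1 / (H : ℝ)) • ∑ j, ρsim j T θ ω

/-- The squared distance `‖x‖²_W = x' W x`. -/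
def sqNorm (W : Matrix (Fin dρ) (Fin dρ) ℝ) (x : Vec dρ) : ℝ := x.ofLp ⬝ᵥ (W *ᵥ x.ofLp)

/-- `θhat` is the local indirect inference estimator at `u` with weighting matrix `W`, built on the
auxiliary estimators `ρhat` and `ρsim`: with probability tending to one, `ρhat` minimizes the local
criterion over `Γ`, each `ρsim j · θ` minimizes the criterion of the `j`-th simulated path over `Γ`,
and `θhat` maximizes `-‖ρ̂(u) - ρ̂(u; θ)‖²_W` over `θ ∈ Θ`. -/
structure IsLIIEstimator [MeasurableSpace Ω] (P : Measure Ω) (W : Matrix (Fin dρ) (Fin dρ) ℝ)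
    (u : ℝ) (ρhat : ℕ → Ω → Vec dρ) (ρsim : Fin H → ℕ → Vec dθ → Ω → Vec dρ)
    (θhat : ℕ → Ω → Vec dθ) : Prop where
  θhat_meas : ∀ T, Measurable (θhat T)
  argmin_obs : Tendsto (fun T : ℕ =>
    P {ω | ¬ (ρhat T ω ∈ M.Γ ∧ IsMinOn (M.localCrit T u ω) M.Γ (ρhat T ω))}) atTop (𝓝 0)
  argmin_sim : ∀ j, Tendsto (fun T : ℕ => P {ω | ¬ ∀ θ ∈ M.Θ, ρsim j T θ ω ∈ M.Γ ∧
    IsMinOn (M.simCrit j T u θ ω) M.Γ (ρsim j T θ ω)}) atTop (𝓝 0)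
  argmax : Tendsto (fun T : ℕ => P {ω | ¬ (θhat T ω ∈ M.Θ ∧
    IsMaxOn (fun θ => -sqNorm W (ρhat T ω - avgSim ρsim T θ ω)) M.Θ (θhat T ω))}) atTop (𝓝 0)

/-- `D = ∂ρ₀(u; θ)/∂θ'` at `θ = θ₀(u)`. -/
def D (ρ₀ : ℝ → Vec dθ → Vec dρ) (u : ℝ) : Matrix (Fin dρ) (Fin dθ) ℝ :=
  jacobian (ρ₀ u) (M.θ₀ u)

/-- `Q(u) = (∂ρ₀'/∂θ) W (∂ρ₀/∂θ')`, with weighting matrix `W`. -/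
def Q (ρ₀ : ℝ → Vec dθ → Vec dρ) (W : Matrix (Fin dρ) (Fin dρ) ℝ) (u : ℝ) :
    Matrix (Fin dθ) (Fin dθ) ℝ :=
  (M.D ρ₀ u)ᵀ * W * M.D ρ₀ u

/-- `W(u) = (∂ρ₀'/∂θ) W (∂Ψ₀/∂ρ')⁻¹` at `θ = θ₀(u)`, `ρ = ρ₀(u)`, with weighting matrix `W`. -/
def Wmat [MeasurableSpace Ω] (P : Measure Ω) (ρ₀ : ℝ → Vec dθ → Vec dρ)
    (W : Matrix (Fin dρ) (Fin dρ) ℝ) (u : ℝ) : Matrix (Fin dθ) (Fin dρ) ℝ :=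
  (M.D ρ₀ u)ᵀ * W * (jacobian (M.limScore P u) (ρ₀ u (M.θ₀ u)))⁻¹

end LIIModel

end

/-! The estimator is a minimum distance estimator, and its limit law comes from two linearizations.
Write `J = ∂Ψ₀/∂ρ'` and `D = ∂ρ₀/∂θ'` at the true values. On the observed side, the first order
condition `Ψ_T(ρ̂) = 0`, the consistency of `ρ̂` and the uniform convergence of `∂Ψ_T/∂ρ'` give `ρ̂
- ρ₀ = -J⁻¹ Ψ_T(ρ₀)` up to smaller order, a term of size `(Th)^{-1/2}`. On the simulated side every
path uses all `T` observations with equal weight, so its sampling error is `O_p(T^{-1/2})`, which is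
`o_p((Th)^{-1/2})` because `h → 0`. What remains of `ρ̂(u; θ) - ρ₀` is the deterministic
displacement `D (θ - θ₀)`, so the number of paths leaves no trace in the limit. Matching the two
sides is, to first order, weighted least squares with design `D`. Its solution is `-Q⁻¹ W Ψ_T(ρ₀)`,
with `W` as in `Wmat`, and the assumed central limit theorem for `Ψ_T(ρ₀(u); u)` concludes through
Slutsky's theorem.

Stochastic orders are handled by the filter `highProb` of events whose probability tends to one:
along it, `=o` and `=O` obey the usual calculus of Landau symbols with random terms, and convergence
is convergence in probability.

Three points carry the weight. Consistency rests on a law of large numbers for kernel sums of a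
mixing array (`tendsto_weighted_sum_sub_mean`) and on one for ergodic averages
(`StationaryErgodic.tendsto_average`), both made uniform by compactness and Lipschitz bounds. Next,
`θ̂` only minimizes a distance, and no regularity of `θ ↦ ρ̂(u; θ)` is available, so no first order
condition can be written for it. Instead `simEstimator_expansion` expands `ρ̂(u; ·)` along arbitrary
consistent sequences, and `isLittleO_argmin_sub` compares `θ̂` with the exact least squares solution
through Pythagoras. Finally, invertibility is assumed for the limit score of the observed data only;
`exists_limCrit_sub_eq_mul` carries it over to the expected score of the simulated data by showing
that the two limit criteria are locally proportional. -/

noncomputable section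

/-! ### Convergence in probability as convergence along a filter; tightness and Slutsky's theorem.
-/

section WithHighProbability

open Asymptotics

variable {Ω : Type*} [MeasurableSpace Ω]

/-- The filter on `ℕ × Ω` of the events that hold with probability tending to one. Convergence along
it is convergence in probability (no measurability is required). -/
def highProb (P : Measure Ω) : Filter (ℕ × Ω) where
  sets := {S | Tendsto (fun T => P {ω | (T, ω) ∉ S}) atTop (𝓝 0)}
  univ_sets := by simp
  sets_of_superset := by
    intro S S' hS hSS'
    refine tendsto_of_tendsto_of_tendsto_of_le_of_le tendsto_const_nhds hS (fun _ => zero_le) ?_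
    exact fun T => measure_mono fun ω hω h => hω (hSS' h)
  inter_sets := by
    intro S S' hS hS'
    have := Tendsto.add hS hS'
    rw [add_zero] at this
    refine tendsto_of_tendsto_of_tendsto_of_le_of_le tendsto_const_nhds this (fun _ => zero_le) ?_
    intro T
    refine (measure_mono ?_).trans (measure_union_le _ _)
    intro ω hω
    by_contra h
    simp only [Set.mem_union, Set.mem_ofPred_eq, not_or, not_not] at h
    exact hω h

variable {P : Measure Ω}

lemma eventually_highProb_iff {q : ℕ × Ω → Prop} :
    (∀ᶠ p in highProb P, q p) ↔ Tendsto (fun T => P {ω | ¬ q (T, ω)}) atTop (𝓝 0) :=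
  Iff.rfl

lemma eventually_highProb_of_ae {q : ℕ × Ω → Prop} (h : ∀ᶠ T in atTop, ∀ᵐ ω ∂P, q (T, ω)) :
    ∀ᶠ p in highProb P, q p := by
  rw [eventually_highProb_iff]
  refine tendsto_const_nhds.congr' ?_
  filter_upwards [h] with T hT
  exact (ae_iff.1 hT).symm

lemma tendsto_fst_highProb : Tendsto Prod.fst (highProb P) atTop := by
  intro S hS
  exact eventually_highProb_of_ae (q := fun p => p.1 ∈ S)
    (Eventually.mono hS fun T hT => ae_of_all _ fun _ => hT)

lemma tendsto_highProb_iff {E : Type*} [PseudoMetricSpace E] {X : ℕ × Ω → E} {c : E} :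
    Tendsto X (highProb P) (𝓝 c) ↔
      ∀ e : ℝ, 0 < e → Tendsto (fun T => P {ω | e ≤ dist (X (T, ω)) c}) atTop (𝓝 0) := by
  rw [Metric.tendsto_nhds]
  simp only [eventually_highProb_iff, not_lt, gt_iff_lt]

lemma tendstoInMeasure_of_tendsto_highProb {E : Type*} [PseudoMetricSpace E] {X : ℕ → Ω → E} {c : E}
    (h : Tendsto (fun p : ℕ × Ω => X p.1 p.2) (highProb P) (𝓝 c)) :
    TendstoInMeasure P X atTop fun _ => c :=
  tendstoInMeasure_iff_dist.2 (tendsto_highProb_iff.1 h)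

/-- Convergence in mean implies convergence in probability. -/
lemma tendsto_highProb_of_tendsto_eLpNorm {E : Type*} [NormedAddCommGroup E]
    {X : ℕ → Ω → E} {c : E} (hX : ∀ T, AEStronglyMeasurable (X T) P)
    (h : Tendsto (fun T => eLpNorm (fun ω => X T ω - c) 1 P) atTop (𝓝 0)) :
    Tendsto (fun p : ℕ × Ω => X p.1 p.2) (highProb P) (𝓝 c) := by
  have := tendstoInMeasure_of_tendsto_eLpNorm (μ := P) (f := X) (g := fun _ => c) one_ne_zero hX
    aestronglyMeasurable_const h
  exact tendsto_highProb_iff.2 (tendstoInMeasure_iff_dist.1 this)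

/-- The closed set half of the portmanteau theorem. Applied to `{x | C ≤ ‖x‖}` it yields tightness
of the sequence. -/
lemma limsup_le_of_tendstoInDistribution {E Ω' : Type*} [NormedAddCommGroup E] [MeasurableSpace E]
    [BorelSpace E] [IsProbabilityMeasure P] {mΩ' : MeasurableSpace Ω'} {μ' : Measure Ω'}
    [IsProbabilityMeasure μ'] {X : ℕ → Ω → E} {Z : Ω' → E}
    (h : TendstoInDistribution X atTop Z (fun _ => P) μ') {F : Set E} (hF : IsClosed F) :
    limsup (fun T => P (X T ⁻¹' F)) atTop ≤ μ' (Z ⁻¹' F) := by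
  have := ProbabilityMeasure.limsup_measure_closed_le_of_tendsto h.tendsto hF
  simp only [ProbabilityMeasure.coe_mk] at this
  rw [Measure.map_apply_of_aemeasurable h.aemeasurable_limit hF.measurableSet] at this
  refine le_trans (le_of_eq ?_) this
  congr 1
  ext T
  rw [Measure.map_apply_of_aemeasurable (h.forall_aemeasurable T) hF.measurableSet]

/-- A sequence that converges in distribution is bounded in probability: what is negligible with
respect to it converges to zero in probability. -/
lemma TendstoInDistribution.tendsto_zero_of_isLittleO {E Ω' G : Type*} [NormedAddCommGroup E]
    [MeasurableSpace E] [BorelSpace E] [NormedAddCommGroup G] [IsProbabilityMeasure P]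
    {mΩ' : MeasurableSpace Ω'} {μ' : Measure Ω'}
    [IsProbabilityMeasure μ'] {X : ℕ → Ω → E} {Z : Ω' → E}
    (h : TendstoInDistribution X atTop Z (fun _ => P) μ') {R : ℕ × Ω → G}
    (hR : R =o[highProb P] fun p => ‖X p.1 p.2‖ + 1) :
    Tendsto R (highProb P) (𝓝 0) := by
  rw [tendsto_highProb_iff]
  intro e he
  rw [ENNReal.tendsto_nhds_zero]
  intro η hη
  -- A single probability law is tight: the events `n ≤ ‖Z‖` decrease to the empty set.
  obtain ⟨C, hC0, hC⟩ : ∃ C : ℝ, 0 < C ∧ μ' (Z ⁻¹' {x | C ≤ ‖x‖}) < η / 2 := by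
    have hm : ∀ C : ℝ, NullMeasurableSet (Z ⁻¹' {x | C ≤ ‖x‖}) μ' := fun C =>
      h.aemeasurable_limit.nullMeasurableSet_preimage
        (isClosed_le continuous_const continuous_norm).measurableSet
    have ht : Tendsto (fun n : ℕ => μ' (Z ⁻¹' {x | (n : ℝ) ≤ ‖x‖})) atTop
        (𝓝 (μ' (⋂ n : ℕ, Z ⁻¹' {x | (n : ℝ) ≤ ‖x‖}))) := by
      refine tendsto_measure_iInter_atTop (fun n => hm n) ?_ ⟨0, measure_ne_top _ _⟩
      intro n m hnm ω hω
      exact le_trans (by exact_mod_cast hnm : (n : ℝ) ≤ m) hω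
    have hempty : (⋂ n : ℕ, Z ⁻¹' {x | (n : ℝ) ≤ ‖x‖}) = ∅ := by
      ext ω
      simp only [Set.mem_iInter, Set.mem_preimage, Set.mem_ofPred_eq, Set.mem_empty_iff_false,
        iff_false, not_forall, not_le]
      exact exists_nat_gt _
    rw [hempty, measure_empty] at ht
    have hη2 : 0 < η / 2 := by simpa using hη.ne'
    obtain ⟨n, hn, hn0⟩ := ((ht.eventually_lt_const hη2).and (eventually_gt_atTop 0)).exists
    exact ⟨n, by exact_mod_cast hn0, hn⟩
  have h1 := (limsup_le_of_tendstoInDistribution h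
    (isClosed_le continuous_const continuous_norm : IsClosed {x : E | C ≤ ‖x‖})).trans_lt hC
  have h1 := eventually_lt_of_limsup_lt h1
  -- Where `‖X‖ < C`, the quantity `‖X‖ + 1` is below `C + 2`, so this factor keeps `‖R‖` strictly
  -- below `e`.
  have hc : 0 < e / (C + 2) := by positivity
  have h2 := eventually_highProb_iff.1 (hR.bound hc)
  have hη2 : 0 < η / 2 := by simpa using hη.ne'
  filter_upwards [h1, h2.eventually_lt_const hη2] with T hT1 hT2
  calc P {ω | e ≤ dist (R (T, ω)) 0}
      ≤ P ((X T ⁻¹' {x | C ≤ ‖x‖}) ∪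
        {ω | ¬ ‖R (T, ω)‖ ≤ e / (C + 2) * ‖‖X T ω‖ + 1‖}) := by
        refine measure_mono fun ω hω => ?_
        by_contra hcon
        simp only [Set.mem_union, Set.mem_preimage, Set.mem_ofPred_eq, not_or,
          not_le] at hcon
        simp only [Set.mem_ofPred_eq, dist_zero_right] at hω
        obtain ⟨ha, hb⟩ := hcon
        rw [Real.norm_of_nonneg (by positivity)] at hb
        have : e / (C + 2) * (‖X T ω‖ + 1) < e / (C + 2) * (C + 2) := by gcongr; linarith
        rw [div_mul_cancel₀ _ (by positivity)] at this
        linarith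
    _ ≤ _ := measure_union_le _ _
    _ ≤ η / 2 + η / 2 := by gcongr
    _ = η := ENNReal.add_halves η

/-- Slutsky's theorem for a linear approximation. -/
lemma TendstoInDistribution.of_tendsto_sub_linear {E G Ω' : Type*} [NormedAddCommGroup E]
    [MeasurableSpace E] [BorelSpace E] [NormedSpace ℝ E] [NormedAddCommGroup G] [MeasurableSpace G]
    [BorelSpace G] [NormedSpace ℝ G] [SecondCountableTopology G]
    [IsProbabilityMeasure P] {mΩ' : MeasurableSpace Ω'} {μ' : Measure Ω'}
    [IsProbabilityMeasure μ'] {X : ℕ → Ω → E} {Z : Ω' → E} (L : E →L[ℝ] G)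
    (h : TendstoInDistribution X atTop Z (fun _ => P) μ') {Y : ℕ → Ω → G}
    (hY : ∀ T, AEMeasurable (Y T) P)
    (hYX : Tendsto (fun p : ℕ × Ω => Y p.1 p.2 - L (X p.1 p.2)) (highProb P) (𝓝 0)) :
    TendstoInDistribution Y atTop (fun ω => L (Z ω)) (fun _ => P) μ' := by
  refine tendstoInDistribution_of_tendstoInMeasure_sub Y _ (h.continuous_comp L.continuous) ?_ hY
  exact tendstoInMeasure_of_tendsto_highProb (X := fun T ω => Y T ω - L (X T ω)) hYX

end WithHighProbability

/-! ### The mean ergodic theorem in L² and in L¹. -/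

section MeanErgodic

variable {α : Type*} [MeasurableSpace α] {μ : Measure α} {f : α → α}

lemma aestronglyMeasurable_birkhoffAverage {E : Type*} [NormedAddCommGroup E] [NormedSpace ℝ E]
    (hf : MeasurePreserving f μ μ) {g : α → E} (hg : AEStronglyMeasurable g μ) (N : ℕ) :
    AEStronglyMeasurable (birkhoffAverage ℝ f g N) μ := by
  have : birkhoffAverage ℝ f g N = (N : ℝ)⁻¹ • ∑ n ∈ Finset.range N, g ∘ f^[n] := by
    ext x; simp [birkhoffAverage, birkhoffSum]
  rw [this]
  refine AEStronglyMeasurable.const_smul ?_ _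
  exact Finset.aestronglyMeasurable_sum _ fun n _ => hg.comp_measurePreserving (hf.iterate n)

/-- Birkhoff averages do not increase the mean. -/
lemma eLpNorm_one_birkhoffAverage_le {E : Type*} [NormedAddCommGroup E] [NormedSpace ℝ E]
    (hf : MeasurePreserving f μ μ) {g : α → E} (hg : AEStronglyMeasurable g μ) (N : ℕ) :
    eLpNorm (birkhoffAverage ℝ f g N) 1 μ ≤ eLpNorm g 1 μ := by
  have : birkhoffAverage ℝ f g N = (N : ℝ)⁻¹ • ∑ n ∈ Finset.range N, g ∘ f^[n] := by
    ext x; simp [birkhoffAverage, birkhoffSum]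
  rw [this, eLpNorm_const_smul]
  rcases Nat.eq_zero_or_pos N with rfl | hN
  · simp
  calc ‖(N : ℝ)⁻¹‖ₑ * eLpNorm (∑ n ∈ Finset.range N, g ∘ f^[n]) 1 μ
      ≤ ‖(N : ℝ)⁻¹‖ₑ * ∑ n ∈ Finset.range N, eLpNorm (g ∘ f^[n]) 1 μ := by
        gcongr
        exact eLpNorm_sum_le (fun n _ => hg.comp_measurePreserving (hf.iterate n)) le_rfl
    _ = ‖(N : ℝ)⁻¹‖ₑ * (N * eLpNorm g 1 μ) := by
        congr 1
        rw [Finset.sum_congr rfl fun n _ => eLpNorm_comp_measurePreserving hg (hf.iterate n)]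
        simp
    _ = eLpNorm g 1 μ := by
        rw [← mul_assoc, enorm_inv (by positivity), show ‖(N : ℝ)‖ₑ = (N : ℝ≥0∞) by
          rw [Real.enorm_natCast]]
        rw [ENNReal.inv_mul_cancel (by positivity) (by simp), one_mul]

/-- The mean ergodic theorem for an ergodic map, in mean square. -/
lemma Ergodic.exists_tendsto_eLpNorm_two_birkhoffAverage (hf : Ergodic f μ) {g : α → ℝ}
    (hg : MemLp g 2 μ) :
    ∃ c : ℝ, Tendsto (fun N => eLpNorm (fun x => birkhoffAverage ℝ f g N x - c) 2 μ)
      atTop (𝓝 0) := by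
  have hmp : MeasurePreserving f μ μ := hf.toMeasurePreserving
  -- The Koopman operator, an isometry since `f` preserves `μ`. By von Neumann's theorem its
  -- averages converge to the projection onto the fixed vectors, and ergodicity makes every fixed
  -- vector constant.
  let U : Lp ℝ 2 μ →L[ℝ] Lp ℝ 2 μ :=
    (Lp.compMeasurePreservingₗᵢ ℝ f hmp).toContinuousLinearMap
  have hU : ‖U‖ ≤ 1 := LinearIsometry.norm_toContinuousLinearMap_le _
  have hUg : ∀ h : Lp ℝ 2 μ, U h =ᵐ[μ] h ∘ f := fun h => Lp.coeFn_compMeasurePreserving h hmp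
  have hiter : ∀ n : ℕ, ((U^[n] (hg.toLp g) : Lp ℝ 2 μ) : α → ℝ) =ᵐ[μ] g ∘ f^[n] := by
    intro n
    induction n with
    | zero => simpa using hg.coeFn_toLp
    | succ n ih =>
      rw [Function.iterate_succ_apply']
      refine (hUg _).trans ?_
      rw [Function.iterate_succ, ← Function.comp_assoc]
      exact hmp.quasiMeasurePreserving.ae_eq_comp ih
  have hT := U.tendsto_birkhoffAverage_orthogonalProjection hU (hg.toLp g)
  set S := U.eqLocus (1 : Lp ℝ 2 μ →L[ℝ] Lp ℝ 2 μ)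
  set g' : Lp ℝ 2 μ := (S.orthogonalProjectionOnto (hg.toLp g) : Lp ℝ 2 μ) with hg'
  have hfix : U g' = g' := (S.orthogonalProjectionOnto (hg.toLp g)).2
  obtain ⟨c, hc⟩ := hf.ae_eq_const_of_ae_eq_comp_ae (Lp.aestronglyMeasurable g')
    (by have := hUg g'; rw [hfix] at this; exact this.symm)
  refine ⟨c, ?_⟩
  have h2 : Tendsto (fun N => eLpNorm (⇑(birkhoffAverage ℝ U id N (hg.toLp g)) - ⇑g') 2 μ)
      atTop (𝓝 0) := (Lp.tendsto_Lp_iff_tendsto_eLpNorm' _ _).1 hT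
  refine h2.congr fun N => eLpNorm_congr_ae ?_
  have hsum : (birkhoffAverage ℝ U id N (hg.toLp g) : Lp ℝ 2 μ) =
      (N : ℝ)⁻¹ • ∑ n ∈ Finset.range N, U^[n] (hg.toLp g) := by
    simp [birkhoffAverage, birkhoffSum]
  have h3 : ((birkhoffAverage ℝ U id N (hg.toLp g) : Lp ℝ 2 μ) : α → ℝ) =ᵐ[μ]
      birkhoffAverage ℝ f g N := by
    rw [hsum]
    refine (Lp.coeFn_smul _ _).trans ?_
    have h4 := Lp.coeFn_fun_finsetSum (Finset.range N) (fun n => U^[n] (hg.toLp g))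
    have h5 : ∀ᵐ x ∂μ, ∀ n ∈ Finset.range N, (U^[n] (hg.toLp g) : Lp ℝ 2 μ) x = (g ∘ f^[n]) x := by
      rw [Finset.eventually_all]
      exact fun n _ => hiter n
    filter_upwards [h4, h5] with x hx hx5
    simp only [Pi.smul_apply, birkhoffAverage, birkhoffSum, hx]
    congr 1
    exact Finset.sum_congr rfl hx5
  filter_upwards [h3, hc] with x hx hcx
  simp [Pi.sub_apply, hx, hcx]

/-- The mean ergodic theorem for an ergodic map, in mean: Birkhoff averages of an integrable
function converge in mean to its integral. -/
theorem Ergodic.tendsto_eLpNorm_one_birkhoffAverage {E : Type*} [NormedAddCommGroup E]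
    [NormedSpace ℝ E] [CompleteSpace E] [IsProbabilityMeasure μ] (hf : Ergodic f μ) {g : α → E} (hg : Integrable g μ) :
    Tendsto (fun N => eLpNorm (fun x => birkhoffAverage ℝ f g N x - ∫ y, g y ∂μ) 1 μ)
      atTop (𝓝 0) := by
  have hmp : MeasurePreserving f μ μ := hf.toMeasurePreserving
  have hconst : ∀ c : E, eLpNorm (fun _ : α => c) 1 μ = ‖c‖ₑ := by
    intro c; rw [eLpNorm_const _ one_ne_zero (IsProbabilityMeasure.ne_zero μ)]; simp
  have hint : ∀ h : α → E, ‖∫ y, h y ∂μ‖ₑ ≤ eLpNorm h 1 μ := by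
    intro h; rw [eLpNorm_one_eq_lintegral_enorm]; exact enorm_integral_le_lintegral_enorm _
  rw [← memLp_one_iff_integrable] at hg
  -- Density argument: the functions with the asserted convergence include indicators, by the L²
  -- theorem. They are stable under sums, and they form a closed set because averaging contracts the
  -- L¹ norm.
  refine MemLp.induction (p := 1) ENNReal.one_ne_top (motive := fun g : α → E =>
    Tendsto (fun N => eLpNorm (fun x => birkhoffAverage ℝ f g N x - ∫ y, g y ∂μ) 1 μ)
      atTop (𝓝 0)) ?_ ?_ ?_ ?_ hg
  · intro c s hs hsμ
    have hind : MemLp (s.indicator fun _ => (1 : ℝ)) 2 μ :=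
      memLp_indicator_const 2 hs 1 (Or.inr hsμ.ne)
    obtain ⟨a, ha⟩ := hf.exists_tendsto_eLpNorm_two_birkhoffAverage hind
    have hA : ∀ N, AEStronglyMeasurable
        (birkhoffAverage ℝ f (s.indicator fun _ => (1 : ℝ)) N) μ := fun N =>
      aestronglyMeasurable_birkhoffAverage hmp hind.1 N
    have ha1 : Tendsto (fun N => eLpNorm (fun x =>
        birkhoffAverage ℝ f (s.indicator fun _ => (1 : ℝ)) N x - a) 1 μ) atTop (𝓝 0) := by
      refine tendsto_of_tendsto_of_tendsto_of_le_of_le tendsto_const_nhds ha (fun _ => zero_le)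
        fun N => ?_
      exact eLpNorm_le_eLpNorm_of_exponent_le (by norm_num) ((hA N).sub aestronglyMeasurable_const)
    have hI : Integrable (s.indicator fun _ => (1 : ℝ)) μ := hind.integrable (by norm_num)
    -- All averages have the same mean as the indicator, so the constant L¹ limit must be that mean.
    have hai : a = ∫ y, s.indicator (fun _ => (1 : ℝ)) y ∂μ := by
      have h0 : ∀ᶠ N : ℕ in atTop, ‖(∫ y, s.indicator (fun _ => (1 : ℝ)) y ∂μ) - a‖ₑ ≤
          eLpNorm (fun x =>
            birkhoffAverage ℝ f (s.indicator fun _ => (1 : ℝ)) N x - a) 1 μ := by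
        filter_upwards [eventually_gt_atTop 0] with N hN
        have hin : ∀ n, Integrable (fun x => s.indicator (fun _ => (1 : ℝ)) (f^[n] x)) μ :=
          fun n => (hmp.iterate n).integrable_comp_of_integrable hI
        have hBi : Integrable (birkhoffAverage ℝ f (s.indicator fun _ => (1 : ℝ)) N) μ := by
          unfold birkhoffAverage birkhoffSum
          exact (integrable_finsetSum _ fun n _ => hin n).smul (N : ℝ)⁻¹
        have : ∫ x, (birkhoffAverage ℝ f (s.indicator fun _ => (1 : ℝ)) N x - a) ∂μ =
            (∫ y, s.indicator (fun _ => (1 : ℝ)) y ∂μ) - a := by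
          rw [integral_sub hBi (integrable_const _)]
          congr 1
          · unfold birkhoffAverage birkhoffSum
            rw [integral_smul, integral_finsetSum _ fun n _ => hin n]
            have : ∀ n ∈ Finset.range N, ∫ x, s.indicator (fun _ => (1 : ℝ)) (f^[n] x) ∂μ =
                ∫ y, s.indicator (fun _ => (1 : ℝ)) y ∂μ := fun n _ => by
              have h := (hmp.iterate n)
              have h6 := integral_map (μ := μ) h.measurable.aemeasurable
                (f := s.indicator (fun _ => (1 : ℝ))) (by rw [h.map_eq]; exact hI.1)
              rw [h.map_eq] at h6
              exact h6.symm
            rw [Finset.sum_congr rfl this]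
            simp [show (N : ℝ) ≠ 0 by positivity]
          · simp
        rw [← this, eLpNorm_one_eq_lintegral_enorm]
        exact enorm_integral_le_lintegral_enorm _
      have := ge_of_tendsto ha1 h0
      simp only [nonpos_iff_eq_zero, enorm_eq_zero] at this
      linarith
    have hkey : ∀ N, eLpNorm (fun x => birkhoffAverage ℝ f (s.indicator fun _ => c) N x -
        ∫ y, s.indicator (fun _ => c) y ∂μ) 1 μ = eLpNorm (fun x =>
          birkhoffAverage ℝ f (s.indicator fun _ => (1 : ℝ)) N x - a) 1 μ * ‖c‖ₑ := by
      intro N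
      have hsc : ∀ y, s.indicator (fun _ => c) y = s.indicator (fun _ => (1 : ℝ)) y • c := by
        intro y; by_cases hy : y ∈ s <;> simp [hy]
      have h1 : (fun x => birkhoffAverage ℝ f (s.indicator fun _ => c) N x -
          ∫ y, s.indicator (fun _ => c) y ∂μ) = fun x =>
          (birkhoffAverage ℝ f (s.indicator fun _ => (1 : ℝ)) N x - a) • c := by
        ext x
        simp_rw [hsc]
        rw [integral_smul_const, ← hai, sub_smul]
        congr 1
        simp only [birkhoffAverage, birkhoffSum, hsc]
        rw [← Finset.sum_smul, smul_assoc]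
      rw [h1, eLpNorm_one_eq_lintegral_enorm, eLpNorm_one_eq_lintegral_enorm,
        ← lintegral_mul_const' _ _ (by simp)]
      simp_rw [enorm_smul]
    simp_rw [hkey]
    have := ENNReal.Tendsto.mul_const ha1 (b := ‖c‖ₑ) (Or.inr (by simp))
    rwa [zero_mul] at this
  · intro g h _ hg hh ihg ihh
    have := ihg.add ihh
    rw [add_zero] at this
    refine tendsto_of_tendsto_of_tendsto_of_le_of_le tendsto_const_nhds this (fun _ => zero_le)
      fun N => ?_
    refine le_trans (le_of_eq ?_) (eLpNorm_add_le
      ((aestronglyMeasurable_birkhoffAverage hmp hg.1 N).sub aestronglyMeasurable_const)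
      ((aestronglyMeasurable_birkhoffAverage hmp hh.1 N).sub aestronglyMeasurable_const) le_rfl)
    congr 1
    ext x
    simp only [Pi.add_apply]
    rw [integral_add (memLp_one_iff_integrable.1 hg) (memLp_one_iff_integrable.1 hh)]
    simp only [birkhoffAverage, birkhoffSum, Pi.add_apply, Finset.sum_add_distrib, smul_add]
    abel
  · refine isClosed_of_closure_subset fun g hg => ?_
    rw [Metric.mem_closure_iff] at hg
    simp only [Set.mem_ofPred_eq]
    rw [ENNReal.tendsto_nhds_zero]
    intro e he
    rcases eq_or_ne e ⊤ with rfl | hetop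
    · simp
    have he3 : 0 < (e / 3).toReal := ENNReal.toReal_pos (by simpa using he.ne')
      (ENNReal.div_ne_top hetop (by simp))
    obtain ⟨h, hh, hgh⟩ := hg _ he3
    simp only [Set.mem_ofPred_eq] at hh
    have hgh' : eLpNorm (⇑g - ⇑h) 1 μ ≤ e / 3 := by
      rw [dist_comm, Lp.dist_def] at hgh
      rw [eLpNorm_sub_comm]
      exact ((ENNReal.toReal_lt_toReal (by
        rw [eLpNorm_sub_comm]
        exact ((Lp.memLp g).sub (Lp.memLp h)).2.ne)
        (ENNReal.div_ne_top hetop (by simp))).1 hgh).le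
    have he3' : 0 < e / 3 := by simpa using he.ne'
    filter_upwards [hh.eventually_le_const he3'] with N hN
    have hgI := memLp_one_iff_integrable.1 (Lp.memLp g)
    have hhI := memLp_one_iff_integrable.1 (Lp.memLp h)
    have hsub : AEStronglyMeasurable (⇑g - ⇑h) μ := hgI.1.sub hhI.1
    -- Three errors of at most `e / 3`: the average of `g - h`, the convergence for `h`, and the
    -- difference of the two integrals.
    have hdec : (fun x => birkhoffAverage ℝ f (⇑g) N x - ∫ y, g y ∂μ) =
        (birkhoffAverage ℝ f (⇑g - ⇑h) N +
          fun x => birkhoffAverage ℝ f (⇑h) N x - ∫ y, h y ∂μ) +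
          fun _ => -∫ y, (⇑g - ⇑h) y ∂μ := by
      ext x
      simp only [Pi.add_apply, Pi.sub_apply]
      rw [integral_sub hgI hhI]
      simp only [birkhoffAverage, birkhoffSum, Pi.sub_apply, Finset.sum_sub_distrib, smul_sub]
      abel
    rw [hdec]
    have hm1 := aestronglyMeasurable_birkhoffAverage hmp hsub N
    have hm2 : AEStronglyMeasurable (fun x => birkhoffAverage ℝ f (⇑h) N x - ∫ y, h y ∂μ) μ :=
      (aestronglyMeasurable_birkhoffAverage hmp hhI.1 N).sub aestronglyMeasurable_const
    calc _ ≤ _ := eLpNorm_add_le (hm1.add hm2) aestronglyMeasurable_const le_rfl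
      _ ≤ (e / 3 + e / 3) + e / 3 := by
        gcongr
        · refine (eLpNorm_add_le hm1 hm2 le_rfl).trans ?_
          gcongr
          exact (eLpNorm_one_birkhoffAverage_le hmp hsub N).trans hgh'
        · rw [hconst, enorm_neg]
          exact (hint _).trans hgh'
      _ = e := ENNReal.add_thirds e
  · intro g h hgh hg ih
    refine ih.congr fun N => eLpNorm_congr_ae ?_
    have h5 : ∀ᵐ x ∂μ, ∀ n ∈ Finset.range N, g (f^[n] x) = h (f^[n] x) := by
      rw [Finset.eventually_all]
      exact fun n _ => (hmp.iterate n).quasiMeasurePreserving.ae_eq_comp hgh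
    filter_upwards [h5] with x hx
    rw [integral_congr_ae hgh]
    congr 1
    simp only [birkhoffAverage, birkhoffSum]
    rw [Finset.sum_congr rfl hx]

end MeanErgodic

/-! ### The law of large numbers for stationary ergodic processes. -/

section StationaryAverages

lemma leftShift_iterate {S : Type*} (x : ℕ → S) (n k : ℕ) : (leftShift^[n] x) k = x (k + n) := by
  induction n generalizing x with
  | zero => simp
  | succ n ih => rw [Function.iterate_succ_apply, ih]; simp [leftShift, add_assoc]

variable {Ω S : Type*} [MeasurableSpace Ω] [MeasurableSpace S] {P : Measure Ω}
  {ξ : ℕ → Ω → S}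

lemma measurable_pathOf (hξ : ∀ t, Measurable (ξ t)) : Measurable (pathOf ξ) :=
  measurable_pi_lambda _ fun n => hξ (n + 1)

/-- All the entries of a stationary process have the law of the first one. -/
lemma StationaryErgodic.map_eq (h : StationaryErgodic P ξ) (hξ : ∀ t, Measurable (ξ t)) {t : ℕ}
    (ht : 1 ≤ t) : P.map (ξ t) = P.map (ξ 1) := by
  obtain ⟨n, rfl⟩ : ∃ n, t = n + 1 := ⟨t - 1, by omega⟩
  have hm := measurable_pathOf hξ
  have h1 : ∀ k, P.map (ξ (k + 1)) = (P.map (pathOf ξ)).map (fun x => x k) := fun k => by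
    rw [Measure.map_map (measurable_pi_apply k) hm]; rfl
  have h2 := (h.toMeasurePreserving.iterate n).map_eq
  rw [h1 n]
  have h3 := h1 0
  rw [zero_add] at h3
  rw [h3]
  conv_rhs => rw [← h2, Measure.map_map (measurable_pi_apply 0)
    (h.toMeasurePreserving.iterate n).measurable]
  congr 1
  ext x
  simp [leftShift_iterate]

lemma StationaryErgodic.of_map_eq {ξ' : ℕ → Ω → S} (h : StationaryErgodic P ξ)
    (heq : P.map (pathOf ξ') = P.map (pathOf ξ)) : StationaryErgodic P ξ' := by
  unfold StationaryErgodic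
  rw [heq]
  exact h

lemma map_one_eq_of_map_pathOf_eq {ξ' : ℕ → Ω → S} (hξ : ∀ t, Measurable (ξ t))
    (hξ' : ∀ t, Measurable (ξ' t)) (heq : P.map (pathOf ξ') = P.map (pathOf ξ)) :
    P.map (ξ' 1) = P.map (ξ 1) := by
  have h1 : ∀ η : ℕ → Ω → S, (∀ t, Measurable (η t)) →
      P.map (η 1) = (P.map (pathOf η)).map (fun x => x 0) := fun η hη => by
    rw [Measure.map_map (measurable_pi_apply 0) (measurable_pathOf hη)]; rfl
  rw [h1 _ hξ, h1 _ hξ', heq]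

/-- Weak law of large numbers for stationary ergodic processes. -/
theorem StationaryErgodic.tendsto_average {E : Type*} [NormedAddCommGroup E] [NormedSpace ℝ E]
    [CompleteSpace E] [IsProbabilityMeasure P] (h : StationaryErgodic P ξ) (hξ : ∀ t, Measurable (ξ t)) {g : S → E}
    (hg : Integrable g (P.map (ξ 1))) :
    Tendsto (fun p : ℕ × Ω => (1 / (p.1 : ℝ)) • ∑ t ∈ Finset.Icc 1 p.1, g (ξ t p.2))
      (highProb P) (𝓝 (∫ x, g x ∂(P.map (ξ 1)))) := by
  have hm := measurable_pathOf hξ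
  have hprob : IsProbabilityMeasure (P.map (pathOf ξ)) := Measure.isProbabilityMeasure_map
    hm.aemeasurable
  have h1 : P.map (ξ 1) = (P.map (pathOf ξ)).map (fun x => x 0) := by
    rw [Measure.map_map (measurable_pi_apply 0) hm]; rfl
  have hg' : Integrable (fun x : ℕ → S => g (x 0)) (P.map (pathOf ξ)) := by
    rw [h1] at hg
    exact hg.comp_measurable (measurable_pi_apply 0)
  have hE := Ergodic.tendsto_eLpNorm_one_birkhoffAverage h hg'
  have hA := fun N => aestronglyMeasurable_birkhoffAverage (f := leftShift) h.toMeasurePreserving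
    hg'.1 N
  have hint : ∫ x, g x ∂(P.map (ξ 1)) = ∫ x, g (x 0) ∂(P.map (pathOf ξ)) := by
    rw [h1, integral_map (measurable_pi_apply 0).aemeasurable]
    rw [h1] at hg
    exact hg.1
  -- `pathOf` puts time `1` at coordinate `0`, so the Birkhoff sum over `n < T` is the sum over `1 ≤
  -- t ≤ T`.
  have hpt : ∀ T ω, birkhoffAverage ℝ leftShift (fun x : ℕ → S => g (x 0)) T (pathOf ξ ω) =
      (1 / (T : ℝ)) • ∑ t ∈ Finset.Icc 1 T, g (ξ t ω) := by
    intro T ω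
    simp only [birkhoffAverage, birkhoffSum, leftShift_iterate, zero_add, pathOf, one_div]
    congr 1
    rw [← Finset.sum_image (f := fun t => g (ξ t ω)) (g := fun n => n + 1)
      (fun a _ b _ hab => Nat.succ_injective hab)]
    congr 1
    ext t
    simp only [Finset.mem_image, Finset.mem_range, Finset.mem_Icc]
    exact ⟨by rintro ⟨n, hn, rfl⟩; omega, fun ht => ⟨t - 1, by omega, by omega⟩⟩
  refine tendsto_highProb_of_tendsto_eLpNorm
    (X := fun T ω => (1 / (T : ℝ)) • ∑ t ∈ Finset.Icc 1 T, g (ξ t ω)) ?_ ?_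
  · intro T
    refine ((hA T).comp_measurable hm).congr (ae_of_all _ fun ω => ?_)
    exact hpt T ω
  · refine hE.congr fun T => ?_
    have hAs : AEStronglyMeasurable (fun x => birkhoffAverage ℝ leftShift
        (fun x : ℕ → S => g (x 0)) T x - ∫ y, g (y 0) ∂(P.map (pathOf ξ))) (P.map (pathOf ξ)) :=
      (hA T).sub aestronglyMeasurable_const
    rw [eLpNorm_map_measure hAs hm.aemeasurable, hint]
    congr 1
    ext ω
    simp only [Function.comp_apply]
    rw [hpt]

end StationaryAverages

/-! ### Covariance inequalities under mixing and the law of large numbers for weighted sums. -/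

section MixingCovariance

/-- Layer-cake discretization: rounding down to the grid of mesh `1 / n` is a sum of indicators of
superlevel sets, and mixing speaks about such sets directly. -/
lemma sum_step_eq_floor {x : ℝ} (hx1 : x ≤ 1) {n : ℕ} (hn : 0 < n) :
    ∑ k ∈ Finset.Icc 1 n, (if (k : ℝ) / n ≤ x then (1 / n : ℝ) else 0) = (⌊n * x⌋₊ : ℝ) / n := by
  have hn' : (0 : ℝ) < n := by exact_mod_cast hn
  rw [← Finset.sum_filter, Finset.sum_const, nsmul_eq_mul]
  have : Finset.filter (fun k : ℕ => (k : ℝ) / n ≤ x) (Finset.Icc 1 n) =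
      Finset.Icc 1 ⌊n * x⌋₊ := by
    ext k
    simp only [Finset.mem_filter, Finset.mem_Icc]
    constructor
    · rintro ⟨⟨h1, h2⟩, h3⟩
      refine ⟨h1, Nat.le_floor ?_⟩
      rw [div_le_iff₀ hn'] at h3
      linarith
    · rintro ⟨h1, h2⟩
      have h3 := (Nat.le_floor_iff' (by omega)).1 h2
      refine ⟨⟨h1, ?_⟩, ?_⟩
      · have : (k : ℝ) ≤ n := h3.trans (by nlinarith)
        exact_mod_cast this
      · rw [div_le_iff₀ hn']; linarith
  rw [this]
  simp
  ring

/-- Covariance inequality for strong mixing, for variables with values in `[0, 1]`. -/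
lemma abs_integral_mul_sub_le_of_unit {Ω : Type*} {𝒜 ℬ : MeasurableSpace Ω}
    [m0 : MeasurableSpace Ω] {P : Measure Ω} [IsProbabilityMeasure P] (h𝒜 : 𝒜 ≤ m0) (hℬ : ℬ ≤ m0)
    {a : ℝ} (hmix : ∀ A B, MeasurableSet[𝒜] A → MeasurableSet[ℬ] B →
      |P.real (A ∩ B) - P.real A * P.real B| ≤ a)
    {X Y : Ω → ℝ} (hX : Measurable[𝒜] X) (hY : Measurable[ℬ] Y)
    (hX0 : ∀ ω, 0 ≤ X ω) (hX1 : ∀ ω, X ω ≤ 1) (hY0 : ∀ ω, 0 ≤ Y ω) (hY1 : ∀ ω, Y ω ≤ 1) :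
    |∫ ω, X ω * Y ω ∂P - (∫ ω, X ω ∂P) * ∫ ω, Y ω ∂P| ≤ a := by
  have hXm : Measurable X := hX.mono h𝒜 le_rfl
  have hYm : Measurable Y := hY.mono hℬ le_rfl
  -- After rounding to mesh `1 / n`, the covariance is an average of `n²` differences `P(A ∩ B) -
  -- P(A) P(B)`, each at most `a` in absolute value. Rounding costs `2 / n` in the mean of the
  -- product and `2 / n` in the product of the means.
  have step : ∀ n : ℕ, 0 < n →
      |∫ ω, X ω * Y ω ∂P - (∫ ω, X ω ∂P) * ∫ ω, Y ω ∂P| ≤ a + 4 / n := by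
    intro n hn
    have hn' : (0 : ℝ) < n := by exact_mod_cast hn
    let q : (Ω → ℝ) → ℕ → Set Ω := fun Z k => {ω | (k : ℝ) / n ≤ Z ω}
    let d : (Ω → ℝ) → Ω → ℝ := fun Z ω =>
      ∑ k ∈ Finset.Icc 1 n, (q Z k).indicator (fun _ => (1 / n : ℝ)) ω
    have hd : ∀ Z : Ω → ℝ, (∀ ω, Z ω ≤ 1) → ∀ ω, d Z ω = (⌊n * Z ω⌋₊ : ℝ) / n := by
      intro Z hZ ω
      rw [← sum_step_eq_floor (hZ ω) hn]
      refine Finset.sum_congr rfl fun k _ => ?_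
      simp [q, Set.indicator_apply]
    have hd1 : ∀ Z : Ω → ℝ, (∀ ω, 0 ≤ Z ω) → (∀ ω, Z ω ≤ 1) → ∀ ω, |Z ω - d Z ω| ≤ 1 / n := by
      intro Z hZ0 hZ ω
      rw [hd Z hZ ω]
      have h1 := Nat.floor_le (show 0 ≤ n * Z ω from mul_nonneg hn'.le (hZ0 ω))
      have h2 := Nat.lt_floor_add_one (n * Z ω)
      have h3 : Z ω - (⌊n * Z ω⌋₊ : ℝ) / n = (n * Z ω - ⌊n * Z ω⌋₊) / n := by field_simp
      rw [h3, abs_div, abs_of_pos hn', abs_of_nonneg (by linarith)]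
      gcongr
      linarith
    have hd01 : ∀ Z : Ω → ℝ, (∀ ω, 0 ≤ Z ω) → (∀ ω, Z ω ≤ 1) → ∀ ω, |d Z ω| ≤ 1 := by
      intro Z hZ0 hZ ω
      rw [hd Z hZ ω, abs_of_nonneg (by positivity), div_le_one hn']
      exact (Nat.floor_le (mul_nonneg hn'.le (hZ0 ω))).trans (by nlinarith [hZ ω])
    have hqm : ∀ {𝒞 : MeasurableSpace Ω} {Z : Ω → ℝ}, Measurable[𝒞] Z → ∀ k,
        MeasurableSet[𝒞] (q Z k) := fun hZ k => hZ measurableSet_Ici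
    have hdm : ∀ Z : Ω → ℝ, Measurable Z → Measurable (d Z) := fun Z hZ =>
      Finset.measurable_sum _ fun k _ => measurable_const.indicator (hqm hZ k)
    have hdi : ∀ Z : Ω → ℝ, Measurable Z → ∫ ω, d Z ω ∂P =
        ∑ k ∈ Finset.Icc 1 n, P.real (q Z k) * (1 / n) := by
      intro Z hZ
      have hi : ∀ k, Integrable ((q Z k).indicator fun _ => (1 / n : ℝ)) P := fun k =>
        (integrable_const _).indicator (hqm hZ k)
      rw [integral_finsetSum _ fun k _ => hi k]
      refine Finset.sum_congr rfl fun k _ => ?_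
      rw [integral_indicator_const _ (hqm hZ k), smul_eq_mul]
    have hdd : ∫ ω, d X ω * d Y ω ∂P = ∑ k ∈ Finset.Icc 1 n, ∑ l ∈ Finset.Icc 1 n,
        P.real (q X k ∩ q Y l) * (1 / n * (1 / n)) := by
      have hm : ∀ k l, MeasurableSet (q X k ∩ q Y l) := fun k l => (hqm hXm k).inter (hqm hYm l)
      have : ∀ ω, d X ω * d Y ω = ∑ k ∈ Finset.Icc 1 n, ∑ l ∈ Finset.Icc 1 n,
          (q X k ∩ q Y l).indicator (fun _ => (1 / n * (1 / n) : ℝ)) ω := by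
        intro ω
        simp only [d]
        rw [Finset.sum_mul_sum]
        refine Finset.sum_congr rfl fun k _ => Finset.sum_congr rfl fun l _ => ?_
        by_cases h1 : ω ∈ q X k <;> by_cases h2 : ω ∈ q Y l <;> simp [h1, h2]
      simp_rw [this]
      have hi : ∀ k l, Integrable ((q X k ∩ q Y l).indicator
          fun _ => (1 / n * (1 / n) : ℝ)) P := fun k l =>
        (integrable_const _).indicator (hm k l)
      rw [integral_finsetSum _ fun k _ => integrable_finsetSum _ fun l _ => hi k l]
      refine Finset.sum_congr rfl fun k _ => ?_
      rw [integral_finsetSum _ fun l _ => hi k l]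
      refine Finset.sum_congr rfl fun l _ => ?_
      rw [integral_indicator_const _ (hm k l), smul_eq_mul]
    have hdisc : |∫ ω, d X ω * d Y ω ∂P - (∫ ω, d X ω ∂P) * ∫ ω, d Y ω ∂P| ≤ a := by
      rw [hdd, hdi X hXm, hdi Y hYm, Finset.sum_mul_sum, ← Finset.sum_sub_distrib]
      simp_rw [← Finset.sum_sub_distrib]
      have hb : ∀ k ∈ Finset.Icc 1 n, |∑ l ∈ Finset.Icc 1 n,
          (P.real (q X k ∩ q Y l) * (1 / n * (1 / n)) -
            P.real (q X k) * (1 / n) * (P.real (q Y l) * (1 / n)))| ≤ n * (a * (1 / n * (1 / n))) := by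
        intro k _
        refine (Finset.abs_sum_le_sum_abs _ _).trans ?_
        refine (Finset.sum_le_card_nsmul _ _ (a * (1 / n * (1 / n))) fun l _ => ?_).trans (by simp)
        rw [show P.real (q X k ∩ q Y l) * (1 / n * (1 / n)) -
            P.real (q X k) * (1 / n) * (P.real (q Y l) * (1 / n)) =
            (P.real (q X k ∩ q Y l) - P.real (q X k) * P.real (q Y l)) * (1 / n * (1 / n)) by ring,
          abs_mul, abs_of_pos (by positivity : (0 : ℝ) < 1 / n * (1 / n))]
        gcongr
        exact hmix _ _ (hqm hX k) (hqm hY l)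
      refine (Finset.abs_sum_le_sum_abs _ _).trans ((Finset.sum_le_card_nsmul _ _ _ hb).trans ?_)
      simp only [Nat.card_Icc, add_tsub_cancel_right, nsmul_eq_mul]
      field_simp
      exact le_rfl
    have hbi : ∀ Z : Ω → ℝ, Measurable Z → (∀ ω, |Z ω| ≤ 1) → Integrable Z P := fun Z hZ hb =>
      Integrable.of_bound hZ.aestronglyMeasurable 1 (ae_of_all _ hb)
    have hXa : ∀ ω, |X ω| ≤ 1 := fun ω => abs_le.2 ⟨by linarith [hX0 ω], hX1 ω⟩
    have hYa : ∀ ω, |Y ω| ≤ 1 := fun ω => abs_le.2 ⟨by linarith [hY0 ω], hY1 ω⟩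
    have hdXa := hd01 X hX0 hX1
    have hdYa := hd01 Y hY0 hY1
    have hmulb : ∀ {x y : ℝ}, |x| ≤ 1 → |y| ≤ 1 → |x * y| ≤ 1 := fun {x y} hx hy => by
      rw [abs_mul]; exact mul_le_one₀ hx (abs_nonneg _) hy
    have iX := hbi X hXm hXa
    have iY := hbi Y hYm hYa
    have idX := hbi (d X) (hdm X hXm) hdXa
    have idY := hbi (d Y) (hdm Y hYm) hdYa
    have iXY := hbi (fun ω => X ω * Y ω) (hXm.mul hYm) fun ω => hmulb (hXa ω) (hYa ω)
    have idXY := hbi (fun ω => d X ω * d Y ω) ((hdm X hXm).mul (hdm Y hYm)) fun ω =>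
      hmulb (hdXa ω) (hdYa ω)
    have hclose : ∀ {Z W : Ω → ℝ} {c : ℝ}, Integrable Z P → Integrable W P →
        (∀ ω, |Z ω - W ω| ≤ c) → |∫ ω, Z ω ∂P - ∫ ω, W ω ∂P| ≤ c := by
      intro Z W c hZ hW h
      rw [← integral_sub hZ hW, ← Real.norm_eq_abs]
      refine (norm_integral_le_of_norm_le_const (ae_of_all _ h)).trans (by simp)
    have e1 : |∫ ω, X ω * Y ω ∂P - ∫ ω, d X ω * d Y ω ∂P| ≤ 2 / n := by
      refine hclose iXY idXY fun ω => ?_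
      have : X ω * Y ω - d X ω * d Y ω = X ω * (Y ω - d Y ω) + (X ω - d X ω) * d Y ω := by ring
      rw [this]
      refine (abs_add_le _ _).trans ?_
      rw [abs_mul, abs_mul]
      have h1 := hd1 X hX0 hX1 ω
      have h2 := hd1 Y hY0 hY1 ω
      have h3 := mul_le_mul (hXa ω) h2 (abs_nonneg _) zero_le_one
      have h4 := mul_le_mul h1 (hdYa ω) (abs_nonneg _) (by positivity)
      have : (2 : ℝ) / n = 1 * (1 / n) + 1 / n * 1 := by ring
      linarith
    have hintle : ∀ {Z : Ω → ℝ}, (∀ ω, |Z ω| ≤ 1) → |∫ ω, Z ω ∂P| ≤ 1 := fun {Z} h => by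
      rw [← Real.norm_eq_abs]
      exact (norm_integral_le_of_norm_le_const (ae_of_all _ h)).trans (by simp)
    have e2 : |(∫ ω, X ω ∂P) * (∫ ω, Y ω ∂P) - (∫ ω, d X ω ∂P) * ∫ ω, d Y ω ∂P| ≤ 2 / n := by
      have : (∫ ω, X ω ∂P) * (∫ ω, Y ω ∂P) - (∫ ω, d X ω ∂P) * ∫ ω, d Y ω ∂P =
          (∫ ω, X ω ∂P) * ((∫ ω, Y ω ∂P) - ∫ ω, d Y ω ∂P) +
            ((∫ ω, X ω ∂P) - ∫ ω, d X ω ∂P) * ∫ ω, d Y ω ∂P := by ring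
      rw [this]
      refine (abs_add_le _ _).trans ?_
      rw [abs_mul, abs_mul]
      have h1 := hclose iX idX (hd1 X hX0 hX1)
      have h2 := hclose iY idY (hd1 Y hY0 hY1)
      have h3 := mul_le_mul (hintle hXa) h2 (abs_nonneg _) zero_le_one
      have h4 := mul_le_mul h1 (hintle hdYa) (abs_nonneg _) (by positivity)
      have : (2 : ℝ) / n = 1 * (1 / n) + 1 / n * 1 := by ring
      linarith
    have : (4 : ℝ) / n = 2 / n + 2 / n := by ring
    rw [abs_le] at *
    constructor <;> linarith [hdisc.1, hdisc.2, e1.1, e1.2, e2.1, e2.2]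
  have hlim : Tendsto (fun n : ℕ => a + 4 / (n : ℝ)) atTop (𝓝 (a + 0)) :=
    tendsto_const_nhds.add (tendsto_const_div_atTop_nhds_zero_nat 4)
  rw [add_zero] at hlim
  refine ge_of_tendsto hlim ?_
  filter_upwards [eventually_gt_atTop 0] with n hn using step n hn

/-- Covariance inequality for strong mixing, for bounded variables. -/
lemma abs_covariance_le_of_mixing {Ω : Type*} {𝒜 ℬ : MeasurableSpace Ω}
    [m0 : MeasurableSpace Ω] {P : Measure Ω} [IsProbabilityMeasure P] (h𝒜 : 𝒜 ≤ m0) (hℬ : ℬ ≤ m0)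
    {a : ℝ} (hmix : ∀ A B, MeasurableSet[𝒜] A → MeasurableSet[ℬ] B →
      |P.real (A ∩ B) - P.real A * P.real B| ≤ a)
    {X Y : Ω → ℝ} (hX : Measurable[𝒜] X) (hY : Measurable[ℬ] Y) {c : ℝ} (hc : 0 < c)
    (hXc : ∀ ω, |X ω| ≤ c) (hYc : ∀ ω, |Y ω| ≤ c) :
    |cov[X, Y; P]| ≤ 4 * c ^ 2 * a := by
  have hXm : Measurable X := hX.mono h𝒜 le_rfl
  have hYm : Measurable Y := hY.mono hℬ le_rfl
  have hL2 : ∀ Z : Ω → ℝ, Measurable Z → (∀ ω, |Z ω| ≤ c) → MemLp Z 2 P := fun Z hZ h =>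
    MemLp.of_bound hZ.aestronglyMeasurable c (ae_of_all _ h)
  have hmul : ∫ ω, X ω * Y ω ∂P - (∫ ω, X ω ∂P) * ∫ ω, Y ω ∂P = cov[X, Y; P] := by
    rw [covariance_eq_sub (hL2 X hXm hXc) (hL2 Y hYm hYc)]; rfl
  have iX := (hL2 X hXm hXc).integrable (by norm_num)
  have iY := (hL2 Y hYm hYc).integrable (by norm_num)
  have iXY : Integrable (fun ω => X ω * Y ω) P := (hL2 X hXm hXc).integrable_mul (hL2 Y hYm hYc)
  -- The affine map from `[-c, c]` onto `[0, 1]` divides the covariance by `4 c ^ 2`.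
  have hunit := abs_integral_mul_sub_le_of_unit (P := P) h𝒜 hℬ hmix
    (X := fun ω => (X ω + c) / (2 * c)) (Y := fun ω => (Y ω + c) / (2 * c))
    ((hX.add_const c).div_const _) ((hY.add_const c).div_const _)
    (fun ω => div_nonneg (by linarith [(abs_le.1 (hXc ω)).1]) (by positivity))
    (fun ω => (div_le_one (by positivity)).2 (by linarith [(abs_le.1 (hXc ω)).2]))
    (fun ω => div_nonneg (by linarith [(abs_le.1 (hYc ω)).1]) (by positivity))
    (fun ω => (div_le_one (by positivity)).2 (by linarith [(abs_le.1 (hYc ω)).2]))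
  have e1 : ∀ {Z : Ω → ℝ}, Integrable Z P →
      ∫ ω, (Z ω + c) / (2 * c) ∂P = ((∫ ω, Z ω ∂P) + c) / (2 * c) := fun {Z} hZ => by
    rw [integral_div, integral_add hZ (integrable_const _)]; simp
  have e2 : ∫ ω, (X ω + c) / (2 * c) * ((Y ω + c) / (2 * c)) ∂P =
      ((∫ ω, X ω * Y ω ∂P) + c * (∫ ω, X ω ∂P) + c * (∫ ω, Y ω ∂P) + c ^ 2) / (4 * c ^ 2) := by
    have : ∀ ω, (X ω + c) / (2 * c) * ((Y ω + c) / (2 * c)) =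
        (X ω * Y ω + c * X ω + c * Y ω + c ^ 2) / (4 * c ^ 2) := fun ω => by field_simp; ring
    simp_rw [this]
    have i1 : Integrable (fun ω => X ω * Y ω + c * X ω) P := iXY.add (iX.const_mul c)
    have i2 : Integrable (fun ω => X ω * Y ω + c * X ω + c * Y ω) P := i1.add (iY.const_mul c)
    rw [integral_div, integral_add i2 (integrable_const _), integral_add i1 (iY.const_mul c),
      integral_add iXY (iX.const_mul c), integral_const_mul, integral_const_mul]
    simp
  rw [e1 iX, e1 iY, e2] at hunit
  have e3 : ((∫ ω, X ω * Y ω ∂P) + c * (∫ ω, X ω ∂P) + c * (∫ ω, Y ω ∂P) + c ^ 2) / (4 * c ^ 2) -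
      ((∫ ω, X ω ∂P) + c) / (2 * c) * (((∫ ω, Y ω ∂P) + c) / (2 * c)) =
      cov[X, Y; P] / (4 * c ^ 2) := by
    rw [← hmul]; field_simp; ring
  rw [e3, abs_div, abs_of_pos (by positivity : (0 : ℝ) < 4 * c ^ 2), div_le_iff₀ (by positivity)]
    at hunit
  linarith

variable {Ω S : Type*} [m0 : MeasurableSpace Ω] {P : Measure Ω} [MeasurableSpace S]
  {X : ℕ → ℕ → Ω → S}

lemma pastField_le (hX : ∀ T t, Measurable (X T t)) (T t : ℕ) : pastField X T t ≤ m0 :=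
  iSup₂_le fun i _ => (hX T i).comap_le

lemma futureField_le (hX : ∀ T t, Measurable (X T t)) (T t : ℕ) : futureField X T t ≤ m0 :=
  iSup₂_le fun i _ => (hX T i).comap_le

lemma bddAbove_phiMixing [IsProbabilityMeasure P] (k : ℕ) :
    BddAbove {x : ℝ | ∃ (T t : ℕ) (A B : Set Ω), MeasurableSet[pastField X T t] A ∧
    MeasurableSet[futureField X T (t + k)] B ∧ 0 < P.real A ∧
    x = |P.real (A ∩ B) / P.real A - P.real B|} := by
  refine ⟨1, ?_⟩
  rintro x ⟨T, t, A, B, -, -, hA, rfl⟩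
  have h1 : P.real (A ∩ B) / P.real A ≤ 1 :=
    (div_le_one hA).2 (measureReal_mono Set.inter_subset_left)
  have h2 : 0 ≤ P.real (A ∩ B) / P.real A := by positivity
  have h3 : P.real B ≤ 1 := measureReal_le_one
  have h4 : 0 ≤ P.real B := measureReal_nonneg
  rw [abs_le]; constructor <;> linarith

lemma phiMixingCoeff_nonneg (k : ℕ) : 0 ≤ phiMixingCoeff P X k := by
  refine Real.sSup_nonneg ?_
  rintro x ⟨T, t, A, B, -, -, hA, rfl⟩
  exact abs_nonneg _

lemma phiMixingCoeff_le_one [IsProbabilityMeasure P] (k : ℕ) : phiMixingCoeff P X k ≤ 1 := by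
  refine Real.sSup_le ?_ zero_le_one
  rintro x ⟨T, t, A, B, -, -, hA, rfl⟩
  have h1 : P.real (A ∩ B) / P.real A ≤ 1 :=
    (div_le_one hA).2 (measureReal_mono Set.inter_subset_left)
  have h2 : 0 ≤ P.real (A ∩ B) / P.real A := by positivity
  have h3 : P.real B ≤ 1 := measureReal_le_one
  have h4 : 0 ≤ P.real B := measureReal_nonneg
  rw [abs_le]; constructor <;> linarith

/-- The strong mixing coefficient is dominated by the `φ`-mixing one: multiply the bound on `|P(B |
A) - P(B)|` by `P(A) ≤ 1`. If `P(A) = 0`, both products vanish. -/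
lemma abs_measureReal_inter_sub_le [IsProbabilityMeasure P] (T t k : ℕ) {A B : Set Ω} (hA : MeasurableSet[pastField X T t] A)
    (hB : MeasurableSet[futureField X T (t + k)] B) :
    |P.real (A ∩ B) - P.real A * P.real B| ≤ phiMixingCoeff P X k := by
  rcases eq_or_lt_of_le (measureReal_nonneg : 0 ≤ P.real A) with h0 | h0
  · have : P.real (A ∩ B) = 0 := le_antisymm
      ((measureReal_mono Set.inter_subset_left).trans h0.symm.le) measureReal_nonneg
    rw [this, ← h0]; simpa using phiMixingCoeff_nonneg k
  · have h1 := le_csSup (bddAbove_phiMixing (P := P) (X := X) k) ⟨T, t, A, B, hA, hB, h0, rfl⟩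
    have h2 : P.real (A ∩ B) - P.real A * P.real B =
        P.real A * (P.real (A ∩ B) / P.real A - P.real B) := by field_simp
    rw [h2, abs_mul, abs_of_pos h0]
    exact (mul_le_of_le_one_left (abs_nonneg _) measureReal_le_one).trans h1

lemma abs_covariance_le_phiMixingCoeff [IsProbabilityMeasure P] (hX : ∀ T t, Measurable (X T t)) {F : S → ℝ}
    (hF : Measurable F) {c : ℝ} (hc : 0 < c) (hFc : ∀ x, |F x| ≤ c) {T s t : ℕ} (hs : 1 ≤ s)
    (hst : s ≤ t) (ht : t ≤ T) :
    |cov[fun ω => F (X T s ω), fun ω => F (X T t ω); P]| ≤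
      4 * c ^ 2 * phiMixingCoeff P X (t - s) := by
  refine abs_covariance_le_of_mixing (pastField_le hX T s) (futureField_le hX T (s + (t - s)))
    (fun A B hA hB => abs_measureReal_inter_sub_le T s (t - s) hA hB) ?_ ?_ hc
    (fun ω => hFc _) (fun ω => hFc _)
  · refine hF.comp (Measurable.mono (comap_measurable (X T s)) ?_ le_rfl)
    exact le_iSup₂_of_le s ⟨hs, by omega, le_rfl⟩ le_rfl
  · refine hF.comp (Measurable.mono (comap_measurable (X T t)) ?_ le_rfl)
    exact le_iSup₂_of_le t ⟨by omega, ht, by omega⟩ le_rfl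

/-- The variance of a weighted sum of bounded functions of a mixing array. -/
lemma variance_weighted_sum_le [IsProbabilityMeasure P] (hX : ∀ T t, Measurable (X T t)) {F : S → ℝ}
    (hF : Measurable F) {c : ℝ} (hc : 0 < c) (hFc : ∀ x, |F x| ≤ c) {T N : ℕ} {w : ℕ → ℝ}
    {b B e : ℝ} (hw0 : ∀ t, 0 ≤ w t) (hb0 : 0 ≤ b) (hwb : ∀ t ∈ Finset.Icc 1 T, w t ≤ b)
    (hwB : ∑ t ∈ Finset.Icc 1 T, w t ≤ B) (he : 0 ≤ e)
    (hN : ∀ k, N ≤ k → phiMixingCoeff P X k ≤ e) :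
    Var[fun ω => ∑ t ∈ Finset.Icc 1 T, w t * F (X T t ω); P] ≤
      4 * c ^ 2 * (2 * N * b * B + e * B ^ 2) := by
  have hL2 : ∀ t, MemLp (fun ω => F (X T t ω)) 2 P := fun t =>
    MemLp.of_bound (hF.comp (hX T t)).aestronglyMeasurable c (ae_of_all _ fun ω => hFc _)
  have hcov : ∀ s ∈ Finset.Icc 1 T, ∀ t ∈ Finset.Icc 1 T,
      cov[fun ω => w s * F (X T s ω), fun ω => w t * F (X T t ω); P] ≤
        4 * c ^ 2 * (w s * ((if t < s + N ∧ s < t + N then b else 0) + e * w t)) := by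
    intro s hs t ht
    have hs' := Finset.mem_Icc.1 hs
    have ht' := Finset.mem_Icc.1 ht
    have hk : |cov[fun ω => F (X T s ω), fun ω => F (X T t ω); P]| ≤
        4 * c ^ 2 * phiMixingCoeff P X (max s t - min s t) := by
      rcases le_total s t with h | h
      · rw [max_eq_right h, min_eq_left h]
        exact abs_covariance_le_phiMixingCoeff hX hF hc hFc hs'.1 h ht'.2
      · rw [max_eq_left h, min_eq_right h, covariance_comm]
        exact abs_covariance_le_phiMixingCoeff hX hF hc hFc ht'.1 h hs'.2
    rw [covariance_const_mul_left, covariance_const_mul_right]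
    -- Pairs at lag below `N` use the trivial bound `φ ≤ 1` and the largest weight `b`; all other
    -- pairs use `φ ≤ e`.
    have hkey : w t * phiMixingCoeff P X (max s t - min s t) ≤
        (if t < s + N ∧ s < t + N then b else 0) + e * w t := by
      split_ifs with h
      · have h1 : w t * phiMixingCoeff P X (max s t - min s t) ≤ w t :=
          mul_le_of_le_one_right (hw0 t) (phiMixingCoeff_le_one _)
        have := hwb t ht
        have := mul_nonneg he (hw0 t)
        linarith
      · have h1 := hN (max s t - min s t) (by omega)
        have := mul_le_mul_of_nonneg_left h1 (hw0 t)
        linarith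
    calc w s * (w t * cov[fun ω => F (X T s ω), fun ω => F (X T t ω); P])
        ≤ w s * (w t * (4 * c ^ 2 * phiMixingCoeff P X (max s t - min s t))) := by
          have := (le_abs_self _).trans hk
          have h1 := hw0 s
          have h2 := hw0 t
          gcongr
      _ = 4 * c ^ 2 * (w s * (w t * phiMixingCoeff P X (max s t - min s t))) := by ring
      _ ≤ _ := by
          have h1 := hw0 s
          gcongr
  rw [variance_fun_sum' fun t _ => (hL2 t).const_mul (w t)]
  refine (Finset.sum_le_sum fun s hs => Finset.sum_le_sum fun t ht => hcov s hs t ht).trans ?_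
  simp_rw [← Finset.mul_sum]
  have hb : 0 ≤ (Finset.Icc 1 T).sum w := Finset.sum_nonneg fun t _ => hw0 t
  have hB : 0 ≤ B := hb.trans hwB
  refine mul_le_mul_of_nonneg_left ?_ (by positivity)
  have hinner : ∀ s ∈ Finset.Icc 1 T, w s * ∑ t ∈ Finset.Icc 1 T,
      ((if t < s + N ∧ s < t + N then b else 0) + e * w t) ≤ w s * (2 * N * b + e * B) := by
    intro s hs
    refine mul_le_mul_of_nonneg_left ?_ (hw0 s)
    rw [Finset.sum_add_distrib, ← Finset.mul_sum, ← Finset.sum_filter, Finset.sum_const,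
      nsmul_eq_mul]
    have hcard : (Finset.filter (fun t => t < s + N ∧ s < t + N) (Finset.Icc 1 T)).card ≤ 2 * N := by
      refine (Finset.card_le_card (t := Finset.Ico (s - N) (s + N)) ?_).trans ?_
      · intro t ht
        simp only [Finset.mem_filter, Finset.mem_Icc, Finset.mem_Ico] at ht ⊢
        omega
      · simp; omega
    have hcard' : ((Finset.filter (fun t => t < s + N ∧ s < t + N) (Finset.Icc 1 T)).card : ℝ) ≤
      2 * N := by exact_mod_cast hcard
    gcongr
  refine (Finset.sum_le_sum hinner).trans ?_
  rw [← Finset.sum_mul]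
  calc (∑ i ∈ Finset.Icc 1 T, w i) * (2 * N * b + e * B) ≤ B * (2 * N * b + e * B) := by gcongr
    _ = _ := by ring

/-- Weak law of large numbers for weighted sums of bounded functions of a mixing array. -/
theorem tendsto_weighted_sum_sub_mean [IsProbabilityMeasure P] (hX : ∀ T t, Measurable (X T t))
    (hmix : Tendsto (phiMixingCoeff P X) atTop (𝓝 0)) {F : S → ℝ} (hF : Measurable F) {c : ℝ}
    (hFc : ∀ x, |F x| ≤ c) {w : ℕ → ℕ → ℝ} {b : ℕ → ℝ} {B : ℝ}
    (hw0 : ∀ᶠ T in atTop, ∀ t, 0 ≤ w T t) (hwb : ∀ᶠ T in atTop, ∀ t, w T t ≤ b T)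
    (hb : Tendsto b atTop (𝓝 0))
    (hwB : ∀ᶠ T in atTop, ∑ t ∈ Finset.Icc 1 T, w T t ≤ B) :
    Tendsto (fun p : ℕ × Ω => ∑ t ∈ Finset.Icc 1 p.1, w p.1 t * F (X p.1 t p.2) -
      ∫ ω, ∑ t ∈ Finset.Icc 1 p.1, w p.1 t * F (X p.1 t ω) ∂P) (highProb P) (𝓝 0) := by
  wlog hc : 0 < c generalizing c
  · exact this (c := |c| + 1) (fun x => (hFc x).trans (by linarith [le_abs_self c])) (by positivity)
  rw [tendsto_highProb_iff]
  intro r hr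
  have hL2 : ∀ T, MemLp (fun ω => ∑ t ∈ Finset.Icc 1 T, w T t * F (X T t ω)) 2 P := fun T =>
    memLp_finsetSum _ fun t _ => (MemLp.of_bound (hF.comp (hX T t)).aestronglyMeasurable c
      (ae_of_all _ fun ω => hFc _)).const_mul (w T t)
  have hvar : Tendsto (fun T => Var[fun ω => ∑ t ∈ Finset.Icc 1 T, w T t * F (X T t ω); P])
      atTop (𝓝 0) := by
    rw [Metric.tendsto_nhds]
    intro e he
    -- The lag is fixed first, so that the distant pairs contribute less than `e / 4`; with `N`
    -- fixed, the contribution of the close pairs vanishes with the largest weight `b T`.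
    obtain ⟨N, hN⟩ := eventually_atTop.1
      (hmix.eventually_le_const (show 0 < e / (16 * c ^ 2 * (B ^ 2 + 1)) by positivity))
    have h1 : Tendsto (fun T => 4 * c ^ 2 * (2 * N * b T * B +
        e / (16 * c ^ 2 * (B ^ 2 + 1)) * B ^ 2)) atTop (𝓝 (4 * c ^ 2 * (2 * N * 0 * B +
        e / (16 * c ^ 2 * (B ^ 2 + 1)) * B ^ 2))) :=
      (((hb.const_mul (2 * (N : ℝ))).mul_const B).add_const _).const_mul _
    have h2 : 4 * c ^ 2 * (2 * N * 0 * B + e / (16 * c ^ 2 * (B ^ 2 + 1)) * B ^ 2) < e := by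
      have : 4 * c ^ 2 * (2 * N * 0 * B + e / (16 * c ^ 2 * (B ^ 2 + 1)) * B ^ 2) =
          e * (B ^ 2 / (4 * (B ^ 2 + 1))) := by field_simp; ring
      rw [this]
      refine mul_lt_of_lt_one_right he ((div_lt_one (by positivity)).2 ?_)
      nlinarith [sq_nonneg B]
    filter_upwards [hw0, hwb, hwB, h1.eventually_lt_const h2] with T h3 h4 h5 h6
    rw [Real.dist_eq, sub_zero, abs_of_nonneg (variance_nonneg _ _)]
    exact (variance_weighted_sum_le hX hF hc hFc h3 ((h3 0).trans (h4 0)) (fun t _ => h4 t) h5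
      (by positivity) hN).trans_lt h6
  have hlim : Tendsto (fun T => ENNReal.ofReal
      (Var[fun ω => ∑ t ∈ Finset.Icc 1 T, w T t * F (X T t ω); P] / r ^ 2)) atTop (𝓝 0) := by
    have := ENNReal.tendsto_ofReal (hvar.div_const (r ^ 2))
    simpa using this
  refine tendsto_of_tendsto_of_tendsto_of_le_of_le tendsto_const_nhds hlim (fun _ => zero_le)
    fun T => ?_
  refine le_trans (measure_mono fun ω hω => ?_) (meas_ge_le_variance_div_sq (hL2 T) hr)
  simpa only [Set.mem_ofPred_eq, Real.dist_eq, sub_zero] using hω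

end MixingCovariance

/-! ### Riemann sums of functions of bounded variation. -/

section KernelSums

/-- The value at the left end of a cell is bounded by the integral and the variation over it. -/
lemma mul_apply_le_integral_add_variation {K : ℝ → ℝ} (hK : ContDiff ℝ 1 K) {a b : ℝ}
    (hab : a ≤ b) :
    (b - a) * K a ≤ (∫ x in a..b, K x) + (b - a) * ∫ x in a..b, |deriv K x| := by
  have hK' : Continuous (deriv K) := hK.continuous_deriv le_rfl
  have hpt : ∀ x ∈ Set.Icc a b, K a - ∫ y in a..b, |deriv K y| ≤ K x := by
    intro x hx
    have h1 : ∫ y in a..x, deriv K y = K x - K a :=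
      intervalIntegral.integral_deriv_eq_sub
        (fun y _ => (hK.differentiable one_ne_zero).differentiableAt)
        (hK'.intervalIntegrable _ _)
    have h2 : |∫ y in a..x, deriv K y| ≤ ∫ y in a..x, |deriv K y| :=
      intervalIntegral.abs_integral_le_integral_abs hx.1
    have h3 : ∫ y in a..x, |deriv K y| ≤ ∫ y in a..b, |deriv K y| :=
      intervalIntegral.integral_mono_interval le_rfl hx.1 hx.2
        (ae_of_all _ fun y => abs_nonneg _) (hK'.abs.intervalIntegrable _ _)
    rw [h1] at h2
    linarith [neg_abs_le (K x - K a)]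
  have := intervalIntegral.integral_mono_on hab (intervalIntegrable_const (μ := volume))
    (hK.continuous.intervalIntegrable a b) hpt
  rw [intervalIntegral.integral_const, smul_eq_mul] at this
  linarith

lemma intervalIntegral_le_integral_of_nonneg {f : ℝ → ℝ} (hf : Integrable f) (h0 : ∀ x, 0 ≤ f x)
    {a b : ℝ} (hab : a ≤ b) : ∫ x in a..b, f x ≤ ∫ x, f x := by
  rw [intervalIntegral.integral_of_le hab]
  exact setIntegral_le_integral hf (ae_of_all _ h0)

/-- Riemann sums of a nonnegative integrable function of bounded variation. -/
lemma sum_equispaced_le {K : ℝ → ℝ} (hK : ContDiff ℝ 1 K) (h0 : ∀ x, 0 ≤ K x) (hi : Integrable K)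
    (hi' : Integrable (deriv K)) {d : ℝ} (hd : 0 ≤ d) (x₀ : ℝ) (n : ℕ) :
    ∑ k ∈ Finset.Icc 1 n, d * K (x₀ - k * d) ≤ (∫ x, K x) + d * ∫ x, |deriv K x| := by
  have hK' : Continuous (deriv K) := hK.continuous_deriv le_rfl
  -- The cells `[x₀ - k d, x₀ - k d + d]`, `1 ≤ k ≤ n`, tile `[x₀ - n d, x₀]`.
  have htel : ∀ f : ℝ → ℝ, Continuous f → ∑ k ∈ Finset.Icc 1 n,
      ∫ x in (x₀ - k * d)..(x₀ - k * d + d), f x = ∫ x in (x₀ - n * d)..x₀, f x := by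
    intro f hf
    induction n with
    | zero => simp
    | succ n ih =>
      rw [Finset.sum_Icc_succ_top (by omega), ih, add_comm]
      have : x₀ - ((n + 1 : ℕ) : ℝ) * d + d = x₀ - n * d := by push_cast; ring
      rw [this]
      exact intervalIntegral.integral_add_adjacent_intervals (hf.intervalIntegrable _ _)
        (hf.intervalIntegrable _ _)
  have hle : x₀ - n * d ≤ x₀ := by
    have : 0 ≤ n * d := by positivity
    linarith
  calc ∑ k ∈ Finset.Icc 1 n, d * K (x₀ - k * d)
      ≤ ∑ k ∈ Finset.Icc 1 n, ((∫ x in (x₀ - k * d)..(x₀ - k * d + d), K x) +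
          d * ∫ x in (x₀ - k * d)..(x₀ - k * d + d), |deriv K x|) := by
        refine Finset.sum_le_sum fun k _ => ?_
        have := mul_apply_le_integral_add_variation hK (a := x₀ - k * d) (b := x₀ - k * d + d)
          (by linarith)
        simpa using this
    _ = (∫ x in (x₀ - n * d)..x₀, K x) + d * ∫ x in (x₀ - n * d)..x₀, |deriv K x| := by
        rw [Finset.sum_add_distrib, ← Finset.mul_sum, htel _ hK.continuous, htel _ hK'.abs]
    _ ≤ _ := by
        gcongr
        · exact intervalIntegral_le_integral_of_nonneg hi h0 hle
        · exact intervalIntegral_le_integral_of_nonneg hi'.abs (fun _ => abs_nonneg _) hle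

/-- Comparison with `(1 + |x|) ^ (-p)`, integrable for `p > 1`. The factor `(1 + L) ^ p` serves the
range `|x| ≤ L`, and `(L / (1 + L)) ^ (-p)` serves the tail, where `|x| ≥ L / (1 + L) * (1 + |x|)`.
-/
lemma integrable_of_le_rpow_tail {f : ℝ → ℝ} (hf : Continuous f) {C L p : ℝ} (hL : 0 < L)
    (hp : 1 < p) (hC : ∀ x, |f x| ≤ C) (htail : ∀ x, L < |x| → |f x| ≤ C * |x| ^ (-p)) :
    Integrable f := by
  have hC0 : 0 ≤ C := (abs_nonneg _).trans (hC 0)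
  have hint : Integrable (fun x : ℝ => (1 + ‖x‖) ^ (-p)) :=
    integrable_one_add_norm (by simpa using hp)
  refine (hint.const_mul (C * ((1 + L) ^ p + (L / (1 + L)) ^ (-p)))).mono'
    hf.aestronglyMeasurable (ae_of_all _ fun x => ?_)
  have hpos : 0 < (1 + ‖x‖) ^ (-p) := by positivity
  have hA : 0 ≤ (1 + L) ^ p := by positivity
  have hB : 0 ≤ (L / (1 + L)) ^ (-p) := by positivity
  rw [Real.norm_eq_abs]
  rcases le_or_gt |x| L with hx | hx
  · have h1 : 1 ≤ (1 + L) ^ p * (1 + ‖x‖) ^ (-p) := by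
      rw [Real.rpow_neg (by positivity), ← div_eq_mul_inv, one_le_div (by positivity)]
      gcongr
      simpa using hx
    calc |f x| ≤ C * 1 := by simpa using hC x
      _ ≤ C * ((1 + L) ^ p * (1 + ‖x‖) ^ (-p)) := by gcongr
      _ ≤ C * (((1 + L) ^ p + (L / (1 + L)) ^ (-p)) * (1 + ‖x‖) ^ (-p)) := by
        gcongr; linarith
      _ = _ := by ring
  · have h1 : |x| ^ (-p) ≤ (L / (1 + L)) ^ (-p) * (1 + ‖x‖) ^ (-p) := by
      rw [← Real.mul_rpow (by positivity) (by positivity)]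
      refine Real.rpow_le_rpow_of_nonpos (by positivity) ?_ (by linarith)
      rw [div_mul_eq_mul_div, div_le_iff₀ (by positivity), Real.norm_eq_abs]
      nlinarith
    calc |f x| ≤ C * |x| ^ (-p) := htail x hx
      _ ≤ C * ((L / (1 + L)) ^ (-p) * (1 + ‖x‖) ^ (-p)) := by gcongr
      _ ≤ C * (((1 + L) ^ p + (L / (1 + L)) ^ (-p)) * (1 + ‖x‖) ^ (-p)) := by
        gcongr; linarith
      _ = _ := by ring

end KernelSums

/-! ### Size, total mass and concentration of the kernel weights. -/

namespace LIIModel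

variable {Ω 𝕏 𝕎 : Type*} {dθ dρ dz H : ℕ} {M : LIIModel Ω 𝕏 𝕎 dθ dρ dz H} {s : ℕ}

lemma KernelBandwidth.contDiff_one (hker : M.KernelBandwidth s) : ContDiff ℝ 1 M.K :=
  hker.K_smooth.of_le (by exact_mod_cast le_trans (by norm_num) hker.two_le)

/-- Both alternatives of the tail condition make the kernel of bounded variation on the line, which
is what controls its Riemann sums. -/
lemma KernelBandwidth.integrable_deriv (hker : M.KernelBandwidth s) :
    Integrable (deriv M.K) := by
  have hK' : Continuous (deriv M.K) := hker.contDiff_one.continuous_deriv le_rfl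
  rcases hker.K_tail with ⟨L, hL, h⟩ | ⟨C, L, p, hL, hp, hC, htail⟩
  · refine hK'.integrable_of_hasCompactSupport
      (HasCompactSupport.of_support_subset_isCompact (isCompact_Icc (a := -L) (b := L)) ?_)
    intro x hx
    by_contra hcon
    refine hx ?_
    have hxL : L < |x| := by
      rw [Set.mem_Icc, ← abs_le] at hcon
      exact not_le.1 hcon
    have : M.K =ᶠ[𝓝 x] fun _ => 0 := by
      filter_upwards [continuous_abs.continuousAt.eventually_const_lt hxL] with y hy using h y hy
    rw [this.deriv_eq, deriv_const]
  · exact integrable_of_le_rpow_tail hK' hL hp hC htail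

lemma KernelBandwidth.Th_pos (hker : M.KernelBandwidth s) {T : ℕ} (hT : 1 ≤ T) :
    0 < (T : ℝ) * M.h T :=
  mul_pos (by exact_mod_cast hT) (hker.h_pos T hT)

lemma KernelBandwidth.weight_nonneg (hker : M.KernelBandwidth s) (v : ℝ) :
    ∀ᶠ T in atTop, ∀ t, 0 ≤ M.weight T v t := by
  filter_upwards [eventually_ge_atTop 1] with T hT t
  exact div_nonneg (hker.K_nonneg _) (hker.Th_pos hT).le

/-- The largest kernel weight tends to zero. -/
lemma KernelBandwidth.exists_weight_le (hker : M.KernelBandwidth s) (v : ℝ) :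
    ∃ b : ℕ → ℝ, Tendsto b atTop (𝓝 0) ∧ ∀ᶠ T in atTop, ∀ t, M.weight T v t ≤ b T := by
  obtain ⟨C, hC⟩ := hker.K_bdd
  refine ⟨fun T => C / ((T : ℝ) * M.h T), hker.Th_top.const_div_atTop C, ?_⟩
  filter_upwards [eventually_ge_atTop 1] with T hT t
  exact div_le_div_of_nonneg_right (hC _) (hker.Th_pos hT).le

/-- The kernel weights have bounded sums. -/
lemma KernelBandwidth.exists_sum_weight_le (hker : M.KernelBandwidth s) (v : ℝ) :
    ∃ B : ℝ, ∀ᶠ T in atTop, ∑ t ∈ Finset.Icc 1 T, M.weight T v t ≤ B := by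
  refine ⟨(∫ x, M.K x) + 1 * ∫ x, |deriv M.K x|, ?_⟩
  filter_upwards [eventually_ge_atTop 1, hker.Th_top.eventually_ge_atTop 1] with T hT hT1
  have hT0 : (T : ℝ) ≠ 0 := by positivity
  have hh := hker.h_pos T hT
  have hle : 1 / ((T : ℝ) * M.h T) ≤ 1 := by
    rw [div_le_one (hker.Th_pos hT)]; exact hT1
  -- The arguments `(v - t/T)/h` are equispaced with mesh `1 / (T h)`, and the mesh is at most one
  -- as soon as `T h ≥ 1`.
  have := sum_equispaced_le hker.contDiff_one hker.K_nonneg hker.K_integrable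
    hker.integrable_deriv (d := 1 / ((T : ℝ) * M.h T))
    (div_nonneg zero_le_one (hker.Th_pos hT).le) (v / M.h T) T
  calc ∑ t ∈ Finset.Icc 1 T, M.weight T v t
      = ∑ k ∈ Finset.Icc 1 T, 1 / ((T : ℝ) * M.h T) *
        M.K (v / M.h T - k * (1 / ((T : ℝ) * M.h T))) := by
        refine Finset.sum_congr rfl fun t _ => ?_
        have : (v - (t : ℝ) / T) / M.h T = v / M.h T - t * (1 / ((T : ℝ) * M.h T)) := by
          field_simp
        rw [weight, this]
        ring
    _ ≤ _ := this
    _ ≤ _ := by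
        have : 0 ≤ ∫ x, |deriv M.K x| := integral_nonneg fun _ => abs_nonneg _
        gcongr

/-- The kernel weights of the observations away from `v` are negligible. -/
lemma KernelBandwidth.tendsto_sum_far_weight (hker : M.KernelBandwidth s) (v : ℝ) {a : ℝ}
    (ha : 0 < a) :
    Tendsto (fun T : ℕ => ∑ t ∈ Finset.Icc 1 T with a < |((t : ℕ) : ℝ) / T - v|,
      M.weight T v t)
      atTop (𝓝 0) := by
  rw [Metric.tendsto_nhds]
  intro e he
  have hd := hker.K_decay.eventually_lt_const (show 0 < e * a / 2 by positivity)
  rw [← Metric.cobounded_eq_cocompact, ← comap_norm_atTop, eventually_comap] at hd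
  obtain ⟨R, hR⟩ := eventually_atTop.1 hd
  have hh : ∀ᶠ T in atTop, M.h T * (|R| + 1) < a := by
    have := hker.h_zero.mul_const (|R| + 1)
    rw [zero_mul] at this
    exact this.eventually_lt_const ha
  filter_upwards [hker.weight_nonneg v, hh, eventually_ge_atTop 1] with T hw hT hT1
  have hhp := hker.h_pos T hT1
  have hTp : (0 : ℝ) < T := by exact_mod_cast hT1
  rw [Real.dist_eq, sub_zero, abs_of_nonneg (Finset.sum_nonneg fun t _ => hw t)]
  -- Away from `v` the kernel argument exceeds `a / h`. There `|x| K(x) < e a / 2` forces `K ≤ e h /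
  -- 2`, hence a weight of at most `e / (2 T)`, and at most `T` such weights add up to `e / 2`.
  have hb : ∀ t ∈ Finset.filter (fun t : ℕ => a < |(t : ℝ) / T - v|) (Finset.Icc 1 T),
      M.weight T v t ≤ e / (2 * T) := by
    intro t ht
    have hta := (Finset.mem_filter.1 ht).2
    set x := (v - (t : ℝ) / T) / M.h T with hx
    have hxa : a / M.h T < |x| := by
      rw [hx, abs_div, abs_of_pos hhp, abs_sub_comm]
      gcongr
    have hxR : R ≤ |x| := by
      have h1 : |R| + 1 < a / M.h T := by rw [lt_div_iff₀ hhp]; linarith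
      linarith [le_abs_self R]
    have h1 := hR |x| hxR x (Real.norm_eq_abs x)
    have hK : M.K x ≤ e * M.h T / 2 := by
      have h2 : a / M.h T * M.K x ≤ e * a / 2 :=
        (mul_le_mul_of_nonneg_right hxa.le (hker.K_nonneg x)).trans h1.le
      rw [div_mul_eq_mul_div, div_le_iff₀ hhp] at h2
      have h3 : a * M.K x ≤ a * (e * M.h T / 2) := by linarith
      exact le_of_mul_le_mul_left h3 ha
    calc M.weight T v t = M.K x / (T * M.h T) := rfl
      _ ≤ (e * M.h T / 2) / (T * M.h T) := by gcongr
      _ = _ := by field_simp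
  refine (Finset.sum_le_card_nsmul _ _ _ hb).trans_lt ?_
  have hcard : ((Finset.filter (fun t : ℕ => a < |(t : ℝ) / T - v|) (Finset.Icc 1 T)).card : ℝ)
      ≤ T := by
    have := Finset.card_filter_le (Finset.Icc 1 T) (fun t : ℕ => a < |(t : ℝ) / T - v|)
    simp only [Nat.card_Icc, add_tsub_cancel_right] at this
    exact_mod_cast this
  rw [nsmul_eq_mul]
  calc _ ≤ (T : ℝ) * (e / (2 * T)) := by gcongr
    _ = e / 2 := by field_simp
    _ < e := by linarith

end LIIModel

/-! ### Uniform convergence, consistency of minimizers and inversion of linear expansions along a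
filter. -/

section FilterLemmas

open Asymptotics

/-- Pointwise convergence of equi-Lipschitz functions on a compact set is uniform. -/
lemma eventually_forall_abs_sub_le_of_lipschitz {α E : Type*} [PseudoMetricSpace E] {l : Filter α}
    {K : Set E} (hK : IsCompact K) {X : α → E → ℝ} {X₀ : E → ℝ} {L : ℝ}
    (hL : ∀ᶠ a in l, ∀ x ∈ K, ∀ y ∈ K, |X a x - X a y| ≤ L * dist x y)
    (hX : ∀ x ∈ K, Tendsto (fun a => X a x) l (𝓝 (X₀ x))) {e : ℝ} (he : 0 < e) :
    ∀ᶠ a in l, ∀ x ∈ K, |X a x - X₀ x| ≤ e := by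
  rcases l.eq_or_neBot with rfl | hl
  · simp
  have hL₀ : ∀ x ∈ K, ∀ y ∈ K, |X₀ x - X₀ y| ≤ L * dist x y := fun x hx y hy =>
    le_of_tendsto ((hX x hx).sub (hX y hy)).abs (hL.mono fun a ha => ha x hx y hy)
  have hr : 0 < e / (3 * (|L| + 1)) := by positivity
  obtain ⟨t, htK, htf, ht⟩ := hK.finite_cover_balls hr
  have hfin : ∀ᶠ a in l, ∀ y ∈ t, |X a y - X₀ y| < e / 3 := by
    rw [eventually_all_finite htf]
    intro y hy
    have := (Metric.tendsto_nhds.1 (hX y (htK hy))) (e / 3) (by positivity)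
    simpa only [Real.dist_eq] using this
  filter_upwards [hL, hfin] with a h1 h2 x hx
  obtain ⟨y, hy, hxy⟩ := Set.mem_iUnion₂.1 (ht hx)
  have hxy' : L * dist x y ≤ e / 3 := by
    calc L * dist x y ≤ (|L| + 1) * dist x y := by
          gcongr; linarith [le_abs_self L]
      _ ≤ (|L| + 1) * (e / (3 * (|L| + 1))) := by gcongr; exact (Metric.mem_ball.1 hxy).le
      _ = e / 3 := by field_simp
  have h3 := (h1 x hx y (htK hy)).trans hxy'
  have h4 := (hL₀ x hx y (htK hy)).trans hxy'
  have h5 := (h2 y hy).le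
  rw [abs_le] at *
  constructor <;> linarith [h3.1, h3.2, h4.1, h4.2, h5.1, h5.2]

/-- Consistency of minimizers, uniformly in a parameter. -/
lemma eventually_forall_dist_argmin_le {α A E : Type*} [PseudoMetricSpace E] {l : Filter α}
    {S : Set A} {K : Set E} {X : α → A → E → ℝ} {X₀ : A → E → ℝ} {x₀ : A → E}
    (hx₀ : ∀ θ ∈ S, x₀ θ ∈ K)
    (hunif : ∀ e : ℝ, 0 < e → ∀ᶠ a in l, ∀ θ ∈ S, ∀ x ∈ K, |X a θ x - X₀ θ x| ≤ e)
    (hsep : ∀ r : ℝ, 0 < r → ∃ η : ℝ, 0 < η ∧ ∀ θ ∈ S, ∀ x ∈ K, r < dist x (x₀ θ) →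
      η ≤ X₀ θ x - X₀ θ (x₀ θ))
    {m : α → A → E} (hm : ∀ᶠ a in l, ∀ θ ∈ S, m a θ ∈ K ∧ IsMinOn (X a θ) K (m a θ))
    {r : ℝ} (hr : 0 < r) : ∀ᶠ a in l, ∀ θ ∈ S, dist (m a θ) (x₀ θ) ≤ r := by
  obtain ⟨η, hη, hs⟩ := hsep r hr
  filter_upwards [hunif (η / 3) (by positivity), hm] with a h1 h2 θ hθ
  by_contra! hcon
  obtain ⟨hmK, hmin⟩ := h2 θ hθ
  have h3 := hs θ hθ _ hmK hcon
  have h4 : X a θ (m a θ) ≤ X a θ (x₀ θ) := hmin (hx₀ θ hθ)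
  have h5 := abs_le.1 (h1 θ hθ _ hmK)
  have h6 := abs_le.1 (h1 θ hθ _ (hx₀ θ hθ))
  linarith

/-- Inversion of an approximate linear equation. -/
lemma isLittleO_add_symm_of_isLittleO {α E F : Type*} [NormedAddCommGroup E] [NormedSpace ℝ E]
    [NormedAddCommGroup F] [NormedSpace ℝ F] {l : Filter α} (A : E ≃L[ℝ] F) {x : α → E} {y : α → F}
    {n : α → ℝ} (hn : ∀ a, 0 ≤ n a)
    (h : (fun a => A (x a) + y a) =o[l] fun a => ‖x a‖ + n a) :
    (fun a => x a + A.symm (y a)) =o[l] fun a => ‖y a‖ + n a := by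
  have h1 : (fun a => x a + A.symm (y a)) =o[l] fun a => ‖x a‖ + n a := by
    have := (A.symm : F →L[ℝ] E).isBigO_comp (fun a => A (x a) + y a) l
    refine (this.trans_isLittleO h).congr_left fun a => ?_
    simp
  -- Absorption: `‖x‖ ≤ (‖x‖ + n) / 2 + ‖A⁻¹‖ ‖y‖` eventually, so `‖x‖ + n` is of the order of `‖y‖
  -- + n`.
  refine h1.trans_isBigO ?_
  refine IsBigO.of_bound (4 * ‖(A.symm : F →L[ℝ] E)‖ + 4) ?_
  filter_upwards [h1.bound (show (0 : ℝ) < 1 / 2 by norm_num)] with a ha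
  have hna := hn a
  rw [Real.norm_of_nonneg (by positivity)] at ha
  rw [Real.norm_of_nonneg (by positivity), Real.norm_of_nonneg (by positivity)]
  have h2 : ‖x a‖ ≤ ‖x a + A.symm (y a)‖ + ‖A.symm (y a)‖ := by
    have := norm_sub_le (x a + A.symm (y a)) (A.symm (y a))
    simpa using this
  have h3 : ‖A.symm (y a)‖ ≤ ‖(A.symm : F →L[ℝ] E)‖ * ‖y a‖ :=
    (A.symm : F →L[ℝ] E).le_opNorm _
  have h4 : 0 ≤ ‖(A.symm : F →L[ℝ] E)‖ * n a := by positivity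
  have h5 : 0 ≤ ‖(A.symm : F →L[ℝ] E)‖ * ‖y a‖ := by positivity
  nlinarith [norm_nonneg (y a)]

end FilterLemmas

/-! ### The criterion and its score: gradients, bounds and Lipschitz constants. -/

namespace LIIModel

variable {Ω 𝕏 𝕎 : Type*} {dθ dρ dz H : ℕ} {M : LIIModel Ω 𝕏 𝕎 dθ dρ dz H}

/-- The criterion as a function of one variable. -/
def critMap (M : LIIModel Ω 𝕏 𝕎 dθ dρ dz H) (p : ℝ × Vec dz × Vec dρ) : ℝ := M.crit p.1 p.2.1 p.2.2

/-- The score as a function of one variable. -/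
def scoreMap (M : LIIModel Ω 𝕏 𝕎 dθ dρ dz H) (p : ℝ × Vec dz × Vec dρ) : Vec dρ :=
  M.score p.1 p.2.1 p.2.2

/-- The inclusion of the auxiliary parameter space. -/
def inclρ (dz dρ : ℕ) : Vec dρ →L[ℝ] ℝ × Vec dz × Vec dρ :=
  (ContinuousLinearMap.inr ℝ ℝ (Vec dz × Vec dρ)).comp (ContinuousLinearMap.inr ℝ (Vec dz) (Vec dρ))

lemma inclρ_apply (x : Vec dρ) : inclρ dz dρ x = (0, 0, x) := rfl

lemma norm_inclρ_le : ‖inclρ dz dρ‖ ≤ 1 := by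
  refine ContinuousLinearMap.opNorm_le_bound _ zero_le_one fun x => ?_
  simp [inclρ_apply, Prod.norm_def]

/-- The restriction of a functional to the auxiliary parameter space, as a vector. -/
def restrictρ (dz dρ : ℕ) : ((ℝ × Vec dz × Vec dρ) →L[ℝ] ℝ) →L[ℝ] Vec dρ :=
  LinearMap.mkContinuous
    { toFun := fun φ => (InnerProductSpace.toDual ℝ (Vec dρ)).symm (φ.comp (inclρ dz dρ))
      map_add' := fun φ ψ => by simp [ContinuousLinearMap.add_comp]
      map_smul' := fun c φ => by simp [ContinuousLinearMap.smul_comp] } 1 fun φ => by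
    rw [LinearMap.coe_mk, AddHom.coe_mk, LinearIsometryEquiv.norm_map, one_mul]
    exact (φ.opNorm_comp_le _).trans (mul_le_of_le_one_right (norm_nonneg _) norm_inclρ_le)

lemma restrictρ_apply (φ : (ℝ × Vec dz × Vec dρ) →L[ℝ] ℝ) :
    restrictρ dz dρ φ = (InnerProductSpace.toDual ℝ (Vec dρ)).symm (φ.comp (inclρ dz dρ)) := rfl

lemma norm_restrictρ_apply_le (φ : (ℝ × Vec dz × Vec dρ) →L[ℝ] ℝ) : ‖restrictρ dz dρ φ‖ ≤ ‖φ‖ := by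
  rw [restrictρ_apply, LinearIsometryEquiv.norm_map]
  exact (φ.opNorm_comp_le _).trans (mul_le_of_le_one_right (norm_nonneg _) norm_inclρ_le)

section Criterion

variable (hs : ContDiff ℝ 2 M.critMap)
include hs

lemma hasFDerivAt_crit (y : ℝ) (z : Vec dz) (ρ : Vec dρ) :
    HasFDerivAt (M.crit y z) ((fderiv ℝ M.critMap (y, z, ρ)).comp (inclρ dz dρ)) ρ := by
  have h1 : HasFDerivAt M.critMap (fderiv ℝ M.critMap (y, z, ρ)) (y, z, ρ) :=
    (hs.differentiable two_ne_zero).differentiableAt.hasFDerivAt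
  have h2 : HasFDerivAt (fun ρ' : Vec dρ => ((y, z, ρ') : ℝ × Vec dz × Vec dρ)) (inclρ dz dρ) ρ := by
    have := ((inclρ dz dρ).hasFDerivAt (x := ρ)).const_add ((y, z, 0) : ℝ × Vec dz × Vec dρ)
    refine this.congr_of_eventuallyEq (Eventually.of_forall fun ρ' => ?_)
    simp [inclρ_apply]
  exact h1.comp ρ h2

/-- As the image of the full derivative under a contraction, the score inherits the bound on the
first derivatives, and the bound on the second derivatives becomes its Lipschitz constant. -/
lemma scoreMap_eq : M.scoreMap = fun p => restrictρ dz dρ (fderiv ℝ M.critMap p) := by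
  ext1 p
  simp only [scoreMap, score, gradient, restrictρ_apply]
  rw [(hasFDerivAt_crit hs p.1 p.2.1 p.2.2).fderiv]

lemma hasGradientAt_crit (y : ℝ) (z : Vec dz) (ρ : Vec dρ) :
    HasGradientAt (M.crit y z) (M.score y z ρ) ρ :=
  (hasFDerivAt_crit hs y z ρ).differentiableAt.hasGradientAt

lemma contDiff_scoreMap : ContDiff ℝ 1 M.scoreMap := by
  rw [scoreMap_eq hs]
  exact (restrictρ dz dρ).contDiff.comp (hs.fderiv_right (by norm_num))

lemma norm_critMap_sub_le {C : ℝ} (hC : ∀ p, ‖fderiv ℝ M.critMap p‖ ≤ C)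
    (p q : ℝ × Vec dz × Vec dρ) : |M.critMap p - M.critMap q| ≤ C * ‖p - q‖ :=
  convex_univ.norm_image_sub_le_of_norm_fderiv_le
    (fun _ _ => (hs.differentiable two_ne_zero).differentiableAt) (fun x _ => hC x)
    (Set.mem_univ q) (Set.mem_univ p)

lemma norm_scoreMap_le {C : ℝ} (hC : ∀ p, ‖fderiv ℝ M.critMap p‖ ≤ C)
    (p : ℝ × Vec dz × Vec dρ) : ‖M.scoreMap p‖ ≤ C := by
  rw [scoreMap_eq hs]
  exact (norm_restrictρ_apply_le _).trans (hC p)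

lemma norm_scoreMap_sub_le {C : ℝ} (hC : ∀ p, ‖iteratedFDeriv ℝ 2 M.critMap p‖ ≤ C)
    (p q : ℝ × Vec dz × Vec dρ) : ‖M.scoreMap p - M.scoreMap q‖ ≤ C * ‖p - q‖ := by
  rw [scoreMap_eq hs]
  simp only
  rw [← map_sub]
  refine (norm_restrictρ_apply_le _).trans ?_
  have hd : Differentiable ℝ (fderiv ℝ M.critMap) :=
    (hs.fderiv_right (m := 1) (by norm_num)).differentiable one_ne_zero
  refine convex_univ.norm_image_sub_le_of_norm_fderiv_le (fun x _ => hd.differentiableAt)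
    (fun x _ => ?_) (Set.mem_univ q) (Set.mem_univ p)
  have h1 := norm_iteratedFDeriv_one (𝕜 := ℝ) (f := fderiv ℝ M.critMap) (x := x)
  rw [← h1, norm_iteratedFDeriv_fderiv]
  exact hC x

lemma hasGradientAt_localCrit (T : ℕ) (v : ℝ) (ω : Ω) (ρ : Vec dρ) :
    HasGradientAt (M.localCrit T v ω) (M.localScore T v ω ρ) ρ := by
  rw [hasGradientAt_iff_hasFDerivAt]
  unfold localCrit localScore
  rw [map_sum]
  refine HasFDerivAt.fun_sum fun t _ => ?_
  rw [map_smulₛₗ]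
  exact (hasGradientAt_crit hs _ _ ρ).hasFDerivAt.const_mul _

lemma hasGradientAt_simCrit (j : Fin H) (T : ℕ) (v : ℝ) (θ : Vec dθ) (ω : Ω) (ρ : Vec dρ) :
    HasGradientAt (M.simCrit j T v θ ω) ((1 / (T : ℝ)) • ∑ t ∈ Finset.Icc 1 T,
      M.score (M.ySim j θ t ω) (M.zSim j v θ t ω) ρ) ρ := by
  rw [hasGradientAt_iff_hasFDerivAt, map_smulₛₗ, map_sum]
  exact (HasFDerivAt.fun_sum fun t _ => (hasGradientAt_crit hs _ _ ρ).hasFDerivAt).const_mul _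

lemma differentiable_localScore (T : ℕ) (v : ℝ) (ω : Ω) : Differentiable ℝ (M.localScore T v ω) := by
  unfold localScore
  refine Differentiable.fun_sum fun t _ => Differentiable.fun_const_smul ?_ _
  intro ρ
  have h1 : DifferentiableAt ℝ M.scoreMap (M.Y T t ω, M.Z T t ω, ρ) :=
    ((contDiff_scoreMap hs).differentiable one_ne_zero).differentiableAt
  exact h1.comp ρ (f := fun ρ' : Vec dρ => ((M.Y T t ω, M.Z T t ω, ρ') : ℝ × Vec dz × Vec dρ))
    (by fun_prop)

end Criterion

end LIIModel

lemma IsMinOn.gradient_eq_zero {d : ℕ} {f : Vec d → ℝ} {K : Set (Vec d)} {x g : Vec d}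
    (h : IsMinOn f K x) (hx : x ∈ interior K) (hg : HasGradientAt f g x) : g = 0 := by
  have h1 : IsLocalMin f x := h.isLocalMin (mem_interior_iff_mem_nhds.1 hx)
  have h2 := h1.hasFDerivAt_eq_zero hg.hasFDerivAt
  simpa using h2

set_option linter.unusedSectionVars false

/-! ### The observed data: consistency and expansion of the local auxiliary estimator, and its limit
criterion. -/

namespace LIIModel

open Asymptotics

variable {Ω 𝕏 𝕎 : Type*} [MeasurableSpace Ω] [MeasurableSpace 𝕏] [MeasurableSpace 𝕎]
  {P : Measure Ω} [IsProbabilityMeasure P] {dθ dρ dz H : ℕ} {M : LIIModel Ω 𝕏 𝕎 dθ dρ dz H}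
  {ρ₀ : ℝ → Vec dθ → Vec dρ} {ε : ℝ} {s : ℕ} {u : ℝ}

lemma AuxiliaryRegularity.exists_bound (haux : M.AuxiliaryRegularity P ρ₀ ε) :
    ∃ C : ℝ, 0 ≤ C ∧ (∀ p, ‖fderiv ℝ M.critMap p‖ ≤ C) ∧
      ∀ p, ‖iteratedFDeriv ℝ 2 M.critMap p‖ ≤ C := by
  obtain ⟨C, hC⟩ := haux.crit_bound
  exact ⟨C, (norm_nonneg _).trans (hC 0).1, fun p => (hC p).1, fun p => (hC p).2⟩

lemma AuxiliaryRegularity.contDiff_critMap (haux : M.AuxiliaryRegularity P ρ₀ ε) :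
    ContDiff ℝ 2 M.critMap := haux.crit_smooth

lemma abs_crit_sub_le {C : ℝ} (hs : ContDiff ℝ 2 M.critMap)
    (hC : ∀ p, ‖fderiv ℝ M.critMap p‖ ≤ C) (y : ℝ) (z : Vec dz) (ρ ρ' : Vec dρ) :
    |M.crit y z ρ - M.crit y z ρ'| ≤ C * ‖ρ - ρ'‖ := by
  have := norm_critMap_sub_le hs hC (y, z, ρ) (y, z, ρ')
  simpa [critMap, Prod.norm_def] using this

lemma abs_crit_sub_le_data {C : ℝ} (hs : ContDiff ℝ 2 M.critMap)
    (hC : ∀ p, ‖fderiv ℝ M.critMap p‖ ≤ C) (x x' : ℝ × Vec dz) (ρ : Vec dρ) :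
    |M.crit x.1 x.2 ρ - M.crit x'.1 x'.2 ρ| ≤ C * ‖x - x'‖ := by
  have := norm_critMap_sub_le hs hC (x.1, x.2, ρ) (x'.1, x'.2, ρ)
  simpa [critMap, Prod.norm_def] using this

lemma measurable_crit (hs : ContDiff ℝ 2 M.critMap) (ρ : Vec dρ) :
    Measurable fun x : ℝ × Vec dz => M.crit x.1 x.2 ρ :=
  (hs.continuous.comp (by fun_prop : Continuous fun x : ℝ × Vec dz =>
    ((x.1, x.2, ρ) : ℝ × Vec dz × Vec dρ))).measurable

lemma measurable_obs (hstruct : M.StructuralRegularity P) (hdep : M.DependenceConditions P)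
    (T t : ℕ) : Measurable (M.obs T t) :=
  ((hstruct.yMap_meas _).comp (hstruct.ν_meas t)).prodMk (hdep.Z_meas T t)

lemma measurable_obsStat (hstruct : M.StructuralRegularity P) (hdep : M.DependenceConditions P)
    (v : ℝ) (t : ℕ) : Measurable (M.obsStat v t) :=
  ((hstruct.yMap_meas _).comp (hstruct.ν_meas t)).prodMk
    ((hdep.ζ_meas v _).comp (hdep.w_meas t))

/-- The increment of the criterion from `ρ'` to `ρ`, as a function of the data. -/
def critDiff (M : LIIModel Ω 𝕏 𝕎 dθ dρ dz H) (ρ ρ' : Vec dρ) (x : ℝ × Vec dz) : ℝ :=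
  M.crit x.1 x.2 ρ - M.crit x.1 x.2 ρ'

lemma measurable_critDiff (hs : ContDiff ℝ 2 M.critMap) (ρ ρ' : Vec dρ) :
    Measurable (M.critDiff ρ ρ') :=
  (measurable_crit hs ρ).sub (measurable_crit hs ρ')

lemma IsPseudoTrue.mem_nbhd (hpseudo : M.IsPseudoTrue P ρ₀) (hstruct : M.StructuralRegularity P)
    (haux : M.AuxiliaryRegularity P ρ₀ ε) (hu : u ∈ M.U) :
    ρ₀ u (M.θ₀ u) ∈ M.nbhd ε (ρ₀ u (M.θ₀ u)) :=
  ⟨hpseudo.mem u hu _ (hstruct.θ₀_mem u hu), by simpa using haux.ε_pos.le⟩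

/-- The criterion is integrable at every auxiliary parameter once it is at one of them. -/
lemma integrable_crit_of_integrable {C : ℝ} (hs : ContDiff ℝ 2 M.critMap)
    (hC : ∀ p, ‖fderiv ℝ M.critMap p‖ ≤ C) {X : Ω → ℝ × Vec dz} (hX : Measurable X)
    {ρ' : Vec dρ} (h : Integrable (fun ω => M.crit (X ω).1 (X ω).2 ρ') P) (ρ : Vec dρ) :
    Integrable (fun ω => M.crit (X ω).1 (X ω).2 ρ) P := by
  have h1 : Integrable (fun ω => M.critDiff ρ ρ' (X ω)) P :=
    Integrable.of_bound ((measurable_critDiff hs ρ ρ').comp hX).aestronglyMeasurable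
      (C * ‖ρ - ρ'‖) (ae_of_all _ fun ω => abs_crit_sub_le hs hC _ _ ρ ρ')
  refine (h1.add h).congr (ae_of_all _ fun ω => ?_)
  simp [critDiff]

section Observed

variable (hstruct : M.StructuralRegularity P) (hdep : M.DependenceConditions P)
  (hpseudo : M.IsPseudoTrue P ρ₀) (haux : M.AuxiliaryRegularity P ρ₀ ε)
  (hker : M.KernelBandwidth s) (hu : u ∈ M.U)

include hstruct hdep hpseudo haux hu

lemma integrable_crit_obs {T t : ℕ} (ht : t ∈ Finset.Icc 1 T) (ρ : Vec dρ) :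
    Integrable (fun ω => M.crit (M.Y T t ω) (M.Z T t ω) ρ) P := by
  obtain ⟨C, -, hC, -⟩ := haux.exists_bound
  obtain ⟨C', hC'⟩ := haux.crit_integrable u hu T t ht
  exact integrable_crit_of_integrable haux.contDiff_critMap hC (measurable_obs hstruct hdep T t)
    (hC' _ (hpseudo.mem_nbhd hstruct haux hu)).1 ρ

lemma integral_weighted_critDiff (T : ℕ) (ρ ρ' : Vec dρ) :
    ∫ ω, ∑ t ∈ Finset.Icc 1 T, M.weight T u t * M.critDiff ρ ρ' (M.obs T t ω) ∂P =
      ∫ ω, M.localCrit T u ω ρ ∂P - ∫ ω, M.localCrit T u ω ρ' ∂P := by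
  have hi : ∀ ρ, Integrable (fun ω => M.localCrit T u ω ρ) P := fun ρ =>
    integrable_finsetSum _ fun t ht =>
      (integrable_crit_obs hstruct hdep hpseudo haux hu ht ρ).const_mul _
  rw [← integral_sub (hi ρ) (hi ρ')]
  congr 1
  ext ω
  simp only [localCrit, critDiff, obs, mul_sub, Finset.sum_sub_distrib]

/-- The criterion may be unbounded, but its increments in `ρ` are bounded by `C ‖ρ - ρ'‖`, as the
mixing law of large numbers requires. Minimization is insensitive to the subtracted term, so only
increments need a limit. -/
lemma tendsto_integral_weighted_critDiff (ρ ρ' : Vec dρ) :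
    Tendsto (fun T : ℕ => ∫ ω, ∑ t ∈ Finset.Icc 1 T,
      M.weight T u t * M.critDiff ρ ρ' (M.obs T t ω) ∂P) atTop
      (𝓝 (M.limCrit P u ρ - M.limCrit P u ρ')) := by
  simp_rw [integral_weighted_critDiff hstruct hdep hpseudo haux hu]
  obtain ⟨l, hl⟩ := haux.limCrit_exists u hu ρ
  obtain ⟨l', hl'⟩ := haux.limCrit_exists u hu ρ'
  have h1 : M.limCrit P u ρ = l := hl.limUnder_eq
  have h2 : M.limCrit P u ρ' = l' := hl'.limUnder_eq
  rw [h1, h2]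
  exact hl.sub hl'

include hker

/-- Increments of the local criterion converge in probability. -/
lemma tendsto_localCrit_sub (ρ ρ' : Vec dρ) :
    Tendsto (fun p : ℕ × Ω => M.localCrit p.1 u p.2 ρ - M.localCrit p.1 u p.2 ρ') (highProb P)
      (𝓝 (M.limCrit P u ρ - M.limCrit P u ρ')) := by
  obtain ⟨C, -, hC, -⟩ := haux.exists_bound
  have hs := haux.contDiff_critMap
  obtain ⟨b, hb0, hb⟩ := hker.exists_weight_le u
  obtain ⟨B, hB⟩ := hker.exists_sum_weight_le u
  have h1 := tendsto_weighted_sum_sub_mean (P := P) (measurable_obs hstruct hdep) hdep.mixing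
    (measurable_critDiff hs ρ ρ') (c := C * ‖ρ - ρ'‖)
    (fun x => abs_crit_sub_le hs hC _ _ ρ ρ') (w := fun T t => M.weight T u t)
    (hker.weight_nonneg u) hb hb0 hB
  have h2 := (tendsto_integral_weighted_critDiff hstruct hdep hpseudo haux hu ρ ρ').comp
    (tendsto_fst_highProb (P := P))
  have h3 := h1.add h2
  rw [zero_add] at h3
  refine h3.congr fun p => ?_
  simp only [Function.comp_apply, sub_add_cancel]
  simp only [localCrit, critDiff, obs, mul_sub, Finset.sum_sub_distrib]

/-- Consistency of the local auxiliary estimator. -/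
theorem tendsto_auxEstimator {ρhat : ℕ → Ω → Vec dρ}
    (hmin : ∀ᶠ p in highProb P, ρhat p.1 p.2 ∈ M.Γ ∧
      IsMinOn (M.localCrit p.1 u p.2) M.Γ (ρhat p.1 p.2)) :
    Tendsto (fun p : ℕ × Ω => ρhat p.1 p.2) (highProb P) (𝓝 (ρ₀ u (M.θ₀ u))) := by
  set ρs := ρ₀ u (M.θ₀ u) with hρs
  obtain ⟨C, hC0, hC, -⟩ := haux.exists_bound
  have hs := haux.contDiff_critMap
  obtain ⟨B, hB⟩ := hker.exists_sum_weight_le u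
  have hlip : ∀ᶠ p : ℕ × Ω in highProb P, ∀ ρ ∈ M.Γ, ∀ ρ' ∈ M.Γ,
      |(M.localCrit p.1 u p.2 ρ - M.localCrit p.1 u p.2 ρs) -
        (M.localCrit p.1 u p.2 ρ' - M.localCrit p.1 u p.2 ρs)| ≤ (B * C) * dist ρ ρ' := by
    filter_upwards [tendsto_fst_highProb.eventually hB,
      tendsto_fst_highProb.eventually (hker.weight_nonneg u)] with p h1 h2 ρ _ ρ' _
    rw [sub_sub_sub_cancel_right, localCrit, localCrit, ← Finset.sum_sub_distrib]
    refine (Finset.abs_sum_le_sum_abs _ _).trans ?_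
    calc _ ≤ ∑ t ∈ Finset.Icc 1 p.1, M.weight p.1 u t * (C * dist ρ ρ') := by
          refine Finset.sum_le_sum fun t _ => ?_
          rw [← mul_sub, abs_mul, abs_of_nonneg (h2 t), dist_eq_norm]
          exact mul_le_mul_of_nonneg_left (abs_crit_sub_le hs hC _ _ ρ ρ') (h2 t)
      _ = (∑ t ∈ Finset.Icc 1 p.1, M.weight p.1 u t) * (C * dist ρ ρ') := by
          rw [Finset.sum_mul]
      _ ≤ B * (C * dist ρ ρ') := by gcongr
      _ = _ := by ring
  have hunif := fun (e : ℝ) (he : 0 < e) =>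
    eventually_forall_abs_sub_le_of_lipschitz haux.Γ_compact hlip
      (fun ρ _ => tendsto_localCrit_sub hstruct hdep hpseudo haux hker hu ρ ρs) he
  -- The argmin lemma with a one-point parameter set.
  have hcons := fun (r : ℝ) (hr : 0 < r) => eventually_forall_dist_argmin_le (A := Unit)
    (S := Set.univ) (l := highProb P)
    (X := fun p _ ρ => M.localCrit p.1 u p.2 ρ - M.localCrit p.1 u p.2 ρs)
    (X₀ := fun _ ρ => M.limCrit P u ρ - M.limCrit P u ρs) (x₀ := fun _ => ρs)
    (K := M.Γ) (m := fun p _ => ρhat p.1 p.2)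
    (fun _ _ => hpseudo.mem u hu _ (hstruct.θ₀_mem u hu))
    (fun e he => (hunif e he).mono fun p hp _ _ => hp)
    (fun r hr => by
      obtain ⟨η, hη, h⟩ := haux.well_separated u hu r hr
      refine ⟨η, hη, fun _ _ ρ hρ hd => ?_⟩
      rw [dist_eq_norm] at hd
      have := h ρ hρ hd
      simpa using this)
    (hmin.mono fun p hp _ _ => ⟨hp.1, isMinOn_iff.2 fun ρ hρ =>
      sub_le_sub_right (isMinOn_iff.1 hp.2 ρ hρ) _⟩) hr
  rw [Metric.tendsto_nhds]
  intro e he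
  filter_upwards [hcons (e / 2) (by positivity)] with p hp
  exact (hp () trivial).trans_lt (by linarith)

/-- Linear expansion of the local auxiliary estimator. -/
theorem auxEstimator_expansion {V : ℝ → Matrix (Fin dρ) (Fin dρ) ℝ}
    (hnorm : M.LocalNormality P ρ₀ V u) (hρint : ρ₀ u (M.θ₀ u) ∈ interior M.Γ)
    {ρhat : ℕ → Ω → Vec dρ}
    (hmin : ∀ᶠ p in highProb P, ρhat p.1 p.2 ∈ M.Γ ∧
      IsMinOn (M.localCrit p.1 u p.2) M.Γ (ρhat p.1 p.2)) :
    (fun p : ℕ × Ω => fderiv ℝ (M.limScore P u) (ρ₀ u (M.θ₀ u)) (ρhat p.1 p.2 - ρ₀ u (M.θ₀ u)) +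
      M.localScore p.1 u p.2 (ρ₀ u (M.θ₀ u))) =o[highProb P]
      fun p => ρhat p.1 p.2 - ρ₀ u (M.θ₀ u) := by
  set ρs := ρ₀ u (M.θ₀ u) with hρs
  have hs := haux.contDiff_critMap
  have hcons := tendsto_auxEstimator hstruct hdep hpseudo haux hker hu hmin
  obtain ⟨ε', hε', hder⟩ := hnorm.score_deriv
  obtain ⟨L, hL⟩ := hnorm.limScore_lipschitz
  have hL0 : ∀ ρ ∈ M.Γ, ‖fderiv ℝ (M.limScore P u) ρ - fderiv ℝ (M.limScore P u) ρs‖ ≤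
      |L| * ‖ρ - ρs‖ := fun ρ hρ => by
    have := (hL u hu u hu ρ hρ ρs (interior_subset hρint)).2
    rw [sub_self, abs_zero, zero_add] at this
    exact this.trans (mul_le_mul_of_nonneg_right (le_abs_self L) (norm_nonneg _))
  rw [isLittleO_iff]
  intro c hc
  obtain ⟨r₁, hr₁, hball⟩ := Metric.isOpen_iff.1 isOpen_interior ρs hρint
  -- Within this radius the points stay in the interior of `Γ`, the uniform convergence of `∂Ψ_T`
  -- applies, and `∂Ψ₀` moves by at most `c / 2`.
  set r := min (min r₁ ε') (c / (2 * (|L| + 1))) with hr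
  have hr0 : 0 < r := by positivity
  have hd := eventually_highProb_iff (P := P) (q := fun p => ¬ ∃ v ∈ M.U,
    ∃ ρ ∈ M.nbhd ε' (ρ₀ v (M.θ₀ v)),
    c / 2 ≤ ‖fderiv ℝ (M.localScore p.1 v p.2) ρ - fderiv ℝ (M.limScore P v) ρ‖)
  simp only [not_not] at hd
  have hd := hd.2 (hder (c / 2) (by positivity))
  filter_upwards [hmin, hd, (Metric.tendsto_nhds.1 hcons) r hr0] with p h1 h2 h3
  have hfoc : M.localScore p.1 u p.2 (ρhat p.1 p.2) = 0 := h1.2.gradient_eq_zero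
    (hball (Metric.ball_subset_ball ((min_le_left _ _).trans (min_le_left _ _)) h3))
    (hasGradientAt_localCrit hs _ _ _ _)
  -- Mean value inequality for `Ψ_T` minus the linear map `∂Ψ₀(ρs)`: its derivative is at most `c /
  -- 2` from the convergence of `∂Ψ_T` plus `c / 2` from the Lipschitz bound. Since `Ψ_T(ρ̂) = 0`,
  -- this is the expansion.
  have hmv := (convex_ball ρs r).norm_image_sub_le_of_norm_fderiv_le'
    (f := M.localScore p.1 u p.2) (φ := fderiv ℝ (M.limScore P u) ρs) (C := c) (𝕜 := ℝ)
    (fun ρ _ => (differentiable_localScore hs _ _ _).differentiableAt)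
    (fun ρ hρ => by
      have hρΓ : ρ ∈ M.Γ := interior_subset (hball
        (Metric.ball_subset_ball ((min_le_left _ _).trans (min_le_left _ _)) hρ))
      have hρr : ‖ρ - ρs‖ < r := by rw [← dist_eq_norm]; exact hρ
      have h4 : ‖fderiv ℝ (M.localScore p.1 u p.2) ρ - fderiv ℝ (M.limScore P u) ρ‖ < c / 2 := by
        by_contra! hcon
        exact h2 ⟨u, hu, ρ, ⟨hρΓ,
          hρr.le.trans ((min_le_left _ _).trans (min_le_right _ _))⟩, hcon⟩
      have h5 : |L| * ‖ρ - ρs‖ ≤ c / 2 := by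
        calc |L| * ‖ρ - ρs‖ ≤ (|L| + 1) * (c / (2 * (|L| + 1))) := by
              gcongr
              · linarith
              · exact hρr.le.trans (min_le_right _ _)
          _ = c / 2 := by field_simp
      have h6 := hL0 ρ hρΓ
      calc _ = ‖(fderiv ℝ (M.localScore p.1 u p.2) ρ - fderiv ℝ (M.limScore P u) ρ) +
            (fderiv ℝ (M.limScore P u) ρ - fderiv ℝ (M.limScore P u) ρs)‖ := by
            rw [sub_add_sub_cancel]
        _ ≤ _ := norm_add_le _ _
        _ ≤ c := by linarith)
    (Metric.mem_ball_self hr0) h3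
  rw [hfoc] at hmv
  refine le_trans (le_of_eq ?_) hmv
  rw [zero_sub, ← norm_neg]
  congr 1
  abel

/-- Mean increments of the local criterion are asymptotically proportional to those of the
stationary approximation at `u`. -/
lemma tendsto_integral_sub_sum_weight {ρ : Vec dρ} (hρ : ρ ∈ M.nbhd ε (ρ₀ u (M.θ₀ u)))
    {D : ℝ} (hD : ∀ t, 1 ≤ t →
      ∫ ω, M.critDiff ρ (ρ₀ u (M.θ₀ u)) (M.obsStat u t ω) ∂P = D) :
    Tendsto (fun T : ℕ => (∫ ω, ∑ t ∈ Finset.Icc 1 T,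
      M.weight T u t * M.critDiff ρ (ρ₀ u (M.θ₀ u)) (M.obs T t ω) ∂P) -
      (∑ t ∈ Finset.Icc 1 T, M.weight T u t) * D) atTop (𝓝 0) := by
  set ρs := ρ₀ u (M.θ₀ u) with hρs
  obtain ⟨C, hC0, hC, -⟩ := haux.exists_bound
  have hs := haux.contDiff_critMap
  obtain ⟨B, hB⟩ := hker.exists_sum_weight_le u
  set F := M.critDiff ρ ρs with hF
  have hFm : Measurable F := measurable_critDiff hs ρ ρs
  set C₀ := C * ‖ρ - ρs‖ with hC₀
  have hC₀0 : 0 ≤ C₀ := by positivity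
  have hFb : ∀ x, |F x| ≤ C₀ := fun x => abs_crit_sub_le hs hC _ _ ρ ρs
  have hFl : ∀ x x', |F x - F x'| ≤ 2 * C * ‖x - x'‖ := fun x x' => by
    have h1 := abs_crit_sub_le_data hs hC x x' ρ
    have h2 := abs_crit_sub_le_data hs hC x x' ρs
    have : F x - F x' = (M.crit x.1 x.2 ρ - M.crit x'.1 x'.2 ρ) -
      (M.crit x.1 x.2 ρs - M.crit x'.1 x'.2 ρs) := by simp only [hF, critDiff]; ring
    rw [this]
    refine (abs_sub _ _).trans ?_
    linarith
  have hFi : ∀ X : Ω → ℝ × Vec dz, Measurable X → Integrable (fun ω => F (X ω)) P := fun X hX =>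
    Integrable.of_bound (hFm.comp hX).aestronglyMeasurable C₀ (ae_of_all _ fun ω => hFb _)
  have hobs := measurable_obs hstruct hdep
  have hstat := measurable_obsStat hstruct hdep
  obtain ⟨-, CT, η, Bη, hη, hCm, hCη, hCT⟩ := hdep.locallyStationary
  -- Markov's inequality for `|C_T| ^ η` gives `C_T / T → 0` in probability, however small `η` is.
  have hprob : ∀ r : ℝ, 0 < r → Tendsto (fun T : ℕ => P.real {ω | T * r ≤ |CT T ω|})
      atTop (𝓝 0) := by
    intro r hr
    have hmk : ∀ T : ℕ, 1 ≤ T → P {ω | T * r ≤ |CT T ω|} ≤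
        ENNReal.ofReal Bη / ENNReal.ofReal ((T * r) ^ η) := by
      intro T hT
      have hTr : 0 < (T : ℝ) * r := by positivity
      have hm : AEMeasurable (fun ω => ENNReal.ofReal (|CT T ω| ^ η)) P := by
        have := hCm T
        fun_prop
      have := meas_ge_le_lintegral_div hm (ε := ENNReal.ofReal ((T * r) ^ η))
        (by simpa using by positivity) (by simp)
      refine le_trans (measure_mono fun ω hω => ?_) (this.trans (ENNReal.div_le_div_right (hCη T) _))
      exact ENNReal.ofReal_le_ofReal (Real.rpow_le_rpow hTr.le hω hη.le)
    have hlim : Tendsto (fun T : ℕ => ENNReal.ofReal Bη / ENNReal.ofReal (((T : ℝ) * r) ^ η)) atTop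
        (𝓝 0) := by
      have h1 : Tendsto (fun T : ℕ => ((T : ℝ) * r) ^ η) atTop atTop :=
        (tendsto_rpow_atTop hη).comp (tendsto_natCast_atTop_atTop.atTop_mul_const hr)
      have h2 := ENNReal.tendsto_ofReal_atTop.comp h1
      have h3 := ENNReal.Tendsto.const_div h2 (a := ENNReal.ofReal Bη) (Or.inr (by simp))
      simpa using h3
    have hz : Tendsto (fun T : ℕ => P {ω | T * r ≤ |CT T ω|}) atTop (𝓝 0) := by
      refine tendsto_of_tendsto_of_tendsto_of_le_of_le' tendsto_const_nhds hlim
        (Eventually.of_forall fun _ => zero_le) ?_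
      filter_upwards [eventually_ge_atTop 1] with T hT using hmk T hT
    exact (ENNReal.tendsto_toReal_zero_iff (fun _ => measure_ne_top _ _)).2 hz
  rw [Metric.tendsto_nhds]
  intro e he
  have hB' : 0 < |B| + 1 := by positivity
  -- Error budget: a total weight of at most `|B| + 1` times `3 e₁` costs `3 e / 8`, and the
  -- observations far from `u` cost `e / 4`.
  set e₁ := e / (8 * (|B| + 1)) with he₁
  have he₁0 : 0 < e₁ := by positivity
  obtain ⟨a₁, a₂, ha₁, ha₂, heq⟩ := haux.equicontinuous (e₁ / 2) (by positivity)
  have hfar := (hker.tendsto_sum_far_weight u ha₁).eventually_lt_const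
    (show 0 < e / (8 * (C₀ + 1)) by positivity)
  have hr0 : 0 < e₁ / (2 * (C + 1)) := by positivity
  have hpr := (hprob _ hr0).eventually_lt_const (show 0 < e₁ / (2 * (C₀ + 1)) by positivity)
  filter_upwards [hker.weight_nonneg u, hB, hfar, hpr, eventually_ge_atTop 1] with T hw hwB h1 h2 hT
  have hTp : (0 : ℝ) < T := by exact_mod_cast hT
  have hint : ∫ ω, ∑ t ∈ Finset.Icc 1 T, M.weight T u t * F (M.obs T t ω) ∂P =
      ∑ t ∈ Finset.Icc 1 T, M.weight T u t * ∫ ω, F (M.obs T t ω) ∂P := by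
    rw [integral_finsetSum _ fun t _ => (hFi _ (hobs T t)).const_mul _]
    simp_rw [integral_const_mul]
  have hle : ∀ Z : Ω → ℝ, ∀ c : ℝ, (∀ ω, |Z ω| ≤ c) → |∫ ω, Z ω ∂P| ≤ c := fun Z c h => by
    rw [← Real.norm_eq_abs]
    exact (norm_integral_le_of_norm_le_const (ae_of_all _ h)).trans (by simp)
  -- Local stationarity. Outside `E` the data are within `e₁ / (2 (C + 1))` of their approximation
  -- and `F` is Lipschitz; on `E` only `|F| ≤ C₀` is used, and `E` has small probability.
  have step1 : ∀ t ∈ Finset.Icc 1 T, |∫ ω, F (M.obs T t ω) ∂P -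
      ∫ ω, F (M.obsStat ((t : ℝ) / T) t ω) ∂P| ≤ 2 * e₁ := by
    intro t ht
    set E := {ω | T * (e₁ / (2 * (C + 1))) ≤ |CT T ω|} with hE
    have hEm : MeasurableSet E := measurableSet_le measurable_const (hCm T).abs
    rw [← integral_sub (hFi _ (hobs T t)) (hFi _ (hstat _ t)), ← Real.norm_eq_abs]
    have hptw : ∀ᵐ ω ∂P, ‖F (M.obs T t ω) - F (M.obsStat ((t : ℝ) / T) t ω)‖ ≤
        e₁ + E.indicator (fun _ => 2 * C₀) ω := by
      filter_upwards [hCT T hT] with ω hω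
      have hω := hω t ht
      by_cases hωE : ω ∈ E
      · rw [Set.indicator_of_mem hωE]
        have := abs_sub (F (M.obs T t ω)) (F (M.obsStat ((t : ℝ) / T) t ω))
        have := hFb (M.obs T t ω)
        have := hFb (M.obsStat ((t : ℝ) / T) t ω)
        rw [Real.norm_eq_abs]
        linarith
      · rw [Set.indicator_of_notMem hωE, add_zero]
        simp only [hE, Set.mem_ofPred_eq, not_le] at hωE
        have h3 : CT T ω / T ≤ e₁ / (2 * (C + 1)) := by
          rw [div_le_iff₀ hTp]
          linarith [le_abs_self (CT T ω)]
        calc _ ≤ 2 * C * ‖M.obs T t ω - M.obsStat ((t : ℝ) / T) t ω‖ := hFl _ _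
          _ ≤ 2 * (C + 1) * (e₁ / (2 * (C + 1))) := by
            gcongr
            · linarith
            · exact hω.trans h3
          _ = e₁ := by field_simp
    have hii : Integrable (E.indicator fun _ => 2 * C₀) P := (integrable_const _).indicator hEm
    refine (norm_integral_le_of_norm_le ((integrable_const _).add hii) hptw).trans ?_
    simp only [Pi.add_apply]
    rw [integral_add (integrable_const _) hii, integral_indicator_const _ hEm]
    simp only [integral_const, probReal_univ, smul_eq_mul, one_mul]
    have : P.real E * (2 * C₀) ≤ e₁ := by
      calc P.real E * (2 * C₀) ≤ e₁ / (2 * (C₀ + 1)) * (2 * (C₀ + 1)) := by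
            gcongr
            linarith
        _ = e₁ := by field_simp
    linarith
  -- Equicontinuity in rescaled time, `e₁ / 2` for each of `ρ` and `ρs`. It is applied with equal
  -- auxiliary parameters, and so asks that `ρ` lie in the neighbourhood of the pseudo-true value.
  have step2 : ∀ t ∈ Finset.Icc 1 T, |(t : ℝ) / T - u| ≤ a₁ →
      |∫ ω, F (M.obsStat ((t : ℝ) / T) t ω) ∂P - D| ≤ e₁ := by
    intro t ht hta
    have ht' := Finset.mem_Icc.1 ht
    have htI : (t : ℝ) / T ∈ Set.Icc (0 : ℝ) 1 := by
      refine ⟨by positivity, (div_le_one hTp).2 (by exact_mod_cast ht'.2)⟩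
    have hρsn := hpseudo.mem_nbhd hstruct haux hu
    obtain ⟨i1, i2, i3⟩ := heq u hu ρ hρ _ htI hta ρ hρ.1 (by simpa using ha₂.le) t ht'.1
    obtain ⟨i4, i5, i6⟩ := heq u hu ρs hρsn _ htI hta ρs hρsn.1 (by simpa using ha₂.le) t ht'.1
    rw [← hD t ht'.1]
    simp only [hF, critDiff]
    rw [integral_sub i2 i5, integral_sub i1 i4]
    rw [abs_le] at *
    constructor <;> linarith [i3.1, i3.2, i6.1, i6.2]
  have hDb : |D| ≤ C₀ := by rw [← hD 1 le_rfl]; exact hle _ _ fun ω => hFb _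
  have step3 : ∀ t ∈ Finset.Icc 1 T, |M.weight T u t * ∫ ω, F (M.obs T t ω) ∂P -
      M.weight T u t * D| ≤ M.weight T u t * (3 * e₁) +
        (if a₁ < |(t : ℝ) / T - u| then M.weight T u t else 0) * (2 * C₀) := by
    intro t ht
    rw [← mul_sub, abs_mul, abs_of_nonneg (hw t)]
    split_ifs with hta
    · rw [← mul_add]
      refine mul_le_mul_of_nonneg_left ?_ (hw t)
      refine (abs_sub _ _).trans ?_
      have := hle _ _ fun ω => hFb (M.obs T t ω)
      linarith
    · rw [zero_mul, add_zero]
      refine mul_le_mul_of_nonneg_left ?_ (hw t)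
      have h3 := step1 t ht
      have h4 := step2 t ht (not_lt.1 hta)
      rw [abs_le] at *
      constructor <;> linarith [h3.1, h3.2, h4.1, h4.2]
  rw [Real.dist_eq, sub_zero, hint, Finset.sum_mul, ← Finset.sum_sub_distrib]
  have hsum0 : 0 ≤ ∑ t ∈ Finset.Icc 1 T, M.weight T u t := Finset.sum_nonneg fun t _ => hw t
  calc _ ≤ _ := Finset.abs_sum_le_sum_abs _ _
    _ ≤ _ := Finset.sum_le_sum step3
    _ = (∑ t ∈ Finset.Icc 1 T, M.weight T u t) * (3 * e₁) +
        (∑ t ∈ Finset.Icc 1 T with a₁ < |((t : ℕ) : ℝ) / T - u|, M.weight T u t) * (2 * C₀) := by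
      rw [Finset.sum_add_distrib, ← Finset.sum_mul, ← Finset.sum_mul, Finset.sum_filter]
    _ ≤ (|B| + 1) * (3 * e₁) + e / (8 * (C₀ + 1)) * (2 * (C₀ + 1)) := by
      gcongr
      · linarith [le_abs_self B]
      · linarith
    _ = 3 / 8 * e + 1 / 4 * e := by rw [he₁]; field_simp; norm_num
    _ < e := by linarith

/-- Near the pseudo-true value, the limit criterion is proportional, up to a constant, to the
expected criterion of the stationary approximation at `u`. -/
theorem exists_limCrit_sub_eq_mul :
    ∃ c : ℝ, ∀ ρ ∈ M.nbhd ε (ρ₀ u (M.θ₀ u)), ∀ D : ℝ,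
      (∀ t, 1 ≤ t → ∫ ω, M.critDiff ρ (ρ₀ u (M.θ₀ u)) (M.obsStat u t ω) ∂P = D) →
      M.limCrit P u ρ - M.limCrit P u (ρ₀ u (M.θ₀ u)) = c * D := by
  obtain ⟨B, hB⟩ := hker.exists_sum_weight_le u
  have hev : ∀ᶠ T in atTop, ∑ t ∈ Finset.Icc 1 T, M.weight T u t ∈ Set.Icc 0 B := by
    filter_upwards [hker.weight_nonneg u, hB] with T h1 h2
    exact ⟨Finset.sum_nonneg fun t _ => h1 t, h2⟩
  -- A subsequential limit of the total kernel weight is enough: the limit criterion exists along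
  -- the whole sequence, and the subsequence does not depend on `ρ`.
  obtain ⟨c, -, φ, hφ, hc⟩ := isCompact_Icc.tendsto_subseq' hev.frequently
  refine ⟨c, fun ρ hρ D hD => ?_⟩
  have h1 := tendsto_integral_weighted_critDiff hstruct hdep hpseudo haux hu ρ (ρ₀ u (M.θ₀ u))
  have h2 := tendsto_integral_sub_sum_weight hstruct hdep hpseudo haux hker hu hρ hD
  have h3 := (h1.sub h2).comp hφ.tendsto_atTop
  rw [sub_zero] at h3
  refine tendsto_nhds_unique h3 ((hc.mul_const D).congr fun n => ?_)
  simp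

end Observed

end LIIModel

/-! ### First order expansion of ergodic averages in a parameter. -/

section StochasticDifferentiability

open Asymptotics

variable {S E G : Type*} [MeasurableSpace S] [NormedAddCommGroup E] [NormedSpace ℝ E]
  [FiniteDimensional ℝ E] [NormedAddCommGroup G] [NormedSpace ℝ G] [FiniteDimensional ℝ G]
  [MeasurableSpace G] [BorelSpace G]

/-- The derivative of a measurable family of functions at a point is measurable. -/
lemma stronglyMeasurable_of_hasFDerivAt {F : S → E → G} {F' : S → E →L[ℝ] G} {p₀ : E}
    (hFm : ∀ p, Measurable fun x => F x p) (hFd : ∀ x, HasFDerivAt (F x) (F' x) p₀) :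
    StronglyMeasurable F' := by
  have : ProperSpace G := FiniteDimensional.proper ℝ G
  -- Directional derivatives are limits of measurable difference quotients with step `1 / (n + 1)`;
  -- the derivative is then rebuilt from its values on a basis.
  have happ : ∀ v : E, Measurable fun x => F' x v := by
    intro v
    refine measurable_of_tendsto_metrizable
      (f := fun (n : ℕ) x => ((n : ℝ) + 1) • (F x (p₀ + ((n : ℝ) + 1)⁻¹ • v) - F x p₀))
      (fun n => ((hFm _).sub (hFm _)).const_smul _) ?_
    rw [tendsto_pi_nhds]
    intro x
    refine (hFd x).lim v (c := fun n : ℕ => (n : ℝ) + 1) ?_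
    refine tendsto_norm_atTop_atTop.comp ?_
    exact tendsto_atTop_add_const_right _ _ tendsto_natCast_atTop_atTop
  let b := Module.finBasis ℝ E
  let c : Fin (Module.finrank ℝ E) → (E →L[ℝ] ℝ) := fun i => LinearMap.toContinuousLinearMap (b.coord i)
  have hsum : F' = fun x => ∑ i, ContinuousLinearMap.smulRightL ℝ E G (c i) (F' x (b i)) := by
    ext1 x
    ext v
    conv_lhs => rw [← b.sum_repr v, map_sum]
    simp [c]
  rw [hsum]
  refine Finset.stronglyMeasurable_fun_sum _ fun i _ => ?_
  exact (ContinuousLinearMap.continuous _).comp_stronglyMeasurable (happ (b i)).stronglyMeasurable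

/-- A dominated family of differentiable functions is differentiable uniformly in the mean: the
difference quotients are bounded by a measurable function with small integral. -/
lemma exists_integrable_remainder_bound {μ : Measure S} {F : S → E → G} {F' : S → E →L[ℝ] G}
    {p₀ : E} (hFm : ∀ p, Measurable fun x => F x p) (hFc : ∀ x, Continuous (F x))
    (hFd : ∀ x, HasFDerivAt (F x) (F' x) p₀) {L : S → ℝ} (hLi : Integrable L μ) {r₀ : ℝ}
    (hr₀ : 0 < r₀) (hL : ∀ x, ∀ p ∈ Metric.ball p₀ r₀, ‖F x p - F x p₀‖ ≤ L x * ‖p - p₀‖)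
    {e : ℝ} (he : 0 < e) :
    ∃ (R : S → ℝ) (r : ℝ), 0 < r ∧ Integrable R μ ∧ ∫ x, R x ∂μ < e ∧
      ∀ x, ∀ p ∈ Metric.ball p₀ r, ‖F x p - F x p₀ - F' x (p - p₀)‖ ≤ R x * ‖p - p₀‖ := by
  have : ProperSpace G := FiniteDimensional.proper ℝ G
  have : ProperSpace E := FiniteDimensional.proper ℝ E
  have hF'm := stronglyMeasurable_of_hasFDerivAt hFm hFd
  have hball : ∀ᶠ p in 𝓝 p₀, p ∈ Metric.ball p₀ r₀ := Metric.ball_mem_nhds p₀ hr₀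
  have hLa : ∀ x, ∀ p ∈ Metric.ball p₀ r₀, ‖F x p - F x p₀‖ ≤ |L x| * ‖p - p₀‖ := fun x p hp =>
    (hL x p hp).trans (mul_le_mul_of_nonneg_right (le_abs_self _) (norm_nonneg _))
  have hF'L : ∀ x, ‖F' x‖ ≤ |L x| := fun x =>
    (hFd x).le_of_lip' (abs_nonneg _) (hball.mono fun p hp => hLa x p hp)
  let d : ℕ → E := TopologicalSpace.denseSeq E
  let rem : S → E → G := fun x p => F x p - F x p₀ - F' x (p - p₀)
  have hrem : ∀ x, ∀ p ∈ Metric.ball p₀ r₀, ‖rem x p‖ ≤ 2 * |L x| * ‖p - p₀‖ := by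
    intro x p hp
    refine (norm_sub_le _ _).trans ?_
    have h1 := hLa x p hp
    have h2 := (F' x).le_of_opNorm_le (hF'L x) (p - p₀)
    linarith
  have hremm : ∀ p, Measurable fun x => rem x p := fun p =>
    ((hFm p).sub (hFm p₀)).sub ((ContinuousLinearMap.apply ℝ G (p - p₀)).continuous.comp_stronglyMeasurable
      hF'm).measurable
  have hremc : ∀ x, Continuous (rem x) := fun x => by
    have := hFc x
    fun_prop
  let ρ : ℕ → ℝ := fun n => r₀ / (n + 1)
  have hρ0 : ∀ n, 0 < ρ n := fun n => by positivity
  have hρle : ∀ n, ρ n ≤ r₀ := fun n => div_le_self hr₀.le (by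
    have : (0 : ℝ) ≤ n := by positivity
    linarith)
  have hρlim : Tendsto ρ atTop (𝓝 0) := by
    have := (tendsto_one_div_add_atTop_nhds_zero_nat (𝕜 := ℝ)).const_mul r₀
    simpa [ρ, div_eq_mul_inv] using this
  -- Difference quotients of the remainder at countably many dense points, so that their supremum
  -- over a ball is measurable. This supremum is dominated by `2 |L|` and tends to zero pointwise by
  -- differentiability; dominated convergence then makes its integral small.
  let q : ℕ → ℕ → S → ℝ := fun n i x =>
    if ‖d i - p₀‖ < ρ n then ‖rem x (d i)‖ / ‖d i - p₀‖ else 0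
  have hq0 : ∀ n i x, 0 ≤ q n i x := fun n i x => by
    simp only [q]; split_ifs <;> positivity
  have hqle : ∀ n i x c, 0 ≤ c → (∀ p ∈ Metric.ball p₀ (ρ n), ‖rem x p‖ ≤ c * ‖p - p₀‖) →
      q n i x ≤ c := by
    intro n i x c hc h
    simp only [q]
    split_ifs with hi
    · exact div_le_of_le_mul₀ (norm_nonneg _) hc (h _ (by rwa [mem_ball_iff_norm]))
    · exact hc
  have hqL : ∀ n i x, q n i x ≤ 2 * |L x| := fun n i x => hqle n i x _ (by positivity)
    fun p hp => hrem x p (Metric.ball_subset_ball (hρle n) hp)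
  have hqm : ∀ n i, Measurable (q n i) := fun n i => by
    simp only [q]
    split_ifs
    · exact (hremm (d i)).norm.div_const _
    · exact measurable_const
  let R : ℕ → S → ℝ := fun n x => ⨆ i, q n i x
  have hRm : ∀ n, Measurable (R n) := fun n => Measurable.iSup fun i => hqm n i
  have hbdd : ∀ n x, BddAbove (Set.range fun i => q n i x) := fun n x =>
    ⟨2 * |L x|, by rintro _ ⟨i, rfl⟩; exact hqL n i x⟩
  have hR0 : ∀ n x, 0 ≤ R n x := fun n x => Real.iSup_nonneg fun i => hq0 n i x
  have hRL : ∀ n x, R n x ≤ 2 * |L x| := fun n x => ciSup_le fun i => hqL n i x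
  have hRi : ∀ n, Integrable (R n) μ := fun n =>
    (hLi.abs.const_mul 2).mono' (hRm n).aestronglyMeasurable (ae_of_all _ fun x => by
      rw [Real.norm_of_nonneg (hR0 n x)]; exact hRL n x)
  have hRlim : ∀ x, Tendsto (fun n => R n x) atTop (𝓝 0) := by
    intro x
    rw [Metric.tendsto_nhds]
    intro c hc
    have h1 := (hFd x).isLittleO.bound (show 0 < c / 2 by positivity)
    obtain ⟨δ, hδ, hδb⟩ := Metric.eventually_nhds_iff_ball.1 h1
    filter_upwards [hρlim.eventually_lt_const hδ] with n hn
    rw [Real.dist_eq, sub_zero, abs_of_nonneg (hR0 n x)]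
    refine (ciSup_le fun i => hqle n i x (c / 2) (by positivity) fun p hp => ?_).trans_lt
      (by linarith : c / 2 < c)
    exact hδb p (Metric.ball_subset_ball hn.le hp)
  have hint : Tendsto (fun n => ∫ x, R n x ∂μ) atTop (𝓝 0) := by
    have := tendsto_integral_of_dominated_convergence (fun x => 2 * |L x|)
      (fun n => (hRm n).aestronglyMeasurable) (hLi.abs.const_mul 2)
      (fun n => ae_of_all μ fun x => by
        rw [Real.norm_of_nonneg (hR0 n x)]; exact hRL n x)
      (ae_of_all μ hRlim)
    simpa using this
  obtain ⟨n, hn⟩ := (hint.eventually_lt_const he).exists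
  refine ⟨R n, ρ n, hρ0 n, hRi n, hn, fun x p hp => ?_⟩
  -- Both sides are continuous in `p`, so the bound passes from the dense points to the whole ball.
  have hclosed : IsClosed {p | ‖rem x p‖ ≤ R n x * ‖p - p₀‖} :=
    isClosed_le (hremc x).norm (by fun_prop)
  have hsub : Metric.ball p₀ (ρ n) ∩ Set.range d ⊆ {p | ‖rem x p‖ ≤ R n x * ‖p - p₀‖} := by
    rintro _ ⟨hp, i, rfl⟩
    rw [mem_ball_iff_norm] at hp
    rcases eq_or_ne (d i) p₀ with h0 | h0
    · have : rem x p₀ = 0 := by simp [rem]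
      simp [h0, this]
    · have h1 : ‖rem x (d i)‖ / ‖d i - p₀‖ ≤ R n x := by
        have := le_ciSup (hbdd n x) i
        simpa only [q, if_pos hp] using this
      exact (div_le_iff₀ (norm_pos_iff.2 (sub_ne_zero.2 h0))).1 h1
  exact closure_minimal hsub hclosed
    ((TopologicalSpace.denseRange_denseSeq E).open_subset_closure_inter Metric.isOpen_ball hp)

variable {Ω : Type*} [MeasurableSpace Ω] {P : Measure Ω} [IsProbabilityMeasure P] {ξ : ℕ → Ω → S}

/-- Averages of a dominated family of differentiable functions over a stationary ergodic process
are asymptotically differentiable. -/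
theorem StationaryErgodic.average_sub_isLittleO (h : StationaryErgodic P ξ)
    (hξ : ∀ t, Measurable (ξ t)) {F : S → E → G} {F' : S → E →L[ℝ] G}
    {p₀ : E} (hFm : ∀ p, Measurable fun x => F x p) (hFc : ∀ x, Continuous (F x))
    (hFd : ∀ x, HasFDerivAt (F x) (F' x) p₀) {L : S → ℝ} (hLi : Integrable L (P.map (ξ 1)))
    {r₀ : ℝ} (hr₀ : 0 < r₀)
    (hL : ∀ x, ∀ p ∈ Metric.ball p₀ r₀, ‖F x p - F x p₀‖ ≤ L x * ‖p - p₀‖)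
    (hF'i : Integrable F' (P.map (ξ 1)))
    {q : ℕ × Ω → E} (hq : Tendsto q (highProb P) (𝓝 p₀)) :
    (fun a : ℕ × Ω => (1 / (a.1 : ℝ)) • ∑ t ∈ Finset.Icc 1 a.1, F (ξ t a.2) (q a) -
      (1 / (a.1 : ℝ)) • ∑ t ∈ Finset.Icc 1 a.1, F (ξ t a.2) p₀ -
      (∫ x, F' x ∂(P.map (ξ 1))) (q a - p₀)) =o[highProb P] fun a => q a - p₀ := by
  have : CompleteSpace G := FiniteDimensional.complete ℝ G
  rw [isLittleO_iff]
  intro c hc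
  -- The mean of `R` is below `c / 2`, hence so is its sample average with probability tending to
  -- one; the other half of `c` covers the averaged derivative.
  obtain ⟨R, r, hr, hRi, hRc, hR⟩ := exists_integrable_remainder_bound hFm hFc hFd hLi hr₀ hL
    (show 0 < c / 2 by positivity)
  have h1 := (h.tendsto_average hξ hRi).eventually_lt_const hRc
  have h2 := (Metric.tendsto_nhds.1 (h.tendsto_average hξ hF'i)) (c / 2) (by positivity)
  filter_upwards [h1, h2, (Metric.tendsto_nhds.1 hq) r hr] with a ha1 ha2 ha3
  set k : ℝ := 1 / (a.1 : ℝ) with hk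
  have hk0 : 0 ≤ k := by positivity
  set A : E →L[ℝ] G := k • ∑ t ∈ Finset.Icc 1 a.1, F' (ξ t a.2) with hA
  set B : E →L[ℝ] G := ∫ x, F' x ∂(P.map (ξ 1)) with hB
  have hdec : k • ∑ t ∈ Finset.Icc 1 a.1, F (ξ t a.2) (q a) -
      k • ∑ t ∈ Finset.Icc 1 a.1, F (ξ t a.2) p₀ - B (q a - p₀) =
      k • ∑ t ∈ Finset.Icc 1 a.1, (F (ξ t a.2) (q a) - F (ξ t a.2) p₀ -
        F' (ξ t a.2) (q a - p₀)) + (A - B) (q a - p₀) := by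
    simp only [hA, sub_apply, smul_apply, sum_apply, Finset.sum_sub_distrib, smul_sub]
    abel
  rw [hdec]
  have e1 : ‖k • ∑ t ∈ Finset.Icc 1 a.1, (F (ξ t a.2) (q a) - F (ξ t a.2) p₀ -
      F' (ξ t a.2) (q a - p₀))‖ ≤ c / 2 * ‖q a - p₀‖ := by
    rw [norm_smul, Real.norm_of_nonneg hk0]
    calc _ ≤ k * ∑ t ∈ Finset.Icc 1 a.1, R (ξ t a.2) * ‖q a - p₀‖ := by
          refine mul_le_mul_of_nonneg_left ?_ hk0
          exact (norm_sum_le _ _).trans (Finset.sum_le_sum fun t _ => hR _ _ ha3)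
      _ = (k • ∑ t ∈ Finset.Icc 1 a.1, R (ξ t a.2)) * ‖q a - p₀‖ := by
          rw [← Finset.sum_mul, smul_eq_mul, mul_assoc]
      _ ≤ c / 2 * ‖q a - p₀‖ := by gcongr
  have e2 : ‖(A - B) (q a - p₀)‖ ≤ c / 2 * ‖q a - p₀‖ := by
    rw [dist_eq_norm] at ha2
    exact (A - B).le_of_opNorm_le ha2.le _
  calc _ ≤ _ := norm_add_le _ _
    _ ≤ c * ‖q a - p₀‖ := by linarith

end StochasticDifferentiability

/-! ### Bounds on first derivatives from values and second derivatives. -/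

section GradientBound

variable {d : ℕ}

lemma norm_fderiv_sub_le_of_iteratedFDeriv_two {E F : Type*} [NormedAddCommGroup E]
    [NormedSpace ℝ E] [NormedAddCommGroup F] [NormedSpace ℝ F] {f : E → F} (hf : ContDiff ℝ 2 f)
    {K : Set E} (hK : Convex ℝ K) {B : ℝ} (hB : ∀ x ∈ K, ‖iteratedFDeriv ℝ 2 f x‖ ≤ B)
    {x y : E} (hx : x ∈ K) (hy : y ∈ K) : ‖fderiv ℝ f y - fderiv ℝ f x‖ ≤ B * ‖y - x‖ := by
  have hd : Differentiable ℝ (fderiv ℝ f) :=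
    (hf.fderiv_right (m := 1) (by norm_num)).differentiable one_ne_zero
  refine hK.norm_image_sub_le_of_norm_fderiv_le (fun x _ => hd.differentiableAt)
    (fun x hx => ?_) hx hy
  rw [← norm_iteratedFDeriv_one (𝕜 := ℝ) (f := fderiv ℝ f) (x := x), norm_iteratedFDeriv_fderiv]
  exact hB x hx

lemma norm_strongDual_le_sum (φ : Vec d →L[ℝ] ℝ) :
    ‖φ‖ ≤ ∑ i, |φ (EuclideanSpace.single i 1)| := by
  refine ContinuousLinearMap.opNorm_le_bound _ (Finset.sum_nonneg fun i _ => abs_nonneg _)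
    fun x => ?_
  have hx : x = ∑ i, x i • EuclideanSpace.single i (1 : ℝ) := by
    conv_lhs => rw [← (EuclideanSpace.basisFun (Fin d) ℝ).sum_repr x]
    simp
  conv_lhs => rw [hx, map_sum]
  refine (norm_sum_le _ _).trans ?_
  rw [Finset.sum_mul]
  refine Finset.sum_le_sum fun i _ => ?_
  rw [map_smul, norm_smul, mul_comm, Real.norm_eq_abs]
  exact mul_le_mul_of_nonneg_left (PiLp.norm_apply_le x i) (abs_nonneg _)

/-- A derivative at an interior point is controlled by finitely many values of the function and
a bound on the second derivative. -/
lemma norm_fderiv_le_of_values {f : Vec d → ℝ} (hf : ContDiff ℝ 2 f) {x : Vec d} {r B : ℝ}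
    (hr : 0 < r) (hB : ∀ y ∈ Metric.closedBall x r, ‖iteratedFDeriv ℝ 2 f y‖ ≤ B) :
    ‖fderiv ℝ f x‖ ≤
      ∑ i, ((|f (x + r • EuclideanSpace.single i 1)| + |f x|) / r + B * r) := by
  refine (norm_strongDual_le_sum _).trans (Finset.sum_le_sum fun i _ => ?_)
  set v : Vec d := EuclideanSpace.single i 1 with hv
  have hvn : ‖v‖ = 1 := by simp [hv]
  have hB0 : 0 ≤ B := (norm_nonneg _).trans (hB x (Metric.mem_closedBall_self hr.le))
  have hmem : x + r • v ∈ Metric.closedBall x r := by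
    simp [norm_smul, hvn, abs_of_pos hr]
  have hmv := (convex_closedBall x r).norm_image_sub_le_of_norm_fderiv_le'
    (f := f) (φ := fderiv ℝ f x) (C := B * r) (𝕜 := ℝ)
    (fun y _ => (hf.differentiable two_ne_zero).differentiableAt)
    (fun y hy => by
      refine (norm_fderiv_sub_le_of_iteratedFDeriv_two hf (convex_closedBall x r) hB
        (Metric.mem_closedBall_self hr.le) hy).trans ?_
      gcongr
      exact mem_closedBall_iff_norm.1 hy)
    (Metric.mem_closedBall_self hr.le) hmem
  rw [add_sub_cancel_left, map_smul, norm_smul, hvn, Real.norm_of_nonneg hr.le, mul_one,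
    smul_eq_mul, Real.norm_eq_abs] at hmv
  have h1 : r * |fderiv ℝ f x v| ≤ |f (x + r • v)| + |f x| + B * r * r := by
    rw [← abs_of_pos hr, ← abs_mul, abs_of_pos hr]
    have h2 : r * fderiv ℝ f x v = f (x + r • v) - f x -
      (f (x + r • v) - f x - r * fderiv ℝ f x v) := by ring
    rw [h2]
    refine (abs_sub _ _).trans ?_
    have := abs_sub (f (x + r • v)) (f x)
    linarith
  have h3 : (|f (x + r • v)| + |f x|) / r + B * r =
    (|f (x + r • v)| + |f x| + B * r * r) / r := by field_simp
  rw [h3, le_div_iff₀ hr]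
  linarith

end GradientBound

/-! ### The simulated data: integrable Lipschitz constants and uniform consistency of the auxiliary
estimators. -/

namespace LIIModel

open Asymptotics

variable {Ω 𝕏 𝕎 : Type*} [MeasurableSpace Ω] [MeasurableSpace 𝕏] [MeasurableSpace 𝕎]
  {P : Measure Ω} [IsProbabilityMeasure P] {dθ dρ dz H : ℕ} {M : LIIModel Ω 𝕏 𝕎 dθ dρ dz H}
  {ρ₀ : ℝ → Vec dθ → Vec dρ} {ε : ℝ} {s : ℕ} {u : ℝ}

/-- The driving process. -/
def noise (M : LIIModel Ω 𝕏 𝕎 dθ dρ dz H) (t : ℕ) (ω : Ω) : 𝕏 × 𝕎 := (M.ν t ω, M.w t ω)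

/-- The driving process of a simulated path. -/
def simNoise (M : LIIModel Ω 𝕏 𝕎 dθ dρ dz H) (j : Fin H) (t : ℕ) (ω : Ω) : 𝕏 × 𝕎 :=
  (M.νsim j t ω, M.wsim j t ω)

/-- The law of the driving noise. -/
def noiseLaw (M : LIIModel Ω 𝕏 𝕎 dθ dρ dz H) (P : Measure Ω) : Measure (𝕏 × 𝕎) := P.map (M.noise 1)

/-- The stationary data at `(u, θ)` as a function of the noise. -/
def statData (M : LIIModel Ω 𝕏 𝕎 dθ dρ dz H) (u : ℝ) (x : 𝕏 × 𝕎) (θ : Vec dθ) : ℝ × Vec dz :=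
  (M.yMap x.1 θ, M.ζ u x.2 θ)

/-- The score of the stationary data as a function of the noise and of both parameters. -/
def statScore (M : LIIModel Ω 𝕏 𝕎 dθ dρ dz H) (u : ℝ) (x : 𝕏 × 𝕎) (p : Vec dθ × Vec dρ) : Vec dρ :=
  M.scoreMap ((M.statData u x p.1).1, (M.statData u x p.1).2, p.2)

/-- The criterion of the stationary data as a function of the noise and of both parameters. -/
def statCrit (M : LIIModel Ω 𝕏 𝕎 dθ dρ dz H) (u : ℝ) (x : 𝕏 × 𝕎) (p : Vec dθ × Vec dρ) : ℝ :=
  M.critMap ((M.statData u x p.1).1, (M.statData u x p.1).2, p.2)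

lemma norm_prod_sub_le (a b : ℝ × Vec dz) (ρ ρ' : Vec dρ) {c n : ℝ} (hc : 0 ≤ c) (hn : 0 ≤ n)
    (hab : ‖a - b‖ ≤ c * n) (hρ : ‖ρ - ρ'‖ ≤ n) :
    ‖((a.1, a.2, ρ) : ℝ × Vec dz × Vec dρ) - (b.1, b.2, ρ')‖ ≤ (c + 1) * n := by
  have h1 : ‖a.1 - b.1‖ ≤ ‖a - b‖ := norm_fst_le (a - b)
  have h2 : ‖a.2 - b.2‖ ≤ ‖a - b‖ := norm_snd_le (a - b)
  have h3 : 0 ≤ c * n := by positivity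
  simp only [Prod.norm_def, Prod.mk_sub_mk]
  refine max_le (by linarith) (max_le (by linarith) (by linarith))

section Model

variable (hstruct : M.StructuralRegularity P) (hdep : M.DependenceConditions P)

include hdep

lemma measurable_noise (hstruct : M.StructuralRegularity P) (t : ℕ) : Measurable (M.noise t) :=
  (hstruct.ν_meas t).prodMk (hdep.w_meas t)

lemma measurable_simNoise (j : Fin H) (t : ℕ) : Measurable (M.simNoise j t) :=
  (hdep.νsim_meas j t).prodMk (hdep.wsim_meas j t)

lemma stationaryErgodic_simNoise (j : Fin H) : StationaryErgodic P (M.simNoise j) :=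
  StationaryErgodic.of_map_eq hdep.ergodic (hdep.sim_law j)

include hstruct

lemma map_simNoise_one (j : Fin H) : P.map (M.simNoise j 1) = M.noiseLaw P :=
  map_one_eq_of_map_pathOf_eq (measurable_noise hdep hstruct) (measurable_simNoise hdep j)
    (hdep.sim_law j)

lemma map_simNoise (j : Fin H) {t : ℕ} (ht : 1 ≤ t) : P.map (M.simNoise j t) = M.noiseLaw P :=
  ((stationaryErgodic_simNoise hdep j).map_eq (measurable_simNoise hdep j) ht).trans
    (map_simNoise_one hstruct hdep j)

lemma map_noise {t : ℕ} (ht : 1 ≤ t) : P.map (M.noise t) = M.noiseLaw P :=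
  StationaryErgodic.map_eq hdep.ergodic (measurable_noise hdep hstruct) ht

lemma isProbabilityMeasure_noiseLaw : IsProbabilityMeasure (M.noiseLaw P) :=
  Measure.isProbabilityMeasure_map (measurable_noise hdep hstruct 1).aemeasurable

lemma measurable_statData (u : ℝ) (θ : Vec dθ) : Measurable fun x => M.statData u x θ :=
  ((hstruct.yMap_meas θ).comp measurable_fst).prodMk ((hdep.ζ_meas u θ).comp measurable_snd)

lemma continuous_statData (hu : u ∈ M.U) (x : 𝕏 × 𝕎) : Continuous (M.statData u x) :=
  (hstruct.yMap_smooth x.1).continuous.prodMk (hdep.ζ_smooth u hu x.2).continuous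

lemma contDiff_statData (hu : u ∈ M.U) (x : 𝕏 × 𝕎) : ContDiff ℝ 2 (M.statData u x) :=
  (hstruct.yMap_smooth x.1).prodMk (hdep.ζ_smooth u hu x.2)

/-- The stationary data are Lipschitz in the structural parameter, with an integrable constant. -/
lemma exists_statData_lipschitz (hΘ : IsCompact M.Θ) (hu : u ∈ M.U)
    (hθint : M.θ₀ u ∈ interior M.Θ) :
    ∃ G : 𝕏 × 𝕎 → ℝ, Integrable G (M.noiseLaw P) ∧ (∀ x, 0 ≤ G x) ∧
      ∀ x, ∀ θ ∈ M.Θ, ∀ θ' ∈ M.Θ,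
        ‖M.statData u x θ - M.statData u x θ'‖ ≤ G x * ‖θ - θ'‖ := by
  set θs := M.θ₀ u with hθs
  obtain ⟨r, hr, hball⟩ := Metric.mem_nhds_iff.1 (mem_interior_iff_mem_nhds.1 hθint)
  have hcb : Metric.closedBall θs (r / 2) ⊆ M.Θ :=
    (Metric.closedBall_subset_ball (by linarith)).trans hball
  have hsub : M.Θ ⊆ convexHull ℝ M.Θ := subset_convexHull ℝ _
  have hconv : Convex ℝ (convexHull ℝ M.Θ) := convex_convexHull ℝ _
  obtain ⟨B, hBm, hBi, hB⟩ := hstruct.yMap_bound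
  obtain ⟨Bz, hBzm, hBzi, hBz⟩ := hdep.ζ_bound u hu
  obtain ⟨Δ, hΔ⟩ := ((isBounded_convexHull).2 hΘ.isBounded).subset_closedBall θs
  have hB0 : ∀ x, 0 ≤ B x := fun x =>
    (norm_nonneg _).trans (hB x θs (hsub (interior_subset hθint)))
  have hBz0 : ∀ x, 0 ≤ Bz x := fun x =>
    (norm_nonneg _).trans (hBz x θs (hsub (interior_subset hθint))).1
  have hr2 : 0 < r / 2 := by positivity
  let pt : Fin dθ → Vec dθ := fun i => θs + (r / 2) • EuclideanSpace.single i 1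
  have hpt : ∀ i, pt i ∈ M.Θ := fun i => hcb (by
    simp [pt, norm_smul, abs_of_pos hr])
  -- The first derivative of `yMap` has no assumed bound. At `θs` it is controlled by the integrable
  -- values at the points `pt i` and by `B`; the second derivative bound carries this over the
  -- convex hull, which lies in a ball of radius `Δ` about `θs`.
  let Gy : 𝕏 → ℝ := fun x =>
    (∑ i, ((|M.yMap x (pt i)| + |M.yMap x θs|) / (r / 2) + B x * (r / 2))) + B x * |Δ|
  have hGy : ∀ x, ∀ θ ∈ convexHull ℝ M.Θ, ‖fderiv ℝ (M.yMap x) θ‖ ≤ Gy x := by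
    intro x θ hθ
    have h1 := norm_fderiv_le_of_values (hstruct.yMap_smooth x) (x := θs) hr2
      (fun y hy => hB x y (hsub (hcb hy)))
    have h2 := norm_fderiv_sub_le_of_iteratedFDeriv_two (hstruct.yMap_smooth x) hconv (hB x)
      (hsub (interior_subset hθint)) hθ
    have h3 : ‖θ - θs‖ ≤ |Δ| := (mem_closedBall_iff_norm.1 (hΔ hθ)).trans (le_abs_self Δ)
    have h4 : B x * ‖θ - θs‖ ≤ B x * |Δ| := mul_le_mul_of_nonneg_left h3 (hB0 x)
    have h5 : ‖fderiv ℝ (M.yMap x) θ‖ ≤ ‖fderiv ℝ (M.yMap x) θ - fderiv ℝ (M.yMap x) θs‖ +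
        ‖fderiv ℝ (M.yMap x) θs‖ := by
      have := norm_add_le (fderiv ℝ (M.yMap x) θ - fderiv ℝ (M.yMap x) θs) (fderiv ℝ (M.yMap x) θs)
      rwa [sub_add_cancel] at this
    simp only [Gy, pt]
    linarith
  have hGy0 : ∀ x, 0 ≤ Gy x := fun x =>
    (norm_nonneg _).trans (hGy x θs (hsub (interior_subset hθint)))
  have hGyi : Integrable (fun x : 𝕏 × 𝕎 => Gy x.1) (M.noiseLaw P) := by
    have hm : Measurable Gy := by
      have := hstruct.yMap_meas
      simp only [Gy]
      fun_prop
    change Integrable (Gy ∘ Prod.fst) (P.map (M.noise 1))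
    rw [integrable_map_measure (hm.comp measurable_fst).aestronglyMeasurable
      (measurable_noise hdep hstruct 1).aemeasurable]
    have hy : ∀ θ ∈ M.Θ, Integrable (fun ω => |M.yMap (M.ν 1 ω) θ|) P := fun θ hθ =>
      ((hdep.y_memLp θ hθ 1 le_rfl).integrable (by norm_num)).abs
    have hBi1 := hBi 1 le_rfl
    refine Integrable.add (integrable_finsetSum _ fun i _ => ?_) (hBi1.mul_const _)
    exact (((hy _ (hpt i)).add (hy θs (interior_subset hθint))).div_const _).add
      (hBi1.mul_const _)
  have hGzi : Integrable (fun x : 𝕏 × 𝕎 => Bz x.2) (M.noiseLaw P) := by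
    change Integrable (Bz ∘ Prod.snd) (P.map (M.noise 1))
    rw [integrable_map_measure (hBzm.comp measurable_snd).aestronglyMeasurable
      (measurable_noise hdep hstruct 1).aemeasurable]
    exact hBzi 1 le_rfl
  refine ⟨fun x => Gy x.1 + Bz x.2, hGyi.add hGzi, fun x => add_nonneg (hGy0 _) (hBz0 _),
    fun x θ hθ θ' hθ' => ?_⟩
  have h1 := hconv.norm_image_sub_le_of_norm_fderiv_le (𝕜 := ℝ) (f := M.yMap x.1)
    (fun θ _ => ((hstruct.yMap_smooth x.1).differentiable two_ne_zero).differentiableAt)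
    (hGy x.1) (hsub hθ') (hsub hθ)
  have h2 := hconv.norm_image_sub_le_of_norm_fderiv_le (𝕜 := ℝ) (f := M.ζ u x.2)
    (fun θ _ => ((hdep.ζ_smooth u hu x.2).differentiable two_ne_zero).differentiableAt)
    (fun θ hθ => (hBz x.2 θ hθ).1) (hsub hθ') (hsub hθ)
  simp only [statData, Prod.norm_def, Prod.mk_sub_mk]
  have h3 : 0 ≤ Gy x.1 * ‖θ - θ'‖ := mul_nonneg (hGy0 _) (norm_nonneg _)
  have h4 : 0 ≤ Bz x.2 * ‖θ - θ'‖ := mul_nonneg (hBz0 _) (norm_nonneg _)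
  rw [add_mul]
  exact max_le (by linarith) (by linarith)

variable (haux : M.AuxiliaryRegularity P ρ₀ ε) (hu : u ∈ M.U)

include haux

lemma measurable_statCrit (u : ℝ) (p : Vec dθ × Vec dρ) : Measurable fun x => M.statCrit u x p :=
  (measurable_crit haux.contDiff_critMap p.2).comp (measurable_statData hstruct hdep u p.1)

lemma measurable_statScore (u : ℝ) (p : Vec dθ × Vec dρ) :
    Measurable fun x => M.statScore u x p := by
  have h1 : Measurable fun x : ℝ × Vec dz => M.scoreMap (x.1, x.2, p.2) :=
    ((contDiff_scoreMap haux.contDiff_critMap).continuous.comp (by fun_prop :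
      Continuous fun x : ℝ × Vec dz => ((x.1, x.2, p.2) : ℝ × Vec dz × Vec dρ))).measurable
  exact h1.comp (measurable_statData hstruct hdep u p.1)

include hu

lemma continuous_statScore (x : 𝕏 × 𝕎) : Continuous (M.statScore u x) := by
  have h := (continuous_statData hstruct hdep hu x).comp (continuous_fst (Y := Vec dρ))
  exact (contDiff_scoreMap haux.contDiff_critMap).continuous.comp
    ((continuous_fst.comp h).prodMk ((continuous_snd.comp h).prodMk continuous_snd))

lemma differentiable_statScore (x : 𝕏 × 𝕎) : Differentiable ℝ (M.statScore u x) := by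
  have h := ((contDiff_statData hstruct hdep hu x).differentiable two_ne_zero).comp
    (differentiable_fst (E := Vec dθ) (F := Vec dρ))
  exact ((contDiff_scoreMap haux.contDiff_critMap).differentiable one_ne_zero).comp
    (h.fst.prodMk (h.snd.prodMk differentiable_snd))

/-- Criterion and score are Lipschitz in data and `ρ`, and the data are Lipschitz in `θ` with an
integrable constant `G`; composing gives `C (G + 1)`. This one constant serves both the uniform law
of large numbers and the differentiation of the expected score. -/
lemma exists_stat_lipschitz (hθint : M.θ₀ u ∈ interior M.Θ) :
    ∃ L : 𝕏 × 𝕎 → ℝ, Integrable L (M.noiseLaw P) ∧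
      ∀ x, ∀ p q : Vec dθ × Vec dρ, p.1 ∈ M.Θ → q.1 ∈ M.Θ →
        |M.statCrit u x p - M.statCrit u x q| ≤ L x * ‖p - q‖ ∧
        ‖M.statScore u x p - M.statScore u x q‖ ≤ L x * ‖p - q‖ := by
  obtain ⟨C, hC0, hC1, hC2⟩ := haux.exists_bound
  have hs := haux.contDiff_critMap
  obtain ⟨G, hGi, hG0, hG⟩ := exists_statData_lipschitz hstruct hdep haux.Θ_compact hu hθint
  have := isProbabilityMeasure_noiseLaw hstruct hdep
  refine ⟨fun x => C * (G x + 1), (hGi.add (integrable_const 1)).const_mul C,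
    fun x p q hp hq => ?_⟩
  have h1 : ‖p.1 - q.1‖ ≤ ‖p - q‖ := norm_fst_le (p - q)
  have h2 : ‖p.2 - q.2‖ ≤ ‖p - q‖ := norm_snd_le (p - q)
  have h3 := norm_prod_sub_le (M.statData u x p.1) (M.statData u x q.1) p.2 q.2 (hG0 x)
    (norm_nonneg (p - q))
    ((hG x _ hp _ hq).trans (mul_le_mul_of_nonneg_left h1 (hG0 x))) h2
  have h4 := mul_le_mul_of_nonneg_left h3 hC0
  rw [← mul_assoc] at h4
  exact ⟨(norm_critMap_sub_le hs hC1 _ _).trans h4, (norm_scoreMap_sub_le hs hC2 _ _).trans h4⟩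

variable (hpseudo : M.IsPseudoTrue P ρ₀)

omit hu in
-- Integrability is assumed for `ρ ∈ Γ` only; the bounded increments of the criterion extend it to
-- all `ρ`. The path `j` serves to transfer it to the common law of the noise.
lemma integrable_statCrit_map (hu : u ∈ M.U) (j : Fin H) {θ : Vec dθ} (hθ : θ ∈ M.Θ)
    (hne : M.Γ.Nonempty) (ρ : Vec dρ) :
    Integrable (fun x => M.statCrit u x (θ, ρ)) (M.noiseLaw P) := by
  obtain ⟨ρ', hρ'⟩ := hne
  obtain ⟨C, hC0, hC1, -⟩ := haux.exists_bound
  have hm := measurable_simNoise hdep j 1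
  have h1 := haux.simCrit_integrable j u hu θ hθ ρ' hρ' 1 le_rfl
  have h2 := integrable_crit_of_integrable (P := P) haux.contDiff_critMap hC1
    (X := fun ω => M.statData u (M.simNoise j 1 ω) θ)
    ((measurable_statData hstruct hdep u θ).comp hm) h1 ρ
  rw [← map_simNoise_one hstruct hdep j,
    integrable_map_measure (measurable_statCrit hstruct hdep haux u _).aestronglyMeasurable
      hm.aemeasurable]
  exact h2

omit hu in
/-- The limit criterion of the simulated data is the expected criterion of the stationary data. -/
lemma simLimCrit_eq (j : Fin H) (θ : Vec dθ) (ρ : Vec dρ) :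
    M.simLimCrit P j u θ ρ = ∫ x, M.statCrit u x (θ, ρ) ∂(M.noiseLaw P) := by
  refine Tendsto.limUnder_eq (tendsto_const_nhds.congr' ?_)
  filter_upwards [eventually_ge_atTop 1] with T hT
  have h1 : ∀ t ∈ Finset.Icc 1 T,
      ∫ ω, M.crit (M.ySim j θ t ω) (M.zSim j u θ t ω) ρ ∂P =
        ∫ x, M.statCrit u x (θ, ρ) ∂(M.noiseLaw P) := by
    intro t ht
    rw [← map_simNoise hstruct hdep j (Finset.mem_Icc.1 ht).1,
      integral_map (measurable_simNoise hdep j t).aemeasurable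
        (measurable_statCrit hstruct hdep haux u _).aestronglyMeasurable]
    rfl
  rw [Finset.sum_congr rfl h1, Finset.sum_const, Nat.card_Icc, add_tsub_cancel_right, nsmul_eq_mul,
    ← mul_assoc, one_div, inv_mul_cancel₀ (by positivity), one_mul]

omit hu hstruct hdep haux in
lemma simCrit_eq (j : Fin H) (T : ℕ) (θ : Vec dθ) (ω : Ω) (ρ : Vec dρ) :
    M.simCrit j T u θ ω ρ =
      (1 / (T : ℝ)) • ∑ t ∈ Finset.Icc 1 T, M.statCrit u (M.simNoise j t ω) (θ, ρ) := rfl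

/-- Consistency of the simulated auxiliary estimator, uniformly in the structural parameter. -/
theorem eventually_forall_dist_simEstimator_le (hpseudo : M.IsPseudoTrue P ρ₀)
    (hθint : M.θ₀ u ∈ interior M.Θ)
    (j : Fin H) {ρsim : ℕ → Vec dθ → Ω → Vec dρ}
    (hmin : ∀ᶠ p in highProb P, ∀ θ ∈ M.Θ, ρsim p.1 θ p.2 ∈ M.Γ ∧
      IsMinOn (M.simCrit j p.1 u θ p.2) M.Γ (ρsim p.1 θ p.2)) {r : ℝ} (hr : 0 < r) :
    ∀ᶠ p in highProb P, ∀ θ ∈ M.Θ, dist (ρsim p.1 θ p.2) (ρ₀ u θ) ≤ r := by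
  have hξ := measurable_simNoise hdep j
  have herg := stationaryErgodic_simNoise hdep j
  have hne : M.Γ.Nonempty := ⟨_, hpseudo.mem u hu _ (hstruct.θ₀_mem u hu)⟩
  obtain ⟨L, hLi, hL⟩ := exists_stat_lipschitz hstruct hdep haux hu hθint
  have hcpt : IsCompact (M.Θ ×ˢ M.Γ) := haux.Θ_compact.prod haux.Γ_compact
  have hlaw := map_simNoise_one hstruct hdep j
  set μ := M.noiseLaw P with hμ
  set Q : Vec dθ × Vec dρ → ℝ := fun p => ∫ x, M.statCrit u x p ∂μ with hQ
  have hci : ∀ p ∈ M.Θ ×ˢ M.Γ, Integrable (fun x => M.statCrit u x p) μ := fun p hp =>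
    integrable_statCrit_map hstruct hdep haux hu j hp.1 hne p.2
  -- The random Lipschitz constant of the sample criterion is an ergodic average of `L`, eventually
  -- below its mean plus one.
  have hLa : ∀ᶠ a in highProb P,
      (1 / (a.1 : ℝ)) • ∑ t ∈ Finset.Icc 1 a.1, L (M.simNoise j t a.2) < (∫ x, L x ∂μ) + 1 := by
    have h1 := herg.tendsto_average hξ (g := L) (by rw [hlaw]; exact hLi)
    rw [hlaw] at h1
    exact h1.eventually_lt_const (by linarith)
  have hlip : ∀ᶠ a in highProb P, ∀ p ∈ M.Θ ×ˢ M.Γ, ∀ q ∈ M.Θ ×ˢ M.Γ,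
      |M.simCrit j a.1 u p.1 a.2 p.2 - M.simCrit j a.1 u q.1 a.2 q.2| ≤
        ((∫ x, L x ∂μ) + 1) * dist p q := by
    filter_upwards [hLa] with a ha p hp q hq
    rw [simCrit_eq, simCrit_eq, ← smul_sub, ← Finset.sum_sub_distrib, smul_eq_mul, abs_mul,
      abs_of_nonneg (by positivity : (0 : ℝ) ≤ 1 / (a.1 : ℝ)), dist_eq_norm]
    calc _ ≤ 1 / (a.1 : ℝ) * ∑ t ∈ Finset.Icc 1 a.1, L (M.simNoise j t a.2) * ‖p - q‖ := by
          refine mul_le_mul_of_nonneg_left ?_ (by positivity)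
          exact (Finset.abs_sum_le_sum_abs _ _).trans
            (Finset.sum_le_sum fun t _ => (hL _ p q hp.1 hq.1).1)
      _ = ((1 / (a.1 : ℝ)) • ∑ t ∈ Finset.Icc 1 a.1, L (M.simNoise j t a.2)) * ‖p - q‖ := by
          rw [← Finset.sum_mul, smul_eq_mul, mul_assoc]
      _ ≤ _ := by gcongr
  have hpt : ∀ p ∈ M.Θ ×ˢ M.Γ,
      Tendsto (fun a : ℕ × Ω => M.simCrit j a.1 u p.1 a.2 p.2) (highProb P) (𝓝 (Q p)) := by
    intro p hp
    have h1 := herg.tendsto_average hξ (g := fun x => M.statCrit u x p)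
      (by rw [hlaw]; exact hci p hp)
    rw [hlaw] at h1
    exact h1
  have hunif := fun (e : ℝ) (he : 0 < e) =>
    eventually_forall_abs_sub_le_of_lipschitz hcpt hlip hpt he
  have hQmin : ∀ θ ∈ M.Θ, ∀ ρ ∈ M.Γ, ρ ≠ ρ₀ u θ → Q (θ, ρ₀ u θ) < Q (θ, ρ) := by
    intro θ hθ ρ hρ hne
    have := hpseudo.sim_min j u hu θ hθ ρ hρ hne
    rwa [simLimCrit_eq hstruct hdep haux, simLimCrit_eq hstruct hdep haux] at this
  have hQc : ContinuousOn Q (M.Θ ×ˢ M.Γ) := by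
    have hQl : ∀ p ∈ M.Θ ×ˢ M.Γ, ∀ q ∈ M.Θ ×ˢ M.Γ, |Q p - Q q| ≤ (∫ x, L x ∂μ) * dist p q := by
      intro p hp q hq
      rw [hQ]
      simp only
      rw [← integral_sub (hci p hp) (hci q hq), ← integral_mul_const, ← Real.norm_eq_abs,
        dist_eq_norm]
      exact norm_integral_le_of_norm_le (hLi.mul_const _)
        (ae_of_all _ fun x => (hL x p q hp.1 hq.1).1)
    have : LipschitzOnWith (Real.toNNReal (∫ x, L x ∂μ)) Q (M.Θ ×ˢ M.Γ) := by
      refine LipschitzOnWith.of_dist_le_mul fun p hp q hq => ?_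
      rw [Real.dist_eq]
      exact (hQl p hp q hq).trans (mul_le_mul_of_nonneg_right (Real.le_coe_toNNReal _) dist_nonneg)
    exact this.continuousOn
  have hρc : ContinuousOn (fun p : Vec dθ × Vec dρ => ρ₀ u p.1) (M.Θ ×ˢ M.Γ) :=
    (haux.ρ₀_continuous u hu).comp continuousOn_fst fun p hp => hp.1
  -- Pointwise uniqueness of the minimizer becomes uniform separation: a continuous positive
  -- function on the compact set of pairs with `ρ` at distance at least `r` from `ρ₀ u θ` has a
  -- positive minimum. If that set is empty, any `η` will do.
  have hsep : ∀ r : ℝ, 0 < r → ∃ η : ℝ, 0 < η ∧ ∀ θ ∈ M.Θ, ∀ ρ ∈ M.Γ, r < dist ρ (ρ₀ u θ) →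
      η ≤ Q (θ, ρ) - Q (θ, ρ₀ u θ) := by
    intro r hr
    set D : Set (Vec dθ × Vec dρ) :=
      (M.Θ ×ˢ M.Γ) ∩ {p | r ≤ dist p.2 (ρ₀ u p.1)} with hD
    have hDc : IsCompact D := by
      have h1 : ContinuousOn (fun p : Vec dθ × Vec dρ => dist p.2 (ρ₀ u p.1)) (M.Θ ×ˢ M.Γ) :=
        continuous_dist.comp_continuousOn (ContinuousOn.prodMk continuousOn_snd hρc)
      have h2 := h1.preimage_isClosed_of_isClosed hcpt.isClosed (isClosed_Ici (a := r))
      exact hcpt.of_isClosed_subset h2 Set.inter_subset_left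
    have hfc : ContinuousOn (fun p : Vec dθ × Vec dρ => Q p - Q (p.1, ρ₀ u p.1)) D := by
      refine (hQc.mono Set.inter_subset_left).sub ?_
      refine hQc.comp (continuousOn_fst.prodMk (hρc.mono Set.inter_subset_left)) ?_
      exact fun p hp => ⟨hp.1.1, hpseudo.mem u hu _ hp.1.1⟩
    rcases D.eq_empty_or_nonempty with h0 | h0
    · refine ⟨1, one_pos, fun θ hθ ρ hρ hd => ?_⟩
      have : (θ, ρ) ∈ D := ⟨⟨hθ, hρ⟩, hd.le⟩
      rw [h0] at this
      exact this.elim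
    · obtain ⟨p, hp, hpm⟩ := hDc.exists_isMinOn h0 hfc
      refine ⟨Q p - Q (p.1, ρ₀ u p.1), ?_, fun θ hθ ρ hρ hd => ?_⟩
      · refine sub_pos.2 (hQmin p.1 hp.1.1 p.2 hp.1.2 fun h => ?_)
        have h3 : r ≤ dist p.2 (ρ₀ u p.1) := hp.2
        rw [h, dist_self] at h3
        linarith
      · exact isMinOn_iff.1 hpm (θ, ρ) ⟨⟨hθ, hρ⟩, hd.le⟩
  exact eventually_forall_dist_argmin_le (l := highProb P) (S := M.Θ) (K := M.Γ)
    (X := fun a θ ρ => M.simCrit j a.1 u θ a.2 ρ) (X₀ := fun θ ρ => Q (θ, ρ)) (x₀ := ρ₀ u)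
    (m := fun a θ => ρsim a.1 θ a.2) (fun θ hθ => hpseudo.mem u hu θ hθ)
    (fun e he => (hunif e he).mono fun a ha θ hθ ρ hρ => ha (θ, ρ) ⟨hθ, hρ⟩) hsep hmin hr

end Model

end LIIModel

/-! ### The expected score and criterion of the stationary data. -/

namespace LIIModel

open Asymptotics

variable {Ω 𝕏 𝕎 : Type*} [MeasurableSpace Ω] [MeasurableSpace 𝕏] [MeasurableSpace 𝕎]
  {P : Measure Ω} [IsProbabilityMeasure P] {dθ dρ dz H : ℕ} {M : LIIModel Ω 𝕏 𝕎 dθ dρ dz H}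
  {ρ₀ : ℝ → Vec dθ → Vec dρ} {ε : ℝ} {s : ℕ} {u : ℝ}

/-- The expected score of the stationary data. -/
def meanScore (M : LIIModel Ω 𝕏 𝕎 dθ dρ dz H) (P : Measure Ω) (u : ℝ) (p : Vec dθ × Vec dρ) :
    Vec dρ :=
  ∫ x, M.statScore u x p ∂(M.noiseLaw P)

/-- The expected criterion of the stationary data. -/
def meanCrit (M : LIIModel Ω 𝕏 𝕎 dθ dρ dz H) (P : Measure Ω) (u : ℝ) (θ : Vec dθ) (ρ : Vec dρ) :
    ℝ :=
  ∫ x, M.statCrit u x (θ, ρ) ∂(M.noiseLaw P)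

/-- The expected derivative of the score of the stationary data. -/
def meanScoreDeriv (M : LIIModel Ω 𝕏 𝕎 dθ dρ dz H) (P : Measure Ω) (u : ℝ) (p : Vec dθ × Vec dρ) :
    Vec dθ × Vec dρ →L[ℝ] Vec dρ :=
  ∫ x, fderiv ℝ (M.statScore u x) p ∂(M.noiseLaw P)

lemma exists_ball_fst_mem {Θ : Set (Vec dθ)} {θ : Vec dθ} (hθ : θ ∈ interior Θ) (ρ : Vec dρ) :
    ∃ r : ℝ, 0 < r ∧ ∀ p ∈ Metric.ball (θ, ρ) r, p.1 ∈ Θ := by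
  have : ∀ᶠ p in 𝓝 (θ, ρ), p.1 ∈ Θ :=
    (continuous_fst.tendsto (θ, ρ)).eventually (mem_interior_iff_mem_nhds.1 hθ)
  exact Metric.eventually_nhds_iff_ball.1 this

section Model

variable (hstruct : M.StructuralRegularity P) (hdep : M.DependenceConditions P)
  (haux : M.AuxiliaryRegularity P ρ₀ ε)

include hstruct hdep haux

lemma integrable_statScore (u : ℝ) (p : Vec dθ × Vec dρ) :
    Integrable (fun x => M.statScore u x p) (M.noiseLaw P) := by
  obtain ⟨C, -, hC1, -⟩ := haux.exists_bound
  have := isProbabilityMeasure_noiseLaw hstruct hdep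
  exact Integrable.of_bound (measurable_statScore hstruct hdep haux u p).aestronglyMeasurable C
    (ae_of_all _ fun x => norm_scoreMap_le haux.contDiff_critMap hC1 _)

/-- Differentiation under the integral, jointly in `θ` and `ρ`. The dominating Lipschitz constant is
valid for `θ ∈ Θ`, so `θ₀(u)` has to be an interior point. -/
lemma hasFDerivAt_meanScore (hu : u ∈ M.U) (hθint : M.θ₀ u ∈ interior M.Θ) (ρ : Vec dρ) :
    Integrable (fun x => fderiv ℝ (M.statScore u x) (M.θ₀ u, ρ)) (M.noiseLaw P) ∧
      HasFDerivAt (M.meanScore P u) (M.meanScoreDeriv P u (M.θ₀ u, ρ)) (M.θ₀ u, ρ) := by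
  obtain ⟨L, hLi, hL⟩ := exists_stat_lipschitz hstruct hdep haux hu hθint
  obtain ⟨r, hr, hball⟩ := exists_ball_fst_mem hθint ρ
  have hd := fun x => (differentiable_statScore hstruct hdep haux hu x (M.θ₀ u, ρ)).hasFDerivAt
  refine hasFDerivAt_integral_of_dominated_loc_of_lip' (bound := L) (Metric.ball_mem_nhds _ hr)
    (fun p _ => (measurable_statScore hstruct hdep haux u p).aestronglyMeasurable)
    (integrable_statScore hstruct hdep haux u _)
    (stronglyMeasurable_of_hasFDerivAt (measurable_statScore hstruct hdep haux u)
      hd).aestronglyMeasurable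
    (ae_of_all _ fun x p hp => ?_) hLi (ae_of_all _ hd)
  exact (hL x p _ (hball p hp) (interior_subset hθint)).2

lemma hasGradientAt_meanCrit (hu : u ∈ M.U) (j : Fin H) {θ : Vec dθ} (hθ : θ ∈ M.Θ)
    (hne : M.Γ.Nonempty) (ρ : Vec dρ) :
    HasGradientAt (M.meanCrit P u θ) (M.meanScore P u (θ, ρ)) ρ := by
  obtain ⟨C, hC0, hC1, -⟩ := haux.exists_bound
  have := isProbabilityMeasure_noiseLaw hstruct hdep
  have hs := haux.contDiff_critMap
  have hi := integrable_statScore hstruct hdep haux u (θ, ρ)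
  have hm : AEStronglyMeasurable
      (fun x => InnerProductSpace.toDual ℝ (Vec dρ) (M.statScore u x (θ, ρ))) (M.noiseLaw P) :=
    (LinearIsometryEquiv.continuous _).comp_aestronglyMeasurable hi.1
  have h := hasFDerivAt_integral_of_dominated_loc_of_lip' (𝕜 := ℝ) (μ := M.noiseLaw P)
    (F := fun ρ x => M.statCrit u x (θ, ρ)) (x₀ := ρ) (bound := fun _ => C)
    (F' := fun x => InnerProductSpace.toDual ℝ (Vec dρ) (M.statScore u x (θ, ρ)))
    (Metric.ball_mem_nhds ρ one_pos)
    (fun ρ _ => (measurable_statCrit hstruct hdep haux u _).aestronglyMeasurable)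
    (integrable_statCrit_map hstruct hdep haux hu j hθ hne ρ) hm
    (ae_of_all _ fun x ρ' _ => abs_crit_sub_le hs hC1 _ _ _ _) (integrable_const C)
    (ae_of_all _ fun x => (hasGradientAt_crit hs (M.statData u x θ).1 (M.statData u x θ).2
      ρ).hasFDerivAt)
  have heq : (∫ x, InnerProductSpace.toDual ℝ (Vec dρ) (M.statScore u x (θ, ρ)) ∂M.noiseLaw P) =
      InnerProductSpace.toDual ℝ (Vec dρ) (M.meanScore P u (θ, ρ)) := by
    refine ContinuousLinearMap.ext fun v => ?_
    rw [ContinuousLinearMap.integral_apply h.1]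
    simp only [InnerProductSpace.toDual_apply_apply, real_inner_comm v]
    exact integral_inner hi v
  rw [hasGradientAt_iff_hasFDerivAt, ← heq]
  exact h.2

end Model

end LIIModel

lemma jacobian_mulVec {n m : ℕ} (F : Vec n → Vec m) (x v : Vec n) :
    jacobian F x *ᵥ v.ofLp = (fderiv ℝ F x v).ofLp := by
  have hv : v = ∑ i, v i • EuclideanSpace.single i (1 : ℝ) := by
    conv_lhs => rw [← (EuclideanSpace.basisFun (Fin n) ℝ).sum_repr v]
    simp
  ext i
  conv_rhs => rw [hv, map_sum]
  simp [jacobian, Matrix.mulVec, dotProduct, mul_comm]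

/-! ### Population first order conditions and the expansion of the simulated auxiliary estimator. -/

namespace LIIModel

open Asymptotics

variable {Ω 𝕏 𝕎 : Type*} [MeasurableSpace Ω] [MeasurableSpace 𝕏] [MeasurableSpace 𝕎]
  {P : Measure Ω} [IsProbabilityMeasure P] {dθ dρ dz H : ℕ} {M : LIIModel Ω 𝕏 𝕎 dθ dρ dz H}
  {ρ₀ : ℝ → Vec dθ → Vec dρ} {ε : ℝ} {s : ℕ} {u : ℝ}

section Model

variable (hstruct : M.StructuralRegularity P) (hdep : M.DependenceConditions P)
  (hpseudo : M.IsPseudoTrue P ρ₀) (haux : M.AuxiliaryRegularity P ρ₀ ε)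

include hstruct hdep hpseudo haux

/-- By stationarity the limit criterion of the data simulated at `θ` is `meanCrit`, so `ρ₀ u θ`
minimizes it over `Γ`; at an interior point the gradient vanishes. -/
lemma meanScore_pseudoTrue (hu : u ∈ M.U) (j : Fin H) {θ : Vec dθ} (hθ : θ ∈ M.Θ)
    (hρ : ρ₀ u θ ∈ interior M.Γ) : M.meanScore P u (θ, ρ₀ u θ) = 0 := by
  have hne : M.Γ.Nonempty := ⟨_, interior_subset hρ⟩
  refine IsMinOn.gradient_eq_zero (f := M.meanCrit P u θ) (isMinOn_iff.2 fun ρ hρ' => ?_) hρ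
    (hasGradientAt_meanCrit hstruct hdep haux hu j hθ hne _)
  by_cases h : ρ = ρ₀ u θ
  · rw [h]
  · have := hpseudo.sim_min j u hu θ hθ ρ hρ' h
    rw [simLimCrit_eq hstruct hdep haux, simLimCrit_eq hstruct hdep haux] at this
    exact this.le

/-- Differentiating the population first order condition along the pseudo-true values. -/
lemma meanScoreDeriv_pseudoTrue (hu : u ∈ M.U) (j : Fin H) (hθint : M.θ₀ u ∈ interior M.Θ)
    (hρint : ρ₀ u (M.θ₀ u) ∈ interior M.Γ) (hd : DifferentiableAt ℝ (ρ₀ u) (M.θ₀ u))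
    (τ : Vec dθ) :
    M.meanScoreDeriv P u (M.θ₀ u, ρ₀ u (M.θ₀ u)) (τ, fderiv ℝ (ρ₀ u) (M.θ₀ u) τ) = 0 := by
  have h1 := (hasFDerivAt_meanScore hstruct hdep haux hu hθint (ρ₀ u (M.θ₀ u))).2
  have h2 : HasFDerivAt (fun θ => (θ, ρ₀ u θ))
      ((ContinuousLinearMap.id ℝ (Vec dθ)).prod (fderiv ℝ (ρ₀ u) (M.θ₀ u))) (M.θ₀ u) :=
    (hasFDerivAt_id _).prodMk hd.hasFDerivAt
  have h3 := HasFDerivAt.comp (M.θ₀ u) (f := fun θ => (θ, ρ₀ u θ)) h1 h2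
  -- Continuity of `ρ₀ u` at `θ₀(u)` keeps the pseudo-true values in the interior of `Γ` for nearby
  -- `θ`, so the first order condition is an identity in `θ` and can be differentiated.
  have h4 : (M.meanScore P u ∘ fun θ => (θ, ρ₀ u θ)) =ᶠ[𝓝 (M.θ₀ u)] fun _ => 0 := by
    filter_upwards [mem_interior_iff_mem_nhds.1 hθint,
      hd.continuousAt.eventually_mem (isOpen_interior.mem_nhds hρint)] with θ ha hb
    exact meanScore_pseudoTrue hstruct hdep hpseudo haux hu j ha hb
  have h5 := (h3.congr_of_eventuallyEq h4.symm).unique (hasFDerivAt_const 0 _)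
  simpa using congrArg (fun A : Vec dθ →L[ℝ] Vec dρ => A τ) h5

/-- Near the pseudo-true value the score of the observed data is, in the limit, a multiple of that
of the stationary data. -/
lemma exists_limScore_eventuallyEq (hker : M.KernelBandwidth s) (hu : u ∈ M.U) (j : Fin H)
    (hρint : ρ₀ u (M.θ₀ u) ∈ interior M.Γ) :
    ∃ c : ℝ, M.limScore P u =ᶠ[𝓝 (ρ₀ u (M.θ₀ u))] fun ρ => c • M.meanScore P u (M.θ₀ u, ρ) := by
  set θs := M.θ₀ u with hθs
  set ρs := ρ₀ u θs with hρs
  have hne : M.Γ.Nonempty := ⟨_, interior_subset hρint⟩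
  have hθ := hstruct.θ₀_mem u hu
  obtain ⟨c, hc⟩ := exists_limCrit_sub_eq_mul hstruct hdep hpseudo haux hker hu
  have hci := fun ρ => integrable_statCrit_map hstruct hdep haux hu j hθ hne ρ
  have hnb : ∀ᶠ ρ in 𝓝 ρs, M.limCrit P u ρ =
      M.limCrit P u ρs + c * (M.meanCrit P u θs ρ - M.meanCrit P u θs ρs) := by
    filter_upwards [mem_interior_iff_mem_nhds.1 hρint, Metric.closedBall_mem_nhds ρs haux.ε_pos]
      with ρ h1 h2
    rw [← hc ρ ⟨h1, mem_closedBall_iff_norm.1 h2⟩ (M.meanCrit P u θs ρ - M.meanCrit P u θs ρs)]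
    · ring
    intro t ht
    rw [meanCrit, meanCrit, ← integral_sub (hci _) (hci _), ← map_noise hstruct hdep ht,
      integral_map (measurable_noise hdep hstruct t).aemeasurable]
    · rfl
    · exact ((measurable_statCrit hstruct hdep haux u _).sub
        (measurable_statCrit hstruct hdep haux u _)).aestronglyMeasurable
  -- Equality of gradients at `ρ` needs equality of the criteria on a neighbourhood of `ρ`, not at
  -- `ρ` alone.
  refine ⟨c, hnb.eventually_nhds.mono fun ρ hρ => ?_⟩
  refine HasGradientAt.gradient (HasGradientAt.congr_of_eventuallyEq ?_ hρ)
  rw [hasGradientAt_iff_hasFDerivAt, map_smul]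
  exact (((hasGradientAt_meanCrit hstruct hdep haux hu j hθ hne ρ).hasFDerivAt.sub_const
    _).const_mul c).const_add _

/-- The derivative of the expected score in the auxiliary parameter is invertible. -/
lemma exists_equiv_meanScoreDeriv (hker : M.KernelBandwidth s) (hu : u ∈ M.U) (j : Fin H)
    (hθint : M.θ₀ u ∈ interior M.Θ) (hρint : ρ₀ u (M.θ₀ u) ∈ interior M.Γ)
    (hinv : IsUnit (jacobian (M.limScore P u) (ρ₀ u (M.θ₀ u))).det) :
    ∃ A : Vec dρ ≃L[ℝ] Vec dρ, ∀ v,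
      A v = M.meanScoreDeriv P u (M.θ₀ u, ρ₀ u (M.θ₀ u)) (0, v) := by
  obtain ⟨c, hc⟩ := exists_limScore_eventuallyEq hstruct hdep hpseudo haux hker hu j hρint
  have h1 := (hasFDerivAt_meanScore hstruct hdep haux hu hθint (ρ₀ u (M.θ₀ u))).2
  have h2 := (HasFDerivAt.comp (ρ₀ u (M.θ₀ u)) (f := fun ρ => (M.θ₀ u, ρ)) h1
    (hasFDerivAt_prodMk_right _ _)).const_smul c
  have h3 := (h2.congr_of_eventuallyEq hc).fderiv
  set B := (M.meanScoreDeriv P u (M.θ₀ u, ρ₀ u (M.θ₀ u))).comp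
    (ContinuousLinearMap.inr ℝ (Vec dθ) (Vec dρ)) with hB
  -- `∂Ψ₀/∂ρ'` equals `c • B`, so a vector killed by `B` is killed by an invertible matrix; the
  -- value of `c` plays no role.
  have hinj : Function.Injective B := by
    rw [injective_iff_map_eq_zero]
    intro v hv
    have h4 : jacobian (M.limScore P u) (ρ₀ u (M.θ₀ u)) *ᵥ v.ofLp = 0 := by
      rw [jacobian_mulVec, h3]
      simp [hv]
    have h5 := Matrix.mulVec_injective_iff_isUnit.2
      ((Matrix.isUnit_iff_isUnit_det _).2 hinv) (h4.trans (Matrix.mulVec_zero _).symm)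
    ext i
    exact congrFun h5 i
  refine ⟨(LinearEquiv.ofInjectiveEndo (B : Vec dρ →ₗ[ℝ] Vec dρ) hinj).toContinuousLinearEquiv,
    fun v => rfl⟩

omit hstruct hdep hpseudo haux in
/-- The simulated score is negligible on the scale of the local score. -/
lemma simScore_isLittleO {V : ℝ → Matrix (Fin dρ) (Fin dρ) ℝ} (hker : M.KernelBandwidth s)
    (hnorm : M.LocalNormality P ρ₀ V u) (j : Fin H) :
    (fun a : ℕ × Ω => (1 / (a.1 : ℝ)) • ∑ t ∈ Finset.Icc 1 a.1,
      M.statScore u (M.simNoise j t a.2) (M.θ₀ u, ρ₀ u (M.θ₀ u))) =o[highProb P]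
      fun a => (√((a.1 : ℝ) * M.h a.1))⁻¹ := by
  set X : ℕ → Ω → Vec dρ := fun T ω => (1 / √(T : ℝ)) • ∑ t ∈ Finset.Icc 1 T,
    M.statScore u (M.simNoise j t ω) (M.θ₀ u, ρ₀ u (M.θ₀ u)) with hX
  have hclt : TendstoInDistribution X atTop (fun x : Vec dρ => x) (fun _ => P)
    (multivariateGaussian 0 (V u)) := hnorm.sim_score_clt j
  -- `√h → 0` while `X` is bounded in probability. Multiplied by `√(T h)`, the simulated score is
  -- `√h • X`, so simulation noise disappears from the limit law.
  have h0 : Tendsto (fun a : ℕ × Ω => √(M.h a.1) • X a.1 a.2) (highProb P) (𝓝 0) := by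
    refine TendstoInDistribution.tendsto_zero_of_isLittleO hclt ?_
    have h1 : (fun a : ℕ × Ω => √(M.h a.1)) =o[highProb P] fun _ => (1 : ℝ) := by
      rw [isLittleO_one_iff]
      have := (hker.h_zero.sqrt).comp (tendsto_fst_highProb (P := P))
      simpa [Function.comp_def] using this
    have h2 : (fun a : ℕ × Ω => X a.1 a.2) =O[highProb P] fun a => ‖X a.1 a.2‖ + 1 :=
      IsBigO.of_norm_le fun a => by linarith [norm_nonneg (X a.1 a.2)]
    simpa using h1.smul_isBigO h2
  rw [isLittleO_iff]
  intro c hc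
  filter_upwards [(Metric.tendsto_nhds.1 h0) c hc,
    tendsto_fst_highProb.eventually (eventually_ge_atTop 1)] with a ha hT
  have hT' : (0 : ℝ) < a.1 := by exact_mod_cast hT
  have hh := hker.h_pos a.1 hT
  rw [dist_zero_right, hX, smul_smul, norm_smul, Real.norm_of_nonneg (by positivity)] at ha
  rw [norm_smul, Real.norm_of_nonneg (by positivity), Real.norm_of_nonneg (by positivity),
    Real.sqrt_mul hT'.le, ← div_eq_mul_inv, le_div_iff₀ (by positivity)]
  refine le_of_eq_of_le ?_ ha.le
  have h4 : 1 / (a.1 : ℝ) * √(a.1 : ℝ) = 1 / √(a.1 : ℝ) := by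
    rw [one_div_mul_eq_div, Real.sqrt_div_self, one_div]
  rw [← h4]
  ring

/-- Linear expansion of the simulated auxiliary estimator along consistent structural
parameters. -/
theorem simEstimator_expansion {V : ℝ → Matrix (Fin dρ) (Fin dρ) ℝ} (hker : M.KernelBandwidth s)
    (hu : u ∈ M.U) (hnorm : M.LocalNormality P ρ₀ V u)
    (hθint : M.θ₀ u ∈ interior M.Θ) (hρint : ρ₀ u (M.θ₀ u) ∈ interior M.Γ)
    (j : Fin H) {ρsim : ℕ → Vec dθ → Ω → Vec dρ}
    (hmin : ∀ᶠ p in highProb P, ∀ θ ∈ M.Θ, ρsim p.1 θ p.2 ∈ M.Γ ∧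
      IsMinOn (M.simCrit j p.1 u θ p.2) M.Γ (ρsim p.1 θ p.2))
    {q : ℕ × Ω → Vec dθ} (hq : Tendsto q (highProb P) (𝓝 (M.θ₀ u))) :
    (fun a => ρsim a.1 (q a) a.2 - ρ₀ u (M.θ₀ u) - fderiv ℝ (ρ₀ u) (M.θ₀ u) (q a - M.θ₀ u))
      =o[highProb P] fun a => ‖q a - M.θ₀ u‖ + (√((a.1 : ℝ) * M.h a.1))⁻¹ := by
  set θs := M.θ₀ u with hθs
  set ρs := ρ₀ u θs with hρs
  set l := highProb P with hl
  set n : ℕ × Ω → ℝ := fun a => (√((a.1 : ℝ) * M.h a.1))⁻¹ with hn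
  have hn0 : ∀ a, 0 ≤ n a := fun a => by positivity
  have hξ := measurable_simNoise hdep j
  have hlaw := map_simNoise_one hstruct hdep j
  set D := fderiv ℝ (ρ₀ u) θs with hD
  set 𝓛 := M.meanScoreDeriv P u (θs, ρs) with h𝓛
  have hqΘ : ∀ᶠ a in l, q a ∈ M.Θ := hq.eventually_mem (mem_interior_iff_mem_nhds.1 hθint)
  have hρq : Tendsto (fun a => ρsim a.1 (q a) a.2) l (𝓝 ρs) := by
    have h1 : Tendsto (fun a => ρ₀ u (q a)) l (𝓝 ρs) :=
      (hnorm.ρ₀_diff_θ.continuousAt.tendsto).comp hq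
    rw [Metric.tendsto_nhds] at h1 ⊢
    intro e he
    filter_upwards [h1 (e / 2) (by positivity), hqΘ, eventually_forall_dist_simEstimator_le hstruct
      hdep haux hu hpseudo hθint j hmin (show 0 < e / 3 by positivity)] with a h2 h3 h4
    have h5 := h4 _ h3
    have := dist_triangle (ρsim a.1 (q a) a.2) (ρ₀ u (q a)) ρs
    linarith
  obtain ⟨A, hA⟩ := exists_equiv_meanScoreDeriv hstruct hdep hpseudo haux hker hu j hθint hρint
    (hnorm.limScore_invertible u hu)
  have hD0 := meanScoreDeriv_pseudoTrue hstruct hdep hpseudo haux hu j hθint hρint hnorm.ρ₀_diff_θ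
  obtain ⟨L, hLi, hL⟩ := exists_stat_lipschitz hstruct hdep haux hu hθint
  obtain ⟨r, hr, hball⟩ := exists_ball_fst_mem hθint ρs
  -- Joint expansion of the simulated score at the random point `(q, ρ̂(q))` around `(θs, ρs)`;
  -- consistency of this one sequence is all it takes.
  have hexp := (stationaryErgodic_simNoise hdep j).average_sub_isLittleO hξ (F := M.statScore u)
    (p₀ := (θs, ρs)) (measurable_statScore hstruct hdep haux u)
    (continuous_statScore hstruct hdep haux hu)
    (fun x => (differentiable_statScore hstruct hdep haux hu x (θs, ρs)).hasFDerivAt)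
    (L := L) (by rw [hlaw]; exact hLi) hr
    (fun x p hp => (hL x p _ (hball p hp) (interior_subset hθint)).2)
    (by rw [hlaw]; exact (hasFDerivAt_meanScore hstruct hdep haux hu hθint ρs).1)
    (q := fun a => (q a, ρsim a.1 (q a) a.2)) (hq.prodMk_nhds hρq)
  rw [hlaw] at hexp
  change (fun a : ℕ × Ω => (1 / (a.1 : ℝ)) • ∑ t ∈ Finset.Icc 1 a.1,
      M.statScore u (M.simNoise j t a.2) (q a, ρsim a.1 (q a) a.2) -
    (1 / (a.1 : ℝ)) • ∑ t ∈ Finset.Icc 1 a.1, M.statScore u (M.simNoise j t a.2) (θs, ρs) -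
    𝓛 ((q a, ρsim a.1 (q a) a.2) - (θs, ρs))) =o[l] _ at hexp
  have hfoc : ∀ᶠ a in l, (1 / (a.1 : ℝ)) • ∑ t ∈ Finset.Icc 1 a.1,
      M.statScore u (M.simNoise j t a.2) (q a, ρsim a.1 (q a) a.2) = 0 := by
    filter_upwards [hmin, hqΘ, hρq.eventually_mem (isOpen_interior.mem_nhds hρint)] with a h1 h2 h3
    exact (h1 _ h2).2.gradient_eq_zero h3 (hasGradientAt_simCrit haux.contDiff_critMap j _ _ _ _ _)
  have hscore := simScore_isLittleO hker hnorm j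
  set S : ℕ × Ω → Vec dρ := fun a => (1 / (a.1 : ℝ)) • ∑ t ∈ Finset.Icc 1 a.1,
    M.statScore u (M.simNoise j t a.2) (θs, ρs) with hS
  set x : ℕ × Ω → Vec dρ := fun a => ρsim a.1 (q a) a.2 - ρs with hx
  set τ : ℕ × Ω → Vec dθ := fun a => q a - θs with hτ
  set y : ℕ × Ω → Vec dρ := fun a => 𝓛 (τ a, 0) with hy
  -- The relation `𝓛 (τ, D τ) = 0` says that the `θ`-part of `𝓛` is `-A ∘ D`. Inverting `A`
  -- therefore leaves `D` alone, and the curvature of the simulated criterion cancels.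
  have hyD : ∀ a, A.symm (y a) = - D (τ a) := by
    intro a
    have h1 : y a + A (D (τ a)) = 0 := by
      rw [hA, hy, ← map_add, Prod.mk_add_mk, add_zero, zero_add]
      exact hD0 (τ a)
    rw [eq_neg_of_add_eq_zero_left h1, map_neg, ContinuousLinearEquiv.symm_apply_apply]
  have hmain : (fun a => A (x a) + y a) =o[l] fun a => ‖x a‖ + (‖τ a‖ + n a) := by
    have h1 : (fun a => (q a, ρsim a.1 (q a) a.2) - (θs, ρs)) =O[l]
        fun a => ‖x a‖ + (‖τ a‖ + n a) := by
      refine IsBigO.of_bound 1 (Eventually.of_forall fun a => ?_)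
      have h2 := hn0 a
      rw [Real.norm_of_nonneg (by positivity), one_mul, Prod.mk_sub_mk, Prod.norm_def]
      refine max_le ?_ ?_
      · change ‖τ a‖ ≤ _
        linarith [norm_nonneg (x a)]
      · change ‖x a‖ ≤ _
        linarith [norm_nonneg (τ a)]
    have h3 : n =O[l] fun a => ‖x a‖ + (‖τ a‖ + n a) := by
      refine IsBigO.of_bound 1 (Eventually.of_forall fun a => ?_)
      have h2 := hn0 a
      rw [Real.norm_of_nonneg h2, Real.norm_of_nonneg (by positivity), one_mul]
      linarith [norm_nonneg (τ a), norm_nonneg (x a)]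
    have h4 := ((hexp.trans_isBigO h1).add (hscore.trans_isBigO h3)).neg_left
    refine h4.congr' ?_ EventuallyEq.rfl
    filter_upwards [hfoc] with a ha
    rw [ha, hA, hy]
    have : ((q a, ρsim a.1 (q a) a.2) - (θs, ρs) : Vec dθ × Vec dρ) = (0, x a) + (τ a, 0) := by
      rw [Prod.mk_add_mk, add_zero, zero_add]
      rfl
    rw [this, map_add]
    abel
  have hfin := isLittleO_add_symm_of_isLittleO A (fun a => add_nonneg (norm_nonneg (τ a)) (hn0 a))
    hmain
  have h5 : (fun a => ‖y a‖ + (‖τ a‖ + n a)) =O[l] fun a => ‖τ a‖ + n a := by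
    refine IsBigO.add ?_ (isBigO_refl _ _)
    refine IsBigO.of_bound ‖𝓛‖ (Eventually.of_forall fun a => ?_)
    have h2 := hn0 a
    rw [norm_norm, Real.norm_of_nonneg (by positivity)]
    refine (𝓛.le_opNorm _).trans (mul_le_mul_of_nonneg_left ?_ (norm_nonneg _))
    rw [Prod.norm_def, norm_zero, max_eq_left (norm_nonneg _)]
    linarith
  refine (hfin.trans_isBigO h5).congr_left fun a => ?_
  rw [hyD, ← sub_eq_add_neg]

end Model

end LIIModel

/-! ### Asymptotic least squares and identification by a continuous injection. -/

open Asymptotics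

/-- An approximate minimizer of the distance from `b` to a family of points that is linear up to
errors of smaller order is the least squares solution up to an error of smaller order. -/
lemma isLittleO_argmin_sub {α E F : Type*} [NormedAddCommGroup E] [NormedSpace ℝ E]
    [FiniteDimensional ℝ E] [NormedAddCommGroup F] [InnerProductSpace ℝ F] {l : Filter α}
    {G : E →L[ℝ] F} (hG : Function.Injective G) {S : F →L[ℝ] E}
    (hS : ∀ y x, inner ℝ (y - G (S y)) (G x) = 0)
    {m : α → E → F} {b : α → F} {N : α → ℝ} {K : Set E} {t : α → E}
    (hN0 : ∀ a, 0 ≤ N a) (hN : Tendsto N l (𝓝 0)) (hb : b =O[l] N) (hK : K ∈ 𝓝 0)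
    (hm : ∀ q : α → E, Tendsto q l (𝓝 0) → (fun a => m a (q a) - G (q a)) =o[l]
      fun a => ‖q a‖ + N a)
    (hmin : ∀ᶠ a in l, ∀ x ∈ K, ‖b a - m a (t a)‖ ≤ ‖b a - m a x‖)
    (ht : Tendsto t l (𝓝 0)) :
    (fun a => t a - S (b a)) =o[l] N := by
  obtain ⟨c, hc, hGc⟩ := LinearMap.exists_antilipschitzWith (G : E →ₗ[ℝ] F)
    (LinearMap.ker_eq_bot.2 hG)
  have hGO : ∀ q : α → E, q =O[l] fun a => G (q a) := fun q =>
    IsBigO.of_bound c (Eventually.of_forall fun a => by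
      simpa using hGc.le_mul_dist (q a) 0)
  have hNN : ∀ q : α → E, q =O[l] N → (fun a => ‖q a‖ + N a) =O[l] N := fun q hq =>
    hq.norm_left.add (isBigO_refl _ _)
  have h0 := (hm (fun _ => 0) tendsto_const_nhds).trans_isBigO (hNN _ (isBigO_zero _ _))
  simp only [map_zero, sub_zero] at h0
  -- Comparison with the competitor `0`.
  have hres : (fun a => b a - m a (t a)) =O[l] N := by
    refine IsBigO.trans (IsBigO.of_bound 1 ?_) (hb.sub h0.isBigO)
    filter_upwards [hmin] with a ha
    rw [one_mul]
    exact ha 0 (mem_of_mem_nhds hK)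
  -- `G` is bounded below, so `t` is of the order of `G t`, and the model error, small relative to
  -- `‖G t‖ + N`, is absorbed.
  have htN : t =O[l] N := by
    have h1 := (hm t ht).trans_isBigO (g := fun a => ‖t a‖ + N a) (isBigO_refl _ _)
    have h2 : (fun a => G (t a) + (m a (t a) - G (t a))) =O[l] N := by
      refine (hb.sub hres).congr_left fun a => by abel
    have h3 : (fun a => m a (t a) - G (t a)) =o[l] fun a => ‖G (t a)‖ + N a := by
      refine h1.trans_isBigO ?_
      refine IsBigO.of_bound (c + 1) ?_
      refine Eventually.of_forall fun a => ?_
      have h4 : ‖t a‖ ≤ c * ‖G (t a)‖ := by simpa using hGc.le_mul_dist (t a) 0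
      have h5 := hN0 a
      have h6 : 0 ≤ (c : ℝ) * N a := by positivity
      rw [Real.norm_of_nonneg (by positivity), Real.norm_of_nonneg (by positivity)]
      nlinarith [norm_nonneg (G (t a))]
    obtain ⟨C, hC⟩ := h2.bound
    refine (hGO t).trans (IsBigO.of_bound (2 * C + 1) ?_)
    filter_upwards [hC, h3.bound (show (0 : ℝ) < 1 / 2 by norm_num)] with a h4 h5
    have h6 := hN0 a
    rw [Real.norm_of_nonneg h6] at h4 ⊢
    rw [Real.norm_of_nonneg (by positivity)] at h5
    have h7 : ‖G (t a)‖ ≤ ‖G (t a) + (m a (t a) - G (t a))‖ + ‖m a (t a) - G (t a)‖ := by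
      have := norm_sub_le (G (t a) + (m a (t a) - G (t a))) (m a (t a) - G (t a))
      rwa [add_sub_cancel_right] at this
    linarith
  have hSb : (fun a => S (b a)) =O[l] N := (S.isBigO_comp b l).trans hb
  have hS0 : Tendsto (fun a => S (b a)) l (𝓝 0) := hSb.trans_tendsto hN
  have he1 := (hm t ht).trans_isBigO (hNN t htN)
  have he2 := (hm _ hS0).trans_isBigO (hNN _ hSb)
  set e1 := fun a => m a (t a) - G (t a) with he1d
  set e2 := fun a => m a (S (b a)) - G (S (b a)) with he2d
  set n0 := fun a => b a - G (S (b a)) with hn0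
  have hn0O : n0 =O[l] N := hb.sub ((G.isBigO_comp _ l).trans hSb)
  have he : (fun a => ‖e1 a‖ + ‖e2 a‖) =o[l] N := he1.norm_left.add he2.norm_left
  -- Comparison with the competitor `S b` gives `‖b - G t‖ ≤ ‖n0‖ + o(N)`. By Pythagoras the left
  -- side squared is `‖n0‖ ^ 2 + ‖G (t - S b)‖ ^ 2`, and the cross term `‖n0‖ o(N)` is `o(N ^ 2)`
  -- because `n0 = O(N)`.
  have hsq : (fun a => ‖G (t a - S (b a))‖ ^ 2) =o[l] fun a => N a ^ 2 := by
    have h1 : (fun a => 2 * (‖n0 a‖ * (‖e1 a‖ + ‖e2 a‖)) + (‖e1 a‖ + ‖e2 a‖) ^ 2) =o[l]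
        fun a => N a ^ 2 := by
      refine IsLittleO.add (IsLittleO.const_mul_left ?_ 2) (he.pow two_pos)
      simpa only [pow_two] using hn0O.norm_left.mul_isLittleO he
    refine IsBigO.trans_isLittleO (IsBigO.of_bound 1 ?_) h1
    filter_upwards [hmin, hS0.eventually hK] with a ha hK'
    have h2 : b a - G (t a) = n0 a - G (t a - S (b a)) := by
      simp only [hn0, map_sub]
      abel
    have h3 : ‖b a - G (t a)‖ ^ 2 = ‖n0 a‖ ^ 2 + ‖G (t a - S (b a))‖ ^ 2 := by
      rw [h2, norm_sub_sq_real, hS]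
      ring
    have h4 : ‖b a - G (t a)‖ ≤ ‖n0 a‖ + (‖e1 a‖ + ‖e2 a‖) := by
      have h5 : b a - G (t a) = (b a - m a (t a)) + e1 a := by simp only [he1d]; abel
      have h6 : b a - m a (S (b a)) = n0 a - e2 a := by simp only [he2d, hn0]; abel
      have h7 := ha _ hK'
      rw [h6] at h7
      rw [h5]
      linarith [norm_add_le (b a - m a (t a)) (e1 a), norm_sub_le (n0 a) (e2 a)]
    rw [one_mul, Real.norm_of_nonneg (by positivity), Real.norm_of_nonneg (by positivity)]
    have h5 : ‖b a - G (t a)‖ ^ 2 ≤ (‖n0 a‖ + (‖e1 a‖ + ‖e2 a‖)) ^ 2 := by gcongr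
    nlinarith
  have h1 : (fun a => ‖G (t a - S (b a))‖) =o[l] N := IsLittleO.of_pow hsq two_ne_zero
  exact (hGO fun a => t a - S (b a)).trans_isLittleO h1.of_norm_left

/-- A continuous injection of a compact set has a continuous inverse: the image of the part of `K`
outside a neighbourhood of `x₀` is compact and misses `f x₀`. -/
lemma tendsto_of_tendsto_comp_of_injOn {α E F : Type*} [TopologicalSpace E] [TopologicalSpace F]
    [T2Space F] {l : Filter α} {K : Set E} (hK : IsCompact K) {f : E → F} (hf : ContinuousOn f K)
    (hinj : Set.InjOn f K) {x₀ : E} (hx₀ : x₀ ∈ K) {q : α → E} (hq : ∀ᶠ a in l, q a ∈ K)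
    (hfq : Tendsto (fun a => f (q a)) l (𝓝 (f x₀))) : Tendsto q l (𝓝 x₀) := by
  rw [tendsto_nhds]
  intro O hO hx
  have h1 : IsClosed (f '' (K \ O)) :=
    ((hK.diff hO).image_of_continuousOn (hf.mono Set.sdiff_subset)).isClosed
  have h2 : f x₀ ∈ (f '' (K \ O))ᶜ := by
    rintro ⟨x, hxK, hxe⟩
    exact hxK.2 (hinj hxK.1 hx₀ hxe ▸ hx)
  filter_upwards [hq, hfq.eventually_mem (h1.isOpen_compl.mem_nhds h2)] with a h3 h4
  by_contra h5
  exact h4 ⟨q a, ⟨h3, h5⟩, rfl⟩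

/-- The continuous linear map of a matrix. -/
def matCLM {m n : ℕ} (A : Matrix (Fin m) (Fin n) ℝ) : Vec n →L[ℝ] Vec m :=
  LinearMap.toContinuousLinearMap (Matrix.toEuclideanLin A)

/-! ### Matrices as linear maps and images of Gaussian laws. -/

section Matrix

variable {m n k : ℕ}

lemma ofLp_matCLM (A : Matrix (Fin m) (Fin n) ℝ) (x : Vec n) : (matCLM A x).ofLp = A *ᵥ x.ofLp :=
  rfl

lemma matCLM_mul (A : Matrix (Fin m) (Fin n) ℝ) (B : Matrix (Fin n) (Fin k) ℝ) (x : Vec k) :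
    matCLM (A * B) x = matCLM A (matCLM B x) := by
  refine WithLp.ofLp_injective 2 ?_
  simp [ofLp_matCLM, Matrix.mulVec_mulVec]

lemma matCLM_one (x : Vec n) : matCLM (1 : Matrix (Fin n) (Fin n) ℝ) x = x := by
  refine WithLp.ofLp_injective 2 ?_
  simp [ofLp_matCLM]

lemma matCLM_neg (A : Matrix (Fin m) (Fin n) ℝ) (x : Vec n) : matCLM (-A) x = -matCLM A x := by
  refine WithLp.ofLp_injective 2 ?_
  simp [ofLp_matCLM, Matrix.neg_mulVec]

lemma inner_matCLM (A : Matrix (Fin m) (Fin n) ℝ) (x : Vec n) (y : Vec m) :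
    inner ℝ (matCLM A x) y = inner ℝ x (matCLM Aᵀ y) := by
  simp only [EuclideanSpace.inner_eq_star_dotProduct, star_trivial, ofLp_matCLM]
  rw [Matrix.mulVec_transpose, ← Matrix.dotProduct_mulVec]

lemma matCLM_injective_iff {A : Matrix (Fin m) (Fin n) ℝ} :
    Function.Injective (matCLM A) ↔ Function.Injective A.mulVec := by
  refine ⟨fun h x y hxy => ?_, fun h x y hxy => ?_⟩
  · exact congrArg WithLp.ofLp
      (@h (WithLp.toLp 2 x) (WithLp.toLp 2 y) (WithLp.ofLp_injective 2 hxy))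
  · exact WithLp.ofLp_injective 2 (h (congrArg WithLp.ofLp hxy))

lemma mulVec_injective_of_rank {A : Matrix (Fin m) (Fin n) ℝ} (h : A.rank = n) :
    Function.Injective A.mulVec := by
  have h1 := LinearMap.finrank_range_add_finrank_ker A.mulVecLin
  rw [← Matrix.rank, h, Module.finrank_fin_fun] at h1
  have h2 : LinearMap.ker A.mulVecLin = ⊥ := Submodule.finrank_eq_zero.1 (by omega)
  exact LinearMap.ker_eq_bot.1 h2

lemma fderiv_apply_eq_matCLM (F : Vec n → Vec m) (x v : Vec n) :
    fderiv ℝ F x v = matCLM (jacobian F x) v :=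
  WithLp.ofLp_injective 2 (jacobian_mulVec F x v).symm

lemma exists_equiv_matCLM {A : Matrix (Fin n) (Fin n) ℝ} (hA : IsUnit A.det) :
    ∃ e : Vec n ≃L[ℝ] Vec n, (∀ x, e x = matCLM A x) ∧ ∀ x, e.symm x = matCLM A⁻¹ x :=
  ⟨ContinuousLinearEquiv.equivOfInverse (matCLM A) (matCLM A⁻¹)
    (fun x => by rw [← matCLM_mul, Matrix.nonsing_inv_mul _ hA, matCLM_one])
    (fun x => by rw [← matCLM_mul, Matrix.mul_nonsing_inv _ hA, matCLM_one]),
    fun _ => rfl, fun _ => rfl⟩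

/-- The image of a centred Gaussian law under a linear map. -/
lemma map_multivariateGaussian_matCLM {S : Matrix (Fin n) (Fin n) ℝ} (hS : S.PosSemidef)
    (A : Matrix (Fin m) (Fin n) ℝ) :
    (multivariateGaussian 0 S).map (matCLM A) = multivariateGaussian 0 (A * S * Aᵀ) := by
  have hAS : (A * S * Aᵀ).PosSemidef := by
    simpa using hS.mul_mul_conjTranspose_same A
  have hm : Measurable (matCLM A) := (matCLM A).continuous.measurable
  have : IsProbabilityMeasure ((multivariateGaussian 0 S).map (matCLM A)) :=
    Measure.isProbabilityMeasure_map hm.aemeasurable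
  refine Measure.ext_of_charFun (funext fun x => ?_)
  have h1 : charFun ((multivariateGaussian 0 S).map (matCLM A)) x =
      charFun (multivariateGaussian 0 S) (matCLM Aᵀ x) := by
    rw [charFun_apply, charFun_apply, integral_map hm.aemeasurable (by fun_prop)]
    simp only [inner_matCLM]
  rw [h1, charFun_multivariateGaussian hS, charFun_multivariateGaussian hAS]
  simp only [inner_zero_right, ofLp_matCLM]
  have h2 : (Aᵀ *ᵥ x.ofLp) ⬝ᵥ (S *ᵥ (Aᵀ *ᵥ x.ofLp)) = x.ofLp ⬝ᵥ ((A * S * Aᵀ) *ᵥ x.ofLp) := by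
    rw [Matrix.mulVec_transpose, ← Matrix.dotProduct_mulVec, ← Matrix.mulVec_transpose,
      Matrix.mulVec_mulVec, Matrix.mulVec_mulVec]
  rw [h2]

end Matrix

/-- Convergence in distribution sees only the law of the limit, which may thus be realized by the
identity on the target space. -/
lemma TendstoInDistribution.of_map_eq {E Ω Ω' : Type*} [NormedAddCommGroup E] [MeasurableSpace E]
    [BorelSpace E] {mΩ : MeasurableSpace Ω} {mΩ' : MeasurableSpace Ω'} {P : Measure Ω}
    [IsProbabilityMeasure P] {μ : Measure Ω'} [IsProbabilityMeasure μ] {γ : Measure E}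
    [IsProbabilityMeasure γ] {X : ℕ → Ω → E} {Z : Ω' → E}
    (h : TendstoInDistribution X atTop Z (fun _ => P) μ) (hγ : μ.map Z = γ) :
    TendstoInDistribution X atTop (fun x : E => x) (fun _ => P) γ where
  forall_aemeasurable := h.forall_aemeasurable
  aemeasurable_limit := aemeasurable_id
  tendsto := by
    have e : (⟨μ.map Z, Measure.isProbabilityMeasure_map h.aemeasurable_limit⟩ :
        ProbabilityMeasure E) =
        ⟨γ.map fun x => x, Measure.isProbabilityMeasure_map aemeasurable_id⟩ :=
      Subtype.ext (hγ.trans Measure.map_id'.symm)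
    rw [← e]
    exact h.tendsto

open scoped MatrixOrder ComplexOrder Matrix.Norms.L2Operator in
lemma Matrix.PosSemidef.exists_eq_transpose_mul_self {n : ℕ} {W : Matrix (Fin n) (Fin n) ℝ}
    (hW : W.PosSemidef) : ∃ B : Matrix (Fin n) (Fin n) ℝ, W = Bᵀ * B := by
  obtain ⟨B, hB⟩ := CStarAlgebra.nonneg_iff_eq_star_mul_self.mp hW.nonneg
  exact ⟨B, by simpa [Matrix.star_eq_conjTranspose] using hB⟩

/-! ### Consistency of the indirect inference estimator and averaging over the simulated paths. -/

namespace LIIModel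

open Asymptotics

variable {Ω 𝕏 𝕎 : Type*} [MeasurableSpace Ω] [MeasurableSpace 𝕏] [MeasurableSpace 𝕎]
  {P : Measure Ω} [IsProbabilityMeasure P] {dθ dρ dz H : ℕ} {M : LIIModel Ω 𝕏 𝕎 dθ dρ dz H}
  {ρ₀ : ℝ → Vec dθ → Vec dρ} {ε : ℝ} {s : ℕ} {u : ℝ}

lemma sqNorm_transpose_mul_self (B : Matrix (Fin dρ) (Fin dρ) ℝ) (x : Vec dρ) :
    sqNorm (Bᵀ * B) x = ‖matCLM B x‖ ^ 2 := by
  rw [← real_inner_self_eq_norm_sq, inner_matCLM, ← matCLM_mul,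
    EuclideanSpace.inner_eq_star_dotProduct, star_trivial, ofLp_matCLM, dotProduct_comm, sqNorm]

lemma avgSim_sub (hH : 1 ≤ H) (ρsim : Fin H → ℕ → Vec dθ → Ω → Vec dρ) (T : ℕ) (θ : Vec dθ)
    (ω : Ω) (c : Vec dρ) :
    avgSim ρsim T θ ω - c = (1 / (H : ℝ)) • ∑ j, (ρsim j T θ ω - c) := by
  have hH' : (H : ℝ) ≠ 0 := by positivity
  rw [Finset.sum_sub_distrib, smul_sub, Finset.sum_const, Finset.card_univ, Fintype.card_fin,
    ← Nat.cast_smul_eq_nsmul ℝ, smul_smul, one_div_mul_cancel hH', one_smul, avgSim]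

lemma norm_avgSim_sub_le (hH : 1 ≤ H) {ρsim : Fin H → ℕ → Vec dθ → Ω → Vec dρ} {T : ℕ}
    {θ : Vec dθ} {ω : Ω} {c : Vec dρ} {r : ℝ} (h : ∀ j, dist (ρsim j T θ ω) c ≤ r) :
    ‖avgSim ρsim T θ ω - c‖ ≤ r := by
  have hH' : (0 : ℝ) < H := by positivity
  rw [avgSim_sub hH, norm_smul, Real.norm_of_nonneg (by positivity), one_div,
    inv_mul_le_iff₀ hH']
  calc _ ≤ ∑ j, ‖ρsim j T θ ω - c‖ := norm_sum_le _ _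
    _ ≤ ∑ _j : Fin H, r := Finset.sum_le_sum fun j _ => by simpa [dist_eq_norm] using h j
    _ = _ := by simp

section Model

variable (hH : 1 ≤ H) (hstruct : M.StructuralRegularity P) (hdep : M.DependenceConditions P)
  (hpseudo : M.IsPseudoTrue P ρ₀) (haux : M.AuxiliaryRegularity P ρ₀ ε)
  (hker : M.KernelBandwidth s) (hu : u ∈ M.U)
  {B : Matrix (Fin dρ) (Fin dρ) ℝ}
  {ρhat : ℕ → Ω → Vec dρ} {ρsim : Fin H → ℕ → Vec dθ → Ω → Vec dρ} {θhat : ℕ → Ω → Vec dθ}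
  (hest : M.IsLIIEstimator P (Bᵀ * B) u ρhat ρsim θhat)

include hest

/-- With weighting matrix `Bᵀ * B` the quadratic form is a squared Euclidean norm after applying
`B`, so the estimator minimizes a Euclidean distance. -/
lemma IsLIIEstimator.eventually_norm_le :
    ∀ᶠ a in highProb P, θhat a.1 a.2 ∈ M.Θ ∧ ∀ θ ∈ M.Θ,
      ‖matCLM B (ρhat a.1 a.2 - avgSim ρsim a.1 (θhat a.1 a.2) a.2)‖ ≤
        ‖matCLM B (ρhat a.1 a.2 - avgSim ρsim a.1 θ a.2)‖ := by
  have h := eventually_highProb_iff (P := P) (q := fun a => θhat a.1 a.2 ∈ M.Θ ∧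
    IsMaxOn (fun θ => -sqNorm (Bᵀ * B) (ρhat a.1 a.2 - avgSim ρsim a.1 θ a.2)) M.Θ
      (θhat a.1 a.2)) |>.2 hest.argmax
  filter_upwards [h] with a ha
  refine ⟨ha.1, fun θ hθ => ?_⟩
  have h1 := isMaxOn_iff.1 ha.2 θ hθ
  rw [neg_le_neg_iff, sqNorm_transpose_mul_self, sqNorm_transpose_mul_self] at h1
  exact le_of_sq_le_sq h1 (norm_nonneg _)

include hH hstruct hdep hpseudo haux hker hu

/-- Consistency of the indirect inference estimator. -/
theorem tendsto_indirectEstimator (hθint : M.θ₀ u ∈ interior M.Θ)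
    (hB : Function.Injective (matCLM B)) :
    Tendsto (fun a : ℕ × Ω => θhat a.1 a.2) (highProb P) (𝓝 (M.θ₀ u)) := by
  have hmin := hest.eventually_norm_le
  have hobs := tendsto_auxEstimator hstruct hdep hpseudo haux hker hu
    (eventually_highProb_iff.2 hest.argmin_obs)
  have hθs := interior_subset hθint
  -- Identification: `θ ↦ B ρ₀(u; θ)` is a continuous injection on the compact `Θ`, so convergence
  -- of its value at `θ̂` suffices.
  refine tendsto_of_tendsto_comp_of_injOn haux.Θ_compact (f := fun θ => matCLM B (ρ₀ u θ))
    ((matCLM B).continuous.comp_continuousOn (haux.ρ₀_continuous u hu))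
    (fun x hx y hy hxy => haux.ρ₀_injective u hu hx hy (hB hxy)) hθs
    (hmin.mono fun a ha => ha.1) ?_
  rw [Metric.tendsto_nhds]
  intro e he
  set β := ‖matCLM B‖ + 1 with hβ
  have hβ0 : 0 < β := by positivity
  have hBn : ∀ x, ‖matCLM B x‖ ≤ β * ‖x‖ := fun x =>
    ((matCLM B).le_opNorm x).trans (by gcongr; linarith)
  -- Four errors enter, each at most `e / 8` after applying `B`: the one of `ρ̂` twice, and those of
  -- the simulated estimators at `θ̂` and at `θ₀(u)`.
  have hr : 0 < e / (8 * β) := by positivity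
  have hsim : ∀ᶠ a in highProb P, ∀ j, ∀ θ ∈ M.Θ,
      dist (ρsim j a.1 θ a.2) (ρ₀ u θ) ≤ e / (8 * β) := by
    rw [eventually_all]
    exact fun j => eventually_forall_dist_simEstimator_le hstruct hdep haux hu hpseudo hθint j
      (eventually_highProb_iff.2 (hest.argmin_sim j)) hr
  filter_upwards [hmin, hsim, (Metric.tendsto_nhds.1 hobs) _ hr] with a h1 h2 h3
  obtain ⟨hθ, h1⟩ := h1
  have h4 : ∀ θ ∈ M.Θ, ‖avgSim ρsim a.1 θ a.2 - ρ₀ u θ‖ ≤ e / (8 * β) := fun θ hθ =>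
    norm_avgSim_sub_le hH fun j => h2 j θ hθ
  have h5 := h4 _ hθ
  have h6 := h4 _ hθs
  have h7 := h1 _ hθs
  rw [dist_eq_norm] at h3 ⊢
  set R := ρhat a.1 a.2
  set A₁ := avgSim ρsim a.1 (θhat a.1 a.2) a.2
  set A₂ := avgSim ρsim a.1 (M.θ₀ u) a.2
  have h8 : matCLM B (ρ₀ u (θhat a.1 a.2)) - matCLM B (ρ₀ u (M.θ₀ u)) =
      matCLM B (R - ρ₀ u (M.θ₀ u)) - matCLM B (A₁ - ρ₀ u (θhat a.1 a.2)) -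
        matCLM B (R - A₁) := by
    simp only [map_sub]
    abel
  have h9 : R - A₂ = (R - ρ₀ u (M.θ₀ u)) - (A₂ - ρ₀ u (M.θ₀ u)) := by abel
  have h10 := hBn (R - A₂)
  have h11 : ‖R - A₂‖ ≤ ‖R - ρ₀ u (M.θ₀ u)‖ + ‖A₂ - ρ₀ u (M.θ₀ u)‖ := by
    rw [h9]
    exact norm_sub_le _ _
  have h12 := hBn (R - ρ₀ u (M.θ₀ u))
  have h13 := hBn (A₁ - ρ₀ u (θhat a.1 a.2))
  have h14 : ∀ x : ℝ, x ≤ e / (8 * β) → β * x ≤ e / 8 := fun x hx => by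
    have := mul_le_mul_of_nonneg_left hx hβ0.le
    have h : β * (e / (8 * β)) = e / 8 := by field_simp
    linarith
  rw [h8]
  have h15 := norm_sub_le (matCLM B (R - ρ₀ u (M.θ₀ u)) - matCLM B (A₁ - ρ₀ u (θhat a.1 a.2)))
    (matCLM B (R - A₁))
  have h16 := norm_sub_le (matCLM B (R - ρ₀ u (M.θ₀ u))) (matCLM B (A₁ - ρ₀ u (θhat a.1 a.2)))
  have h17 := mul_le_mul_of_nonneg_left h11 hβ0.le
  rw [mul_add] at h17
  linarith [h14 _ h3.le, h14 _ h5, h14 _ h6]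

omit hest in
/-- Linear expansion of the averaged simulated auxiliary estimator. -/
lemma avgSim_expansion {V : ℝ → Matrix (Fin dρ) (Fin dρ) ℝ}
    (hnorm : M.LocalNormality P ρ₀ V u)
    (hθint : M.θ₀ u ∈ interior M.Θ) (hρint : ρ₀ u (M.θ₀ u) ∈ interior M.Γ)
    (hmin : ∀ j, ∀ᶠ p in highProb P, ∀ θ ∈ M.Θ, ρsim j p.1 θ p.2 ∈ M.Γ ∧
      IsMinOn (M.simCrit j p.1 u θ p.2) M.Γ (ρsim j p.1 θ p.2))
    {q : ℕ × Ω → Vec dθ} (hq : Tendsto q (highProb P) (𝓝 (M.θ₀ u))) :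
    (fun a => avgSim ρsim a.1 (q a) a.2 - ρ₀ u (M.θ₀ u) -
        fderiv ℝ (ρ₀ u) (M.θ₀ u) (q a - M.θ₀ u))
      =o[highProb P] fun a => ‖q a - M.θ₀ u‖ + (√((a.1 : ℝ) * M.h a.1))⁻¹ := by
  have h := (IsLittleO.sum (s := Finset.univ) fun j _ => simEstimator_expansion hstruct hdep
    hpseudo haux hker hu hnorm hθint hρint j (hmin j) hq).const_smul_left (1 / (H : ℝ))
  refine h.congr_left fun a => ?_
  simp only [Pi.smul_apply, Finset.sum_apply, sub_sub]
  exact (avgSim_sub hH ρsim a.1 (q a) a.2 _).symm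

end Model

end LIIModel

/-! ### The linear representation of the indirect inference estimator. -/

namespace LIIModel

open Asymptotics

/-- The linear representation of the indirect inference estimator in terms of the local score. -/
theorem indirectEstimator_expansion {Ω 𝕏 𝕎 : Type*} [MeasurableSpace Ω] [MeasurableSpace 𝕏]
    [MeasurableSpace 𝕎] {P : Measure Ω} [IsProbabilityMeasure P] {dθ dρ dz H : ℕ} (hH : 1 ≤ H)
    {M : LIIModel Ω 𝕏 𝕎 dθ dρ dz H} {ρ₀ : ℝ → Vec dθ → Vec dρ}
    {V : ℝ → Matrix (Fin dρ) (Fin dρ) ℝ} {B : Matrix (Fin dρ) (Fin dρ) ℝ} {ε : ℝ} {s : ℕ} {u : ℝ}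
    {ρhat : ℕ → Ω → Vec dρ} {ρsim : Fin H → ℕ → Vec dθ → Ω → Vec dρ} {θhat : ℕ → Ω → Vec dθ}
    (hstruct : M.StructuralRegularity P) (hdep : M.DependenceConditions P)
    (hpseudo : M.IsPseudoTrue P ρ₀) (haux : M.AuxiliaryRegularity P ρ₀ ε)
    (hker : M.KernelBandwidth s) (hu : u ∈ M.U) (hnorm : M.LocalNormality P ρ₀ V u)
    (hθint : M.θ₀ u ∈ interior M.Θ) (hρint : ρ₀ u (M.θ₀ u) ∈ interior M.Γ)
    (hB : Function.Injective (matCLM B))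
    (hest : M.IsLIIEstimator P (Bᵀ * B) u ρhat ρsim θhat)
    (hQ : IsUnit (M.Q ρ₀ (Bᵀ * B) u).det)
    (hN : Tendsto (fun a : ℕ × Ω => ‖M.localScore a.1 u a.2 (ρ₀ u (M.θ₀ u))‖ +
      (√((a.1 : ℝ) * M.h a.1))⁻¹) (highProb P) (𝓝 0)) :
    (fun a : ℕ × Ω => θhat a.1 a.2 - M.θ₀ u +
      matCLM ((M.Q ρ₀ (Bᵀ * B) u)⁻¹ * M.Wmat P ρ₀ (Bᵀ * B) u)
        (M.localScore a.1 u a.2 (ρ₀ u (M.θ₀ u)))) =o[highProb P]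
      fun a => ‖M.localScore a.1 u a.2 (ρ₀ u (M.θ₀ u))‖ + (√((a.1 : ℝ) * M.h a.1))⁻¹ := by
  set θs := M.θ₀ u with hθs
  set ρs := ρ₀ u θs with hρs
  set l := highProb P with hl
  set Ψ : ℕ × Ω → Vec dρ := fun a => M.localScore a.1 u a.2 ρs with hΨ
  set n : ℕ × Ω → ℝ := fun a => (√((a.1 : ℝ) * M.h a.1))⁻¹ with hn
  have hn0 : ∀ a, 0 ≤ n a := fun a => by positivity
  -- The common scale of all remainders: it dominates both the local score and `(T h)^{-1/2}`.
  set N : ℕ × Ω → ℝ := fun a => ‖Ψ a‖ + n a with hNdef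
  have hN0 : ∀ a, 0 ≤ N a := fun a => add_nonneg (norm_nonneg _) (hn0 a)
  have hΨN : Ψ =O[l] N := IsBigO.of_bound 1 (Eventually.of_forall fun a => by
    rw [one_mul, Real.norm_of_nonneg (hN0 a)]
    exact le_add_of_nonneg_right (hn0 a))
  have hnN : n =O[l] N := IsBigO.of_bound 1 (Eventually.of_forall fun a => by
    rw [one_mul, Real.norm_of_nonneg (hN0 a), Real.norm_of_nonneg (hn0 a)]
    exact le_add_of_nonneg_left (norm_nonneg _))
  have hobs : ∀ᶠ a in l, ρhat a.1 a.2 ∈ M.Γ ∧ IsMinOn (M.localCrit a.1 u a.2) M.Γ (ρhat a.1 a.2) :=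
    eventually_highProb_iff.2 hest.argmin_obs
  have hsim : ∀ j, ∀ᶠ a in l, ∀ θ ∈ M.Θ, ρsim j a.1 θ a.2 ∈ M.Γ ∧
      IsMinOn (M.simCrit j a.1 u θ a.2) M.Γ (ρsim j a.1 θ a.2) := fun j =>
    eventually_highProb_iff.2 (hest.argmin_sim j)
  set R : ℕ × Ω → Vec dρ := fun a => ρhat a.1 a.2 - ρs with hR
  set J := jacobian (M.limScore P u) ρs with hJ
  have hRexp : (fun a => R a + matCLM J⁻¹ (Ψ a)) =o[l] N := by
    obtain ⟨e, he, he'⟩ := exists_equiv_matCLM (hnorm.limScore_invertible u hu)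
    have h1 := auxEstimator_expansion hstruct hdep hpseudo haux hker hu hnorm hρint hobs
    have h2 : (fun a => e (R a) + Ψ a) =o[l] fun a => ‖R a‖ + n a := by
      refine (h1.trans_isBigO (IsBigO.of_bound 1 (Eventually.of_forall fun a => ?_))).congr_left
        fun a => ?_
      · rw [one_mul, Real.norm_of_nonneg (add_nonneg (norm_nonneg _) (hn0 a))]
        exact le_add_of_nonneg_right (hn0 a)
      · rw [he, fderiv_apply_eq_matCLM]
    refine (isLittleO_add_symm_of_isLittleO e hn0 h2).congr_left fun a => ?_
    rw [he']
  have hRN : R =O[l] N := by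
    have h1 := ((matCLM J⁻¹).isBigO_comp Ψ l).trans hΨN
    exact (hRexp.isBigO.sub h1).congr_left fun a => by simp
  set G := B * M.D ρ₀ u with hG
  have hQG : M.Q ρ₀ (Bᵀ * B) u = Gᵀ * G := by
    rw [Q, hG, Matrix.transpose_mul]
    simp only [Matrix.mul_assoc]
  have hGinj : Function.Injective (matCLM G) := by
    intro x y hxy
    rw [hG, matCLM_mul, matCLM_mul] at hxy
    exact matCLM_injective_iff.2 (mulVec_injective_of_rank hnorm.full_rank) (hB hxy)
  -- The least squares solution operator of the design `G = B D`; `G * S` is the orthogonal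
  -- projection onto the range of `G`.
  set S := (M.Q ρ₀ (Bᵀ * B) u)⁻¹ * Gᵀ with hS
  have hGS : Gᵀ * (G * S) = Gᵀ := by
    rw [hS, ← Matrix.mul_assoc, ← Matrix.mul_assoc, ← hQG, Matrix.mul_nonsing_inv _ hQ,
      Matrix.one_mul]
  have horth : ∀ (y : Vec dρ) (x : Vec dθ),
      inner ℝ (y - matCLM G (matCLM S y)) (matCLM G x) = 0 := by
    intro y x
    rw [real_inner_comm, inner_matCLM, map_sub, ← matCLM_mul, ← matCLM_mul, Matrix.mul_assoc, hGS,
      sub_self, inner_zero_right]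
  have hmain := isLittleO_argmin_sub (l := l) hGinj horth
    (m := fun a τ => matCLM B (avgSim ρsim a.1 (θs + τ) a.2 - ρs))
    (b := fun a => matCLM B (R a)) (N := N) (K := {τ | θs + τ ∈ M.Θ})
    (t := fun a => θhat a.1 a.2 - θs) hN0 hN (((matCLM B).isBigO_comp R l).trans hRN) ?_ ?_ ?_ ?_
  · have h1 := ((matCLM (S * B)).isBigO_comp (fun a => R a + matCLM J⁻¹ (Ψ a)) l).trans_isLittleO
      hRexp
    refine (hmain.add h1).congr_left fun a => ?_
    have h2 : (M.Q ρ₀ (Bᵀ * B) u)⁻¹ * M.Wmat P ρ₀ (Bᵀ * B) u = S * B * J⁻¹ := by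
      rw [hS, hG, Wmat, Matrix.transpose_mul]
      simp only [Matrix.mul_assoc]
      rfl
    rw [h2, map_add, ← matCLM_mul, ← matCLM_mul]
    abel
  · have h1 : ContinuousAt (fun τ : Vec dθ => θs + τ) 0 := by fun_prop
    exact h1 (by simpa using mem_interior_iff_mem_nhds.1 hθint)
  · intro q hq
    have hq' : Tendsto (fun a => θs + q a) l (𝓝 θs) := by simpa using hq.const_add θs
    have h1 := avgSim_expansion hH hstruct hdep hpseudo haux hker hu hnorm hθint hρint hsim hq'
    have h2 : (fun a => ‖θs + q a - θs‖ + n a) =O[l] fun a => ‖q a‖ + N a := by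
      refine IsBigO.of_bound 1 (Eventually.of_forall fun a => ?_)
      have h3 := hn0 a
      have h4 := hN0 a
      rw [add_sub_cancel_left, one_mul, Real.norm_of_nonneg (by positivity),
        Real.norm_of_nonneg (by positivity)]
      simp only [hNdef]
      linarith [norm_nonneg (Ψ a)]
    refine (((matCLM B).isBigO_comp _ l).trans_isLittleO (h1.trans_isBigO h2)).congr_left fun a => ?_
    rw [add_sub_cancel_left, map_sub, fderiv_apply_eq_matCLM, ← matCLM_mul]
    rfl
  · filter_upwards [hest.eventually_norm_le] with a ha x hx
    have h1 := ha.2 _ hx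
    simp only [hR, ← map_sub, sub_sub_sub_cancel_right, add_sub_cancel]
    exact h1
  · have := tendsto_indirectEstimator hH hstruct hdep hpseudo haux hker hu hest hθint hB
    rw [← sub_self θs]
    exact this.sub_const θs

end LIIModel

end

/-! ### Asymptotic normality of the indirect inference estimator. -/

theorem theorem3 {Ω 𝕏 𝕎 : Type*} [MeasurableSpace Ω] [MeasurableSpace 𝕏] [MeasurableSpace 𝕎]
    (P : Measure Ω) [IsProbabilityMeasure P] {dθ dρ dz H : ℕ} (hH : 1 ≤ H)
    (M : LIIModel Ω 𝕏 𝕎 dθ dρ dz H) (ρ₀ : ℝ → Vec dθ → Vec dρ)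
    (V : ℝ → Matrix (Fin dρ) (Fin dρ) ℝ) (W : Matrix (Fin dρ) (Fin dρ) ℝ) (ε : ℝ) (s : ℕ) (u : ℝ)
    (ρhat : ℕ → Ω → Vec dρ) (ρsim : Fin H → ℕ → Vec dθ → Ω → Vec dρ) (θhat : ℕ → Ω → Vec dθ)
    (hstruct : M.StructuralRegularity P) (hdep : M.DependenceConditions P)
    (hpseudo : M.IsPseudoTrue P ρ₀) (haux : M.AuxiliaryRegularity P ρ₀ ε)
    (hker : M.KernelBandwidth s) (hu : u ∈ M.U) (hnorm : M.LocalNormality P ρ₀ V u)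
    (hθint : M.θ₀ u ∈ interior M.Θ) (hρint : ρ₀ u (M.θ₀ u) ∈ interior M.Γ)
    (hW : W.PosDef) (hest : M.IsLIIEstimator P W u ρhat ρsim θhat)
    (hbias : Tendsto (fun T : ℕ => (T : ℝ) * M.h T ^ 3) atTop (𝓝 0)) :
    IsUnit (M.Q ρ₀ W u).det ∧
    TendstoInDistribution
      (fun (T : ℕ) ω => √((T : ℝ) * M.h T) • (θhat T ω - M.θ₀ u))
      atTop (fun x : Vec dθ => x) (fun _ => P)
      (multivariateGaussian 0 ((∫ x, M.K x ^ 2) •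
        ((M.Q ρ₀ W u)⁻¹ * M.Wmat P ρ₀ W u * V u * (M.Wmat P ρ₀ W u)ᵀ * (M.Q ρ₀ W u)⁻¹))) := by
  -- A factor of the weighting matrix turns the weighted distance into a Euclidean one.
  obtain ⟨B, rfl⟩ := hW.posSemidef.exists_eq_transpose_mul_self
  have hB : Function.Injective (matCLM B) := by
    intro x y hxy
    have h1 : matCLM (Bᵀ * B) x = matCLM (Bᵀ * B) y := by
      rw [matCLM_mul, matCLM_mul, hxy]
    exact matCLM_injective_iff.2 (Matrix.mulVec_injective_iff_isUnit.2 hW.isUnit) h1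
  have hQpos : (M.Q ρ₀ (Bᵀ * B) u).PosDef := by
    have := hW.conjTranspose_mul_mul_same (mulVec_injective_of_rank hnorm.full_rank)
    simpa [LIIModel.Q, LIIModel.D] using this
  have hQ : IsUnit (M.Q ρ₀ (Bᵀ * B) u).det := (Matrix.isUnit_iff_isUnit_det _).1 hQpos.isUnit
  refine ⟨hQ, ?_⟩
  set X : ℕ → Ω → Vec dρ :=
    fun T ω => √((T : ℝ) * M.h T) • M.localScore T u ω (ρ₀ u (M.θ₀ u)) with hX
  have hclt := hnorm.score_clt
  have hpos : ∀ᶠ a : ℕ × Ω in highProb P, 0 < √((a.1 : ℝ) * M.h a.1) := by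
    filter_upwards [tendsto_fst_highProb.eventually (eventually_ge_atTop 1)] with a ha
    exact Real.sqrt_pos.2 (hker.Th_pos ha)
  -- Multiplied by `√(T h)`, the scale of the remainders becomes `‖X‖ + 1`, the form in which
  -- tightness of the normalized score `X` applies.
  have hscale : ∀ᶠ a : ℕ × Ω in highProb P, ‖X a.1 a.2‖ + 1 = √((a.1 : ℝ) * M.h a.1) *
      (‖M.localScore a.1 u a.2 (ρ₀ u (M.θ₀ u))‖ + (√((a.1 : ℝ) * M.h a.1))⁻¹) := by
    filter_upwards [hpos] with a ha
    rw [hX, norm_smul, Real.norm_of_nonneg ha.le, mul_add, mul_inv_cancel₀ ha.ne']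
  have hinv : Tendsto (fun a : ℕ × Ω => (√((a.1 : ℝ) * M.h a.1))⁻¹) (highProb P) (𝓝 0) :=
    (tendsto_inv_atTop_zero.comp (Real.tendsto_sqrt_atTop.comp hker.Th_top)).comp
      tendsto_fst_highProb
  have hN := TendstoInDistribution.tendsto_zero_of_isLittleO hclt
    (R := fun a : ℕ × Ω => ‖M.localScore a.1 u a.2 (ρ₀ u (M.θ₀ u))‖ +
      (√((a.1 : ℝ) * M.h a.1))⁻¹) (by
    have h1 := ((Asymptotics.isLittleO_one_iff ℝ).2 hinv).mul_isBigO
      (Asymptotics.isBigO_refl (fun a : ℕ × Ω => ‖X a.1 a.2‖ + 1) (highProb P))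
    simp only [one_mul] at h1
    refine h1.congr' ?_ EventuallyEq.rfl
    filter_upwards [hpos, hscale] with a ha h2
    rw [h2, inv_mul_cancel_left₀ ha.ne'])
  have hexp := LIIModel.indirectEstimator_expansion hH hstruct hdep hpseudo haux hker hu hnorm hθint hρint hB
    hest hQ hN
  set A := (M.Q ρ₀ (Bᵀ * B) u)⁻¹ * M.Wmat P ρ₀ (Bᵀ * B) u with hA
  have hrem : Tendsto (fun a : ℕ × Ω => √((a.1 : ℝ) * M.h a.1) • (θhat a.1 a.2 - M.θ₀ u) -
      matCLM (-A) (X a.1 a.2)) (highProb P) (𝓝 0) := by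
    refine TendstoInDistribution.tendsto_zero_of_isLittleO hclt ?_
    have h1 := (Asymptotics.isBigO_refl (fun a : ℕ × Ω => √((a.1 : ℝ) * M.h a.1))
      (highProb P)).smul_isLittleO hexp
    refine h1.congr' (Eventually.of_forall fun a => ?_) ?_
    · simp only [matCLM_neg, hX, map_smul, smul_add, smul_neg, sub_neg_eq_add]
    · filter_upwards [hscale] with a ha
      exact ha.symm
  have hκ : 0 ≤ ∫ x, M.K x ^ 2 := integral_nonneg fun x => sq_nonneg _
  have hV := (hnorm.V_posSemidef u hu).smul hκ
  refine TendstoInDistribution.of_map_eq (TendstoInDistribution.of_tendsto_sub_linear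
    (matCLM (-A)) hclt (fun T => ?_) hrem) ?_
  · have := hest.θhat_meas T
    exact Measurable.aemeasurable (by fun_prop)
  · rw [map_multivariateGaussian_matCLM hV]
    congr 1
    -- The covariance is `(-A) (κ₂ V) (-A)ᵀ`: the signs cancel, and `Q⁻¹` is its own transpose.
    have hQt : ((M.Q ρ₀ (Bᵀ * B) u)⁻¹)ᵀ = (M.Q ρ₀ (Bᵀ * B) u)⁻¹ := by
      simpa using hQpos.inv.isHermitian.eq
    rw [Matrix.transpose_neg, Matrix.neg_mul, Matrix.mul_neg, Matrix.neg_mul,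
      neg_neg, hA, Matrix.transpose_mul, hQt,
      Matrix.mul_smul, Matrix.smul_mul]
    simp only [Matrix.mul_assoc]
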